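/- Use the Fourier transform $\mathcal F f(\eta)=\widehat f(\eta)=\int_{\mathbb R} e^{-2\pi i\eta x}f(x)\,dx$, extended to a unitary operator on $L^2(\mathbb R)$. For real numbers $\xi_1<\dots<\xi_N$ and $k\in\mathbb Z$ put $$R_k=\bigcup_{j=1}^N(\xi_j-2^{-k},\,\xi_j+2^{-k}),\qquad \Pi_k[f]=\mathcal F^{-1}\big[1_{R_k}\widehat f\,\big]\quad(f\in L^2(\mathbb R)).$$ For $a:\mathbb Z\to\mathbb C$ and $0<r<\infty$ let $$\|a(k)\|_{V^r_k}=\sup_{n\ge 0,\;k_0<\dots<k_n\text{ in }\mathbb Z}\Big(|a(k_0)|^r+\sum_{j=1}^n|a(k_j)-a(k_{j-1})|^r\Big)^{1/r}\in[0,\infty].$$ **Theorem 7.1.** For every $r>2$ and $\epsilon>0$ there is a finite constant $C_{r,\epsilon}$, depending only on $r$ and $\epsilon$, such that for every $N\ge 1$, all real $\xi_1<\dots<\xi_N$ and every $f\in L^2(\mathbb R)$, $$\Big(\int_{\mathbb R}\big\|\Pi_k[f](x)\big\|_{V^r_k}^2\,dx\Big)^{1/2}\le C_{r,\epsilon}\,N^{\epsilon}\,\|f\|_{L^2(\mathbb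 R)}.$$ -/

import Mathlib

open MeasureTheory FourierTransform
open scoped ENNReal NNReal

namespace MultiFreq

/-- The `r`-variation norm of a family `a` of complex numbers over a linearly ordered index set:
the supremum of `(|a(t₀)|^r + ∑_{j=1}^n |a(t_j) - a(t_{j-1})|^r)^{1/r}` over all `n` and all
`t₀ < ⋯ < t_n`, as an element of `[0, ∞]`. -/
noncomputable def varNorm {ι : Type*} [LinearOrder ι] (r : ℝ) (a : ι → ℂ) : ℝ≥0∞ :=
  ⨆ (n : ℕ) (t : Fin (n + 1) → ι) (_ : StrictMono t),
    (‖a (t 0)‖ₑ ^ r + ∑ j : Fin n, ‖a (t j.succ) - a (t j.castSucc)‖ₑ ^ r) ^ (1 / r)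

/-- The set `R_k = ⋃_j (ξ_j - 2^{-k}, ξ_j + 2^{-k})`. -/
def freqSet {N : ℕ} (ξ : Fin N → ℝ) (k : ℤ) : Set ℝ :=
  ⋃ j, Set.Ioo (ξ j - (2 : ℝ) ^ (-k)) (ξ j + (2 : ℝ) ^ (-k))

theorem measurableSet_freqSet {N : ℕ} (ξ : Fin N → ℝ) (k : ℤ) :
    MeasurableSet (freqSet ξ k) :=
  MeasurableSet.iUnion fun _ => measurableSet_Ioo

/-- Multiplication of an `L²(ℝ)` function by the indicator function of a measurable set. -/
noncomputable def restrictLp (s : Set ℝ) (hs : MeasurableSet s)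
    (g : Lp ℂ 2 (volume : Measure ℝ)) : Lp ℂ 2 (volume : Measure ℝ) :=
  ((Lp.memLp g).indicator hs).toLp (s.indicator g)

/-- The sharp multi-frequency projection `Π_k f = 𝓕⁻¹ (1_{R_k} · 𝓕 f)` on `L²(ℝ)`, where `𝓕` is the
Fourier transform on `L²(ℝ)`, normalised by `𝓕 f(η) = ∫ e^{-2πi η x} f(x) dx` for Schwartz `f`. -/
noncomputable def freqProj {N : ℕ} (ξ : Fin N → ℝ) (k : ℤ)
    (f : Lp ℂ 2 (volume : Measure ℝ)) : Lp ℂ 2 (volume : Measure ℝ) :=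
  𝓕⁻ (restrictLp (freqSet ξ k) (measurableSet_freqSet ξ k) (𝓕 f))

end MultiFreq

/-! The mechanism is orthogonality between frequencies plus a martingale variation estimate at each
frequency. It gives a bound by a multiple of `log N`, which is then absorbed into `N ^ ε`.

Suppose first that the frequencies are `1/λ`-separated and that only neighbourhoods of radius at
most `1/λ` occur. Moving each frequency to the origin writes the truncation as an exponential sum `∑
e(ξ_i x) u_i(x)`, with `u_i` a low-pass function. The sharp low-pass of radius `2⁻ʲ/λ` is compared
with the average over dyadic cells of length `λ 2ʲ`: a frequency shell at distance `d` in scale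
contributes a factor `2⁻ᵈ`, so the squared errors are summable over all scales
(`sum_lintegral_error_le`). What remains is an exponential sum whose coefficient vector in `ℂᴺ` is a
dyadic martingale and is constant on cells of length `λ`. On such a cell the large sieve
(`lintegral_expSum_sq_le`) replaces the `L²` norm of the sum by the Euclidean norm of its
coefficients, without loss in `N`.

For the martingale, each path is sampled, for every `m`, at the times when it has moved by `2⁻ᵐ` of
its running maximum (`skel`). The jumps at each level are square summable by an energy identity
(`tree_sum_skelSq_le`). The first `m₀` levels are handled by the large sieve at every jump. The
residual is handled pointwise by Cauchy–Schwarz: this costs `N^(r/2)`, repaid by `2^(-m₀(r-2))`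
because `r > 2`, and the finer levels then sum geometrically (`varNorm_residual_sq_le`). Taking `m₀`
comparable to `log N` gives `lintegral_varNorm_separated_le`.

In general the line is cut into half-Voronoi cells of the `ξ_i`. At scale `k` a cell is active if it
is not yet covered by the `2⁻ᵏ`-neighbourhood of its frequency. Active frequencies are
`2⁻ᵏ`-separated, and the number of active cells is monotone in `k`, so the scales fall into at most
`N + 1` blocks with constant active set. Within a block the separated estimate applies to the
frequencies that the block can remove, and these sets are disjoint for different blocks. The part
common to all scales up to and including a block is one of at most `N + 1` nested sets, controlled
by a Rademacher–Menshov inequality (`lintegral_varNorm_nested_le`). The two parts are combined in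
`lintegral_varNorm_cellSet_le`, and Fatou's lemma removes the restriction to finitely many scales.
-/

namespace MultiFreq

/-! ### Variation norms of sequences. -/

section VarNorm

variable {ι : Type*} [LinearOrder ι] {r : ℝ}

theorem varNorm_rpow_le (hr : 0 < r) {a : ι → ℂ} {X : ℝ≥0∞}
    (h : ∀ (n : ℕ) (t : Fin (n + 1) → ι), StrictMono t →
      ‖a (t 0)‖ₑ ^ r + ∑ j : Fin n, ‖a (t j.succ) - a (t j.castSucc)‖ₑ ^ r ≤ X) :
    varNorm r a ^ r ≤ X := by
  have : varNorm r a ≤ X ^ (1 / r) := by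
    refine iSup_le fun n => iSup_le fun t => iSup_le fun ht => ?_
    exact ENNReal.rpow_le_rpow (h n t ht) (by positivity)
  calc varNorm r a ^ r ≤ (X ^ (1 / r)) ^ r := ENNReal.rpow_le_rpow this hr.le
    _ = X := by rw [← ENNReal.rpow_mul, one_div_mul_cancel hr.ne', ENNReal.rpow_one]

theorem le_varNorm_rpow (hr : 0 < r) (a : ι → ℂ) {n : ℕ} {t : Fin (n + 1) → ι}
    (ht : StrictMono t) :
    ‖a (t 0)‖ₑ ^ r + ∑ j : Fin n, ‖a (t j.succ) - a (t j.castSucc)‖ₑ ^ r ≤ varNorm r a ^ r := by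
  have : (‖a (t 0)‖ₑ ^ r + ∑ j : Fin n, ‖a (t j.succ) - a (t j.castSucc)‖ₑ ^ r) ^ (1 / r)
      ≤ varNorm r a := by
    unfold varNorm
    exact le_iSup_of_le n (le_iSup_of_le t (le_iSup_of_le ht le_rfl))
  calc _ = ((‖a (t 0)‖ₑ ^ r + ∑ j : Fin n, ‖a (t j.succ) - a (t j.castSucc)‖ₑ ^ r) ^ (1 / r)) ^ r := by
        rw [← ENNReal.rpow_mul, one_div_mul_cancel hr.ne', ENNReal.rpow_one]
    _ ≤ _ := ENNReal.rpow_le_rpow this hr.le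

theorem enorm_rpow_le_varNorm_rpow (hr : 0 < r) (a : ι → ℂ) (k : ι) :
    ‖a k‖ₑ ^ r ≤ varNorm r a ^ r := by
  have := le_varNorm_rpow hr a (n := 0) (t := fun _ => k) (fun i j h => by omega)
  simpa using this

theorem sum_rpow_le_rpow_sum {α : Type*} (s : Finset α) (y : α → ℝ≥0∞) {q : ℝ} (hq : 1 ≤ q) :
    ∑ i ∈ s, y i ^ q ≤ (∑ i ∈ s, y i) ^ q := by
  classical
  induction s using Finset.induction_on with
  | empty => simp
  | insert i s hi ih =>
    rw [Finset.sum_insert hi, Finset.sum_insert hi]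
    exact (add_le_add le_rfl ih).trans (ENNReal.add_rpow_le_rpow_add _ _ hq)

/-- The embedding `ℓ² ⊂ ℓʳ`, applied to the vector formed by the initial value and the increments.
-/
theorem varNorm_le_varNorm_two (hr : 2 ≤ r) (a : ι → ℂ) : varNorm r a ≤ varNorm 2 a := by
  have h2 : (0 : ℝ) < 2 := by norm_num
  have : varNorm r a ^ r ≤ varNorm 2 a ^ r := by
    refine varNorm_rpow_le (by linarith) fun n t ht => ?_
    have h := le_varNorm_rpow h2 a ht
    have key := sum_rpow_le_rpow_sum Finset.univ
      (fun j : Fin (n + 1) => (Fin.cases (‖a (t 0)‖ₑ ^ (2 : ℝ))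
        (fun j => ‖a (t j.succ) - a (t j.castSucc)‖ₑ ^ (2 : ℝ)) j : ℝ≥0∞)) (q := r / 2) (by linarith)
    rw [Fin.sum_univ_succ, Fin.sum_univ_succ] at key
    simp only [Fin.cases_zero, Fin.cases_succ, ← ENNReal.rpow_mul, mul_div_cancel₀ r h2.ne'] at key
    refine key.trans ((ENNReal.rpow_le_rpow h (by linarith)).trans ?_)
    rw [← ENNReal.rpow_mul, mul_div_cancel₀ r h2.ne']
  exact (ENNReal.rpow_le_rpow_iff (by linarith)).1 this

/-- Minkowski's inequality in `ℓʳ` for the vector formed by the initial value and the increments. -/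
theorem varNorm_add_le (hr : 1 ≤ r) (a b : ι → ℂ) :
    varNorm r (fun k => a k + b k) ≤ varNorm r a + varNorm r b := by
  have hr0 : 0 < r := by linarith
  refine iSup_le fun n => iSup_le fun t => iSup_le fun ht => ?_
  let F (c : ι → ℂ) (j : Fin (n + 1)) : ℝ≥0∞ :=
    Fin.cases (‖c (t 0)‖ₑ) (fun j => ‖c (t j.succ) - c (t j.castSucc)‖ₑ) j
  have hF (c : ι → ℂ) : (∑ j, F c j ^ r) ^ (1 / r) ≤ varNorm r c := by
    unfold varNorm
    refine le_iSup_of_le n (le_iSup_of_le t (le_iSup_of_le ht ?_))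
    rw [Fin.sum_univ_succ]
    simp [F]
  refine le_trans ?_ (add_le_add (hF a) (hF b))
  refine le_trans ?_ (ENNReal.Lp_add_le Finset.univ (F a) (F b) hr)
  refine ENNReal.rpow_le_rpow ?_ (by positivity)
  rw [Fin.sum_univ_succ]
  refine add_le_add ?_ (Finset.sum_le_sum fun j _ => ?_)
  · simp only [F, Fin.cases_zero]
    exact ENNReal.rpow_le_rpow (enorm_add_le _ _) hr0.le
  · simp only [F, Fin.cases_succ]
    refine ENNReal.rpow_le_rpow ?_ hr0.le
    rw [add_sub_add_comm]
    exact enorm_add_le _ _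

theorem varNorm_zero (hr : 0 < r) : varNorm r (fun _ : ι => (0 : ℂ)) = 0 := by
  have : varNorm r (fun _ : ι => (0 : ℂ)) ^ r ≤ 0 := by
    refine varNorm_rpow_le hr fun n t ht => ?_
    simp [hr]
  simpa [hr, hr.le, not_lt.2 hr.le] using this

theorem varNorm_sum_le (hr : 1 ≤ r) {α : Type*} (s : Finset α) (a : α → ι → ℂ) :
    varNorm r (fun k => ∑ i ∈ s, a i k) ≤ ∑ i ∈ s, varNorm r (a i) := by
  classical
  induction s using Finset.induction_on with
  | empty => simp [varNorm_zero (ι := ι) (r := r) (by linarith)]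
  | insert i s hi ih =>
    simp only [Finset.sum_insert hi]
    exact (varNorm_add_le hr _ _).trans (add_le_add le_rfl ih)

theorem measurable_varNorm [Countable ι] {α : Type*} [MeasurableSpace α] {a : ι → α → ℂ}
    (ha : ∀ k, Measurable (a k)) : Measurable fun x => varNorm r (fun k => a k x) := by
  unfold varNorm
  refine Measurable.iSup fun n => Measurable.iSup fun t => Measurable.iSup fun _ => ?_
  fun_prop

/-- Telescoping over a partition along a monotone map. -/
theorem sum_sum_Ico_le_of_monotone {θ : ι → ℕ} (hθ : Monotone θ) {m : ℕ} (hm : ∀ k, θ k ≤ m)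
    (w : ℕ → ℝ≥0∞) {n : ℕ} {t : Fin (n + 1) → ι} (ht : StrictMono t) :
    ∑ j : Fin n, ∑ u ∈ Finset.Ico (θ (t j.castSucc)) (θ (t j.succ)), w u
      ≤ ∑ u ∈ Finset.range m, w u := by
  have key : ∑ j : Fin n, ∑ u ∈ Finset.Ico (θ (t j.castSucc)) (θ (t j.succ)), w u
      = ∑ u ∈ Finset.Ico (θ (t 0)) (θ (t (Fin.last n))), w u := by
    clear hm
    induction n with
    | zero => simp
    | succ n ih =>
      rw [Fin.sum_univ_castSucc]
      have := ih (t := fun j => t j.castSucc) (ht.comp (Fin.strictMono_castSucc))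
      simp only [Fin.succ_castSucc, Fin.castSucc_zero] at this ⊢
      rw [this, Finset.sum_Ico_consecutive _ (hθ (ht.monotone (Fin.zero_le _)))
        (hθ (ht.monotone (Fin.castSucc_lt_succ.le)))]
      rfl
  rw [key]
  refine Finset.sum_le_sum_of_subset fun u hu => ?_
  simp only [Finset.mem_Ico, Finset.mem_range] at hu ⊢
  exact hu.2.trans_le (hm _)

theorem sum_sum_Ico_le_of_antitone {θ : ι → ℕ} (hθ : Antitone θ) {m : ℕ} (hm : ∀ k, θ k ≤ m)
    (w : ℕ → ℝ≥0∞) {n : ℕ} {t : Fin (n + 1) → ι} (ht : StrictMono t) :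
    ∑ j : Fin n, ∑ u ∈ Finset.Ico (θ (t j.succ)) (θ (t j.castSucc)), w u
      ≤ ∑ u ∈ Finset.range m, w u := by
  have key : ∑ j : Fin n, ∑ u ∈ Finset.Ico (θ (t j.succ)) (θ (t j.castSucc)), w u
      = ∑ u ∈ Finset.Ico (θ (t (Fin.last n))) (θ (t 0)), w u := by
    clear hm
    induction n with
    | zero => simp
    | succ n ih =>
      rw [Fin.sum_univ_castSucc]
      have := ih (t := fun j => t j.castSucc) (ht.comp (Fin.strictMono_castSucc))
      simp only [Fin.succ_castSucc, Fin.castSucc_zero] at this ⊢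
      rw [this, add_comm, Finset.sum_Ico_consecutive _
        (hθ (ht.monotone (Fin.castSucc_lt_succ (i := Fin.last n)).le))
        (hθ (ht.monotone (Fin.zero_le _))), Fin.succ_last]
  rw [key]
  refine Finset.sum_le_sum_of_subset fun u hu => ?_
  simp only [Finset.mem_Ico, Finset.mem_range] at hu ⊢
  exact hu.2.trans_le (hm _)

/-- Control of the variation by a superadditive bound on the increments. -/
theorem varNorm_comp_rpow_le (hr : 0 < r) {θ : ι → ℕ} (hθ : Monotone θ ∨ Antitone θ) {m : ℕ}
    (hm : ∀ k, θ k ≤ m) {b : ℕ → ℂ} {B : ℝ≥0∞} {w : ℕ → ℝ≥0∞}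
    (hB : ∀ t ≤ m, ‖b t‖ₑ ^ r ≤ B)
    (hw : ∀ s t, s < t → t ≤ m → ‖b t - b s‖ₑ ^ r ≤ ∑ u ∈ Finset.Ico s t, w u) :
    varNorm r (fun k => b (θ k)) ^ r ≤ B + ∑ u ∈ Finset.range m, w u := by
  refine varNorm_rpow_le hr fun n t ht => add_le_add (hB _ (hm _)) ?_
  have hw' : ∀ s t, s ≤ t → t ≤ m → ‖b t - b s‖ₑ ^ r ≤ ∑ u ∈ Finset.Ico s t, w u := by
    intro s t hst htm
    rcases hst.eq_or_lt with rfl | h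
    · simp [hr]
    · exact hw s t h htm
  rcases hθ with hθ | hθ
  · refine le_trans (Finset.sum_le_sum fun j _ => ?_) (sum_sum_Ico_le_of_monotone hθ hm w ht)
    exact hw' _ _ (hθ (ht.monotone Fin.castSucc_lt_succ.le)) (hm _)
  · refine le_trans (Finset.sum_le_sum fun j _ => ?_) (sum_sum_Ico_le_of_antitone hθ hm w ht)
    rw [← enorm_neg, neg_sub]
    exact hw' _ _ (hθ (ht.monotone Fin.castSucc_lt_succ.le)) (hm _)

theorem enorm_sub_sq_le (x y : ℂ) : ‖x - y‖ₑ ^ 2 ≤ 2 * (‖x‖ₑ ^ 2 + ‖y‖ₑ ^ 2) := by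
  have h1 : ‖x - y‖ₑ ^ 2 ≤ (‖x‖ₑ + ‖y‖ₑ) ^ 2 := by
    gcongr
    exact enorm_sub_le
  refine h1.trans ?_
  have := ENNReal.rpow_add_le_mul_rpow_add_rpow ‖x‖ₑ ‖y‖ₑ (p := 2) (by norm_num)
  norm_num at this
  exact this

/-- The quadratic variation of a step sequence. -/
theorem varNorm_two_step_le {θ : ι → ℕ} (hθ : Monotone θ ∨ Antitone θ) {m : ℕ}
    (hm : ∀ k, θ k ≤ m) (b : ℕ → ℂ) (J : Finset ℕ)
    (hJ : ∀ u < m, u ∉ J → b (u + 1) = b u) :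
    varNorm 2 (fun k => b (θ k)) ^ 2
      ≤ ‖b 0‖ₑ ^ 2 + 5 * ∑ u ∈ J, (‖b u‖ₑ ^ 2 + ‖b (u + 1)‖ₑ ^ 2) := by
  classical
  set v : ℕ → ℝ≥0∞ := fun u => if u ∈ J then ‖b u‖ₑ ^ 2 + ‖b (u + 1)‖ₑ ^ 2 else 0 with hv
  have hconst : ∀ s t, s ≤ t → t ≤ m → (∀ u ∈ Finset.Ico s t, u ∉ J) → b t = b s := by
    intro s t hst
    induction t, hst using Nat.le_induction with
    | base => simp
    | succ t hst ih =>
      intro htm h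
      rw [hJ t (by omega) (h t (by simp [hst]))]
      exact ih (by omega) fun u hu => h u (by simp at hu ⊢; omega)
  -- The value at the right end equals the value just after the last jump, and the value at the left
  -- end equals the value just before the first jump.
  have hend : ∀ s t, s ≤ t → t ≤ m → (∃ u ∈ Finset.Ico s t, u ∈ J) →
      ‖b t‖ₑ ^ 2 ≤ ∑ u ∈ Finset.Ico s t, v u ∧ ‖b s‖ₑ ^ 2 ≤ ∑ u ∈ Finset.Ico s t, v u := by
    intro s t hst htm ⟨u, hu, huJ⟩
    have hne : ((Finset.Ico s t).filter (· ∈ J)).Nonempty := ⟨u, by simp [huJ, Finset.mem_Ico.1 hu]⟩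
    constructor
    · have hmem := Finset.max'_mem _ hne
      set y := ((Finset.Ico s t).filter (· ∈ J)).max' hne
      simp only [Finset.mem_filter, Finset.mem_Ico] at hmem
      have hb : b t = b (y + 1) := hconst _ _ (by omega) htm fun z hz hzJ => by
        simp only [Finset.mem_Ico] at hz
        have := Finset.le_max' ((Finset.Ico s t).filter (· ∈ J)) z
          (by simp only [Finset.mem_filter, Finset.mem_Ico]; exact ⟨by omega, hzJ⟩)
        change z ≤ y at this
        omega
      rw [hb]
      refine le_trans ?_ (Finset.single_le_sum (f := v) (fun _ _ => bot_le) (Finset.mem_Ico.2 hmem.1))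
      simp [hv, hmem.2]
    · have hmem := Finset.min'_mem _ hne
      set y := ((Finset.Ico s t).filter (· ∈ J)).min' hne
      simp only [Finset.mem_filter, Finset.mem_Ico] at hmem
      have hb : b y = b s := hconst _ _ (by omega) (by omega) fun z hz hzJ => by
        simp only [Finset.mem_Ico] at hz
        have := Finset.min'_le ((Finset.Ico s t).filter (· ∈ J)) z
          (by simp only [Finset.mem_filter, Finset.mem_Ico]; exact ⟨by omega, hzJ⟩)
        change y ≤ z at this
        omega
      rw [← hb]
      refine le_trans ?_ (Finset.single_le_sum (f := v) (fun _ _ => bot_le) (Finset.mem_Ico.2 hmem.1))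
      simp [hv, hmem.2]
  have hvJ : ∀ s : Finset ℕ, ∑ u ∈ s, v u ≤ ∑ u ∈ J, (‖b u‖ₑ ^ 2 + ‖b (u + 1)‖ₑ ^ 2) := by
    intro s
    rw [hv, ← Finset.sum_filter]
    refine Finset.sum_le_sum_of_subset fun u hu => (Finset.mem_filter.1 hu).2
  -- The factor 4 comes from splitting the square and charging both end values to the same jumps.
  -- The initial term of the variation adds one more copy, whence the final 5.
  have inc : ∀ s t, s < t → t ≤ m →
      ‖b t - b s‖ₑ ^ (2 : ℝ) ≤ ∑ u ∈ Finset.Ico s t, (4 * v u) := by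
    intro s t hst htm
    rw [ENNReal.rpow_two, ← Finset.mul_sum]
    by_cases h : ∃ u ∈ Finset.Ico s t, u ∈ J
    · obtain ⟨h1, h2⟩ := hend s t hst.le htm h
      calc _ ≤ 2 * (‖b t‖ₑ ^ 2 + ‖b s‖ₑ ^ 2) := enorm_sub_sq_le _ _
        _ ≤ 2 * (∑ u ∈ Finset.Ico s t, v u + ∑ u ∈ Finset.Ico s t, v u) := by gcongr
        _ = _ := by ring
    · push Not at h
      rw [hconst s t hst.le htm h]
      simp
  have hB : ∀ t ≤ m, ‖b t‖ₑ ^ (2 : ℝ) ≤ ‖b 0‖ₑ ^ 2 + ∑ u ∈ J, (‖b u‖ₑ ^ 2 + ‖b (u + 1)‖ₑ ^ 2) := by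
    intro t htm
    rw [ENNReal.rpow_two]
    by_cases h : ∃ u ∈ Finset.Ico 0 t, u ∈ J
    · exact ((hend 0 t (zero_le) htm h).1.trans (hvJ _)).trans le_add_self
    · push Not at h
      rw [hconst 0 t (zero_le) htm h]
      exact le_self_add
  have := varNorm_comp_rpow_le (by norm_num) hθ hm hB inc
  rw [ENNReal.rpow_two, ← Finset.mul_sum] at this
  refine this.trans ?_
  rw [add_assoc]
  refine add_le_add le_rfl ?_
  calc _ ≤ ∑ u ∈ J, (‖b u‖ₑ ^ 2 + ‖b (u + 1)‖ₑ ^ 2)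
        + 4 * ∑ u ∈ J, (‖b u‖ₑ ^ 2 + ‖b (u + 1)‖ₑ ^ 2) := by
        gcongr
        exact hvJ _
    _ = _ := by ring

/-- Every index is treated as a jump. Each value then borders at most two jumps, which gives `11 = 1
+ 5 * 2`. -/
theorem varNorm_two_le_sum_sq {θ : ι → ℕ} (hθ : Monotone θ ∨ Antitone θ) {m : ℕ}
    (hm : ∀ k, θ k ≤ m) (b : ℕ → ℂ) :
    varNorm 2 (fun k => b (θ k)) ^ 2 ≤ 11 * ∑ q ∈ Finset.range (m + 1), ‖b q‖ₑ ^ 2 := by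
  refine (varNorm_two_step_le hθ hm b (Finset.range m) fun u hu h => ?_).trans ?_
  · exact absurd (Finset.mem_range.2 hu) h
  rw [Finset.sum_add_distrib]
  have h0 : ‖b 0‖ₑ ^ 2 ≤ ∑ q ∈ Finset.range (m + 1), ‖b q‖ₑ ^ 2 :=
    Finset.single_le_sum (f := fun q => ‖b q‖ₑ ^ 2) (fun _ _ => bot_le) (by simp)
  have h1 : ∑ q ∈ Finset.range m, ‖b q‖ₑ ^ 2 ≤ ∑ q ∈ Finset.range (m + 1), ‖b q‖ₑ ^ 2 := by
    rw [Finset.sum_range_succ]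
    exact le_self_add
  have h2 : ∑ q ∈ Finset.range m, ‖b (q + 1)‖ₑ ^ 2 ≤ ∑ q ∈ Finset.range (m + 1), ‖b q‖ₑ ^ 2 := by
    rw [Finset.sum_range_succ' (fun q => ‖b q‖ₑ ^ 2)]
    exact le_self_add
  calc _ ≤ ∑ q ∈ Finset.range (m + 1), ‖b q‖ₑ ^ 2 + 5 * (∑ q ∈ Finset.range (m + 1), ‖b q‖ₑ ^ 2
        + ∑ q ∈ Finset.range (m + 1), ‖b q‖ₑ ^ 2) := by gcongr
    _ = _ := by ring

/-- The variation of a family given by different families on consecutive blocks. -/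
theorem varNorm_blocks_rpow_le (hr : 1 ≤ r) {σ : ι → ℕ} (hσ : Monotone σ) {m : ℕ}
    (hm : ∀ k, σ k ≤ m) (A : ℕ → ι → ℂ) :
    varNorm r (fun k => A (σ k) k) ^ r
      ≤ (2 + 2 ^ r) * ∑ q ∈ Finset.range (m + 1), varNorm r (A q) ^ r := by
  have hr0 : 0 < r := by linarith
  set v : ℕ → ℝ≥0∞ := fun q => varNorm r (A q) ^ r with hv
  set V := ∑ q ∈ Finset.range (m + 1), v q with hV
  refine varNorm_rpow_le hr0 fun n t ht => ?_
  have hinit : ‖A (σ (t 0)) (t 0)‖ₑ ^ r ≤ V :=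
    (enorm_rpow_le_varNorm_rpow hr0 _ _).trans
      (Finset.single_le_sum (f := v) (fun _ _ => bot_le)
        (Finset.mem_range.2 (Nat.lt_succ_of_le (hm _))))
  -- An increment inside a block is an increment of that block's family. One that crosses blocks is
  -- bounded by its two end values, charged to the index range between the blocks; these ranges are
  -- disjoint for different `j`.
  have hinc : ∀ j : Fin n, ‖A (σ (t j.succ)) (t j.succ) - A (σ (t j.castSucc)) (t j.castSucc)‖ₑ ^ r
      ≤ ∑ q ∈ Finset.range (m + 1), ‖A q (t j.succ) - A q (t j.castSucc)‖ₑ ^ r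
        + ∑ u ∈ Finset.Ico (σ (t j.castSucc)) (σ (t j.succ)), (2 ^ (r - 1) * (v u + v (u + 1))) := by
    intro j
    rcases (hσ (ht.monotone (Fin.castSucc_lt_succ (i := j)).le)).eq_or_lt with h | h
    · rw [← h]
      refine le_trans ?_ le_self_add
      exact Finset.single_le_sum
        (f := fun q => ‖A q (t j.succ) - A q (t j.castSucc)‖ₑ ^ r) (fun _ _ => bot_le)
        (Finset.mem_range.2 (Nat.lt_succ_of_le (hm _)))
    · refine le_trans ?_ le_add_self
      rw [← Finset.mul_sum, Finset.sum_add_distrib]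
      have e1 : ‖A (σ (t j.succ)) (t j.succ)‖ₑ ^ r
          ≤ ∑ u ∈ Finset.Ico (σ (t j.castSucc)) (σ (t j.succ)), v (u + 1) := by
        refine (enorm_rpow_le_varNorm_rpow hr0 _ _).trans ?_
        obtain ⟨y, hy⟩ : ∃ y, σ (t j.succ) = y + 1 := ⟨σ (t j.succ) - 1, by omega⟩
        rw [hy]
        exact Finset.single_le_sum (f := fun u => v (u + 1)) (fun _ _ => bot_le)
          (Finset.mem_Ico.2 (by omega))
      have e2 : ‖A (σ (t j.castSucc)) (t j.castSucc)‖ₑ ^ r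
          ≤ ∑ u ∈ Finset.Ico (σ (t j.castSucc)) (σ (t j.succ)), v u := by
        refine (enorm_rpow_le_varNorm_rpow hr0 _ _).trans ?_
        exact Finset.single_le_sum (f := v) (fun _ _ => bot_le)
          (Finset.mem_Ico.2 (by omega))
      refine (ENNReal.rpow_le_rpow enorm_sub_le hr0.le).trans
        ((ENNReal.rpow_add_le_mul_rpow_add_rpow _ _ hr).trans ?_)
      gcongr 2 ^ (r - 1) * ?_
      rw [add_comm]
      exact add_le_add e2 e1
  have hsame : ∑ j : Fin n, ∑ q ∈ Finset.range (m + 1), ‖A q (t j.succ) - A q (t j.castSucc)‖ₑ ^ r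
      ≤ V := by
    rw [Finset.sum_comm]
    exact Finset.sum_le_sum fun q _ => le_add_self.trans (le_varNorm_rpow hr0 (A q) ht)
  have hcross := sum_sum_Ico_le_of_monotone hσ hm (fun u => 2 ^ (r - 1) * (v u + v (u + 1))) ht
  have hcross' : ∑ u ∈ Finset.range m, (2 : ℝ≥0∞) ^ (r - 1) * (v u + v (u + 1)) ≤ 2 ^ r * V := by
    rw [← Finset.mul_sum, Finset.sum_add_distrib]
    have h1 : ∑ q ∈ Finset.range m, v q ≤ V := by
      rw [hV, Finset.sum_range_succ]
      exact le_self_add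
    have h2 : ∑ q ∈ Finset.range m, v (q + 1) ≤ V := by
      rw [hV, Finset.sum_range_succ' v]
      exact le_self_add
    calc _ ≤ (2 : ℝ≥0∞) ^ (r - 1) * (V + V) := by gcongr
      _ = 2 ^ (r - 1) * 2 ^ (1 : ℝ) * V := by rw [ENNReal.rpow_one]; ring
      _ = _ := by
        rw [← ENNReal.rpow_add _ _ (by norm_num) (by norm_num), sub_add_cancel]
  calc _ ≤ V + (V + 2 ^ r * V) := by
        refine add_le_add hinit ((Finset.sum_le_sum fun j _ => hinc j).trans ?_)
        rw [Finset.sum_add_distrib]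
        exact add_le_add hsame (hcross.trans hcross')
    _ = _ := by ring

end VarNorm

/-- Truncation of an integer to `[-K, K]`. -/
def clamp (K : ℕ) (k : ℤ) : ℤ := max (-K) (min K k)

theorem clamp_mono (K : ℕ) : Monotone (clamp K) := fun _ _ h => by
  simp only [clamp]
  omega

/-- A given finite chain of indices is fixed by `clamp K` for all large `K`. This is the pointwise
input for Fatou's lemma. -/
theorem varNorm_le_liminf_clamp (r : ℝ) (a : ℤ → ℂ) :
    varNorm r a ≤ Filter.liminf (fun K : ℕ => varNorm r (fun k => a (clamp K k))) Filter.atTop := by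
  refine iSup_le fun n => iSup_le fun t => iSup_le fun ht => ?_
  refine Filter.le_liminf_of_le (by isBoundedDefault) ?_
  obtain ⟨K₀, hK₀⟩ : ∃ K₀ : ℕ, ∀ j, (t j).natAbs ≤ K₀ :=
    ⟨∑ j, (t j).natAbs, fun j => Finset.single_le_sum (f := fun j => (t j).natAbs)
      (fun _ _ => bot_le) (Finset.mem_univ j)⟩
  filter_upwards [Filter.eventually_ge_atTop K₀] with K hK
  have hc : ∀ j, clamp K (t j) = t j := fun j => by
    have := hK₀ j
    simp only [clamp]
    omega
  unfold varNorm
  refine le_iSup_of_le n (le_iSup_of_le t (le_iSup_of_le ht ?_))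
  simp only [hc]
  exact le_rfl

/-! ### Sampling a path at jumps relative to its running maximum. -/

section Path

variable {H : Type*} [NormedAddCommGroup H]

/-- Running maximum of the norm along a path. -/
noncomputable def runMax (f : ℕ → H) : ℕ → ℝ
  | 0 => ‖f 0‖
  | t + 1 => max (runMax f t) ‖f (t + 1)‖

open Classical in
/-- The path sampled at the successive times at which it has moved by `2⁻ᵐ` times its running
maximum. -/
noncomputable def skel (f : ℕ → H) (m : ℕ) : ℕ → H
  | 0 => f 0
  | t + 1 => if (1 / 2 : ℝ) ^ m * runMax f (t + 1) ≤ ‖f (t + 1) - skel f m t‖ then f (t + 1)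
      else skel f m t

/-- Square sum of the jumps of `skel`. -/
noncomputable def skelSq (f : ℕ → H) (m : ℕ) (t : ℕ) : ℝ :=
  ‖f 0‖ ^ 2 + ∑ u ∈ Finset.range t, ‖skel f m (u + 1) - skel f m u‖ ^ 2

variable (f : ℕ → H)

theorem runMax_mono : Monotone (runMax f) :=
  monotone_nat_of_le_succ fun _ => le_max_left _ _

theorem norm_le_runMax_self (t : ℕ) : ‖f t‖ ≤ runMax f t := by
  cases t with
  | zero => exact le_rfl
  | succ t => exact le_max_right _ _

theorem runMax_nonneg (t : ℕ) : 0 ≤ runMax f t := (norm_nonneg _).trans (norm_le_runMax_self f t)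

theorem exists_norm_eq_runMax (t : ℕ) : ∃ v ≤ t, ‖f v‖ = runMax f t := by
  induction t with
  | zero => exact ⟨0, le_rfl, rfl⟩
  | succ t ih =>
    rcases le_total (runMax f t) ‖f (t + 1)‖ with h | h
    · exact ⟨t + 1, le_rfl, (max_eq_right h).symm⟩
    · obtain ⟨v, hv, e⟩ := ih
      exact ⟨v, by omega, e.trans (max_eq_left h).symm⟩

theorem skel_jump {m t : ℕ} (h : skel f m (t + 1) ≠ skel f m t) :
    skel f m (t + 1) = f (t + 1) ∧
      (1 / 2 : ℝ) ^ m * runMax f (t + 1) ≤ ‖skel f m (t + 1) - skel f m t‖ := by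
  by_cases hc : (1 / 2 : ℝ) ^ m * runMax f (t + 1) ≤ ‖f (t + 1) - skel f m t‖
  · have : skel f m (t + 1) = f (t + 1) := by rw [skel, if_pos hc]
    rw [this]
    exact ⟨rfl, hc⟩
  · exact absurd (by rw [skel, if_neg hc]) h

theorem norm_sub_skel_le (m t : ℕ) : ‖f t - skel f m t‖ ≤ (1 / 2 : ℝ) ^ m * runMax f t := by
  cases t with
  | zero => simp only [skel, sub_self, norm_zero]; exact mul_nonneg (by positivity) (runMax_nonneg f 0)
  | succ t =>
    rw [skel]
    split_ifs with h
    · rw [sub_self, norm_zero]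
      exact mul_nonneg (by positivity) (runMax_nonneg f _)
    · exact (not_le.1 h).le

theorem norm_skel_le (m t : ℕ) : ‖skel f m t‖ ≤ runMax f t := by
  induction t with
  | zero => exact le_rfl
  | succ t ih =>
    rw [skel]
    split_ifs
    · exact norm_le_runMax_self f _
    · exact ih.trans (runMax_mono f t.le_succ)

theorem skel_eq_of_no_jump {m s t : ℕ} (hst : s ≤ t)
    (h : ∀ u ∈ Finset.Ico s t, skel f m (u + 1) = skel f m u) : skel f m t = skel f m s := by
  induction t, hst using Nat.le_induction with
  | base => rfl
  | succ t hst ih =>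
    rw [h t (by simp [hst])]
    exact ih fun u hu => h u (by simp at hu ⊢; omega)

/-- If the sampled path changes on `[s, t]`, some jump happens when the running maximum is at least
half of its final value. -/
theorem exists_large_jump {m s t : ℕ} (hm : 1 ≤ m)
    (h : ∃ u ∈ Finset.Ico s t, skel f m (u + 1) ≠ skel f m u) :
    ∃ u ∈ Finset.Ico s t,
      (1 / 2 : ℝ) ^ m * runMax f t ≤ 2 * ‖skel f m (u + 1) - skel f m u‖ := by
  suffices hs : ∃ u ∈ Finset.Ico s t, skel f m (u + 1) ≠ skel f m u ∧
      runMax f t ≤ 2 * runMax f (u + 1) by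
    obtain ⟨u, hu, hne, hM⟩ := hs
    refine ⟨u, hu, ?_⟩
    have h1 := (skel_jump f hne).2
    have h2 : (1 / 2 : ℝ) ^ m * runMax f t ≤ (1 / 2 : ℝ) ^ m * (2 * runMax f (u + 1)) := by gcongr
    linarith
  by_contra! hcon
  obtain ⟨u₁, hu₁, hj⟩ := h
  have hlt₁ := hcon u₁ hu₁ hj
  rw [Finset.mem_Ico] at hu₁
  have hs : 2 * runMax f s < runMax f t := by
    have := runMax_mono f (show s ≤ u₁ + 1 by omega)
    linarith
  classical
  have hex : ∃ u, runMax f t ≤ 2 * runMax f u :=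
    ⟨t, by linarith [runMax_nonneg f t]⟩
  -- From the first time `y` at which the running maximum reaches half its final value, no jump is
  -- allowed, so the sample stays frozen at a vector of norm below half the maximum. At the time `v`
  -- where the maximum is attained the path would then be farther from the sample than `2⁻ᵐ ≤ 1/2`
  -- of the maximum permits.
  set y := Nat.find hex with hy
  have hy1 : runMax f t ≤ 2 * runMax f y := Nat.find_spec hex
  have hyt : y ≤ t := Nat.find_min' hex (by linarith [runMax_nonneg f t])
  have hsy : s < y := by
    by_contra hh
    have := runMax_mono f (not_lt.1 hh)
    linarith
  obtain ⟨z, hz⟩ : ∃ z, y = z + 1 := ⟨y - 1, by omega⟩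
  have hzlt : 2 * runMax f z < runMax f t := not_le.1 (Nat.find_min hex (by omega))
  have hnj : ∀ u ∈ Finset.Ico z t, skel f m (u + 1) = skel f m u := by
    intro u hu
    rw [Finset.mem_Ico] at hu
    by_contra hne
    have h1 := hcon u (Finset.mem_Ico.2 ⟨by omega, hu.2⟩) hne
    have h2 := runMax_mono f (show y ≤ u + 1 by omega)
    linarith
  obtain ⟨v, hvt, hv⟩ := exists_norm_eq_runMax f t
  have hyv : y ≤ v := Nat.find_min' hex (by
    have := norm_le_runMax_self f v
    have := runMax_nonneg f v
    linarith)
  have e : skel f m v = skel f m z := skel_eq_of_no_jump f (by omega) fun u hu =>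
    hnj u (by simp at hu ⊢; omega)
  have h1 := norm_sub_skel_le f m v
  have h2 := norm_skel_le f m z
  have h3 : ‖f v‖ ≤ ‖f v - skel f m v‖ + ‖skel f m v‖ := by
    simpa using norm_add_le (f v - skel f m v) (skel f m v)
  rw [e] at h3
  rw [e] at h1
  have h4 : (1 / 2 : ℝ) ^ m ≤ 1 / 2 := by
    calc (1 / 2 : ℝ) ^ m ≤ (1 / 2) ^ 1 := pow_le_pow_of_le_one (by norm_num) (by norm_num) hm
      _ = _ := by norm_num
  have h5 := runMax_mono f hvt
  have h6 : (1 / 2 : ℝ) ^ m * runMax f v ≤ 1 / 2 * runMax f t :=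
    mul_le_mul h4 h5 (runMax_nonneg f v) (by norm_num)
  linarith

/-- Increments of the residual of the sampling at level `m₀` are dominated by single jumps at
finer levels. -/
theorem exists_jump_residual {m₀ s t : ℕ} (hm : 1 ≤ m₀) (hst : s < t) :
    ∃ m ≥ m₀, ∃ u ∈ Finset.Ico s t,
      ‖(f t - skel f m₀ t) - (f s - skel f m₀ s)‖ ≤ 4 * ((1 / 2 : ℝ) ^ m * runMax f t) ∧
      ‖(f t - skel f m₀ t) - (f s - skel f m₀ s)‖ ≤ 8 * ‖skel f m (u + 1) - skel f m u‖ := by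
  set M := runMax f t with hM
  have hM0 : 0 ≤ M := runMax_nonneg f t
  have hres : ∀ m, ‖(f t - skel f m t) - (f s - skel f m s)‖ ≤ 2 * ((1 / 2 : ℝ) ^ m * M) := by
    intro m
    have h1 := norm_sub_skel_le f m t
    have h2 := norm_sub_skel_le f m s
    have h3 : (1 / 2 : ℝ) ^ m * runMax f s ≤ (1 / 2 : ℝ) ^ m * M := by
      gcongr
      exact runMax_mono f hst.le
    have := norm_sub_le (f t - skel f m t) (f s - skel f m s)
    linarith
  have hp0 : 0 ≤ (1 / 2 : ℝ) ^ m₀ * M := by positivity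
  by_cases hj : ∃ u ∈ Finset.Ico s t, skel f m₀ (u + 1) ≠ skel f m₀ u
  · obtain ⟨u, hu, h⟩ := exists_large_jump f hm hj
    refine ⟨m₀, le_rfl, u, hu, ?_, ?_⟩ <;> linarith [hres m₀]
  · push Not at hj
    have e := skel_eq_of_no_jump f hst.le hj
    have hb := hres m₀
    rw [e] at hb ⊢
    rw [sub_sub_sub_cancel_right] at hb ⊢
    set δ := ‖f t - f s‖ with hδ
    rcases (norm_nonneg (f t - f s)).eq_or_lt with h0 | h0
    · refine ⟨m₀, le_rfl, s, by simp [hst], ?_, ?_⟩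
      · rw [hδ, ← h0]; positivity
      · rw [hδ, ← h0]; positivity
    have hMpos : 0 < M := by
      by_contra hh
      have : M = 0 := le_antisymm (not_lt.1 hh) hM0
      rw [this] at hb
      linarith
    classical
    -- With no jump at level `m₀` the increment is that of `f` itself. At the first level whose
    -- tolerance is too small for an increment of size `δ` the sample must jump, and minimality of
    -- the level makes `δ` comparable to that tolerance.
    have hex : ∃ m : ℕ, 2 * ((1 / 2 : ℝ) ^ m * M) < δ := by
      obtain ⟨m, hm⟩ := exists_pow_lt_of_lt_one (show 0 < δ / (2 * M) by positivity)
        (show (1 / 2 : ℝ) < 1 by norm_num)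
      refine ⟨m, ?_⟩
      rw [lt_div_iff₀ (by positivity)] at hm
      linarith
    set m := Nat.find hex
    have h1 : 2 * ((1 / 2 : ℝ) ^ m * M) < δ := Nat.find_spec hex
    have hmm : m₀ < m := by
      by_contra hh
      have : (1 / 2 : ℝ) ^ m₀ ≤ (1 / 2) ^ m :=
        pow_le_pow_of_le_one (by norm_num) (by norm_num) (not_lt.1 hh)
      have : (1 / 2 : ℝ) ^ m₀ * M ≤ (1 / 2) ^ m * M := by gcongr
      linarith
    obtain ⟨z, hz⟩ : ∃ z, m = z + 1 := ⟨m - 1, by omega⟩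
    have h2 : δ ≤ 2 * ((1 / 2 : ℝ) ^ z * M) := not_lt.1 (Nat.find_min hex (by omega))
    have h3 : δ ≤ 4 * ((1 / 2 : ℝ) ^ m * M) := by
      rw [hz, pow_succ]
      linarith
    have hj' : ∃ u ∈ Finset.Ico s t, skel f m (u + 1) ≠ skel f m u := by
      by_contra! hno
      have e' := skel_eq_of_no_jump f hst.le hno
      have := hres m
      rw [e', sub_sub_sub_cancel_right] at this
      linarith
    obtain ⟨u, hu, h⟩ := exists_large_jump f (by omega) hj'
    exact ⟨m, hmm.le, u, hu, h3, by linarith⟩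

/-- The difference of two consecutive samplings is controlled by the jumps. -/
theorem skel_succ_sub_skel_jump_le {m u : ℕ}
    (h : skel f (m + 1) (u + 1) ≠ skel f (m + 1) u ∨ skel f m (u + 1) ≠ skel f m u) :
    ‖skel f (m + 1) u - skel f m u‖ ^ 2 + ‖skel f (m + 1) (u + 1) - skel f m (u + 1)‖ ^ 2
      ≤ 18 * (‖skel f (m + 1) (u + 1) - skel f (m + 1) u‖ ^ 2
        + ‖skel f m (u + 1) - skel f m u‖ ^ 2) := by
  have hM := runMax_mono f (Nat.le_succ u)
  set X := (1 / 2 : ℝ) ^ m * runMax f (u + 1) with hX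
  have hX0 : 0 ≤ X := mul_nonneg (by positivity) (runMax_nonneg f _)
  -- The two squares add up to at most `(9/2) X²`, while a jump at the finer level is at least `X /
  -- 2`; hence `18 = 4 * 9/2`.
  have hval : ∀ v ≤ u + 1, ‖skel f (m + 1) v - skel f m v‖ ≤ 3 / 2 * X := by
    intro v hv
    have h1 := norm_sub_skel_le f (m + 1) v
    have h2 := norm_sub_skel_le f m v
    have h3 : (1 / 2 : ℝ) ^ m * runMax f v ≤ X := by
      rw [hX]
      gcongr
      exact runMax_mono f hv
    have h4 := norm_sub_le (f v - skel f m v) (f v - skel f (m + 1) v)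
    rw [sub_sub_sub_cancel_left] at h4
    rw [pow_succ] at h1
    linarith
  have a1 := hval u (by omega)
  have a2 := hval (u + 1) le_rfl
  have b1 : ‖skel f (m + 1) u - skel f m u‖ ^ 2 ≤ (3 / 2 * X) ^ 2 := by gcongr
  have b2 : ‖skel f (m + 1) (u + 1) - skel f m (u + 1)‖ ^ 2 ≤ (3 / 2 * X) ^ 2 := by gcongr
  rcases h with h | h
  · have := (skel_jump f h).2
    rw [pow_succ] at this
    have h' : 1 / 2 * X ≤ ‖skel f (m + 1) (u + 1) - skel f (m + 1) u‖ := by linarith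
    have : (1 / 2 * X) ^ 2 ≤ ‖skel f (m + 1) (u + 1) - skel f (m + 1) u‖ ^ 2 := by gcongr
    nlinarith [sq_nonneg ‖skel f m (u + 1) - skel f m u‖]
  · have := (skel_jump f h).2
    have : X ^ 2 ≤ ‖skel f m (u + 1) - skel f m u‖ ^ 2 := by gcongr
    nlinarith [sq_nonneg ‖skel f (m + 1) (u + 1) - skel f (m + 1) u‖, sq_nonneg X]

/-- At level 0 a jump is at least the running maximum, which dominates both sampled values. -/
theorem skel_zero_jump_le {u : ℕ} (h : skel f 0 (u + 1) ≠ skel f 0 u) :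
    ‖skel f 0 u‖ ^ 2 + ‖skel f 0 (u + 1)‖ ^ 2 ≤ 2 * ‖skel f 0 (u + 1) - skel f 0 u‖ ^ 2 := by
  have h1 := (skel_jump f h).2
  have h2 := norm_skel_le f 0 u
  have h3 := norm_skel_le f 0 (u + 1)
  have hM := runMax_mono f (Nat.le_succ u)
  simp only [pow_zero, one_mul] at h1
  have b1 : ‖skel f 0 u‖ ^ 2 ≤ ‖skel f 0 (u + 1) - skel f 0 u‖ ^ 2 := by
    gcongr
    exact h2.trans (hM.trans h1)
  have b2 : ‖skel f 0 (u + 1)‖ ^ 2 ≤ ‖skel f 0 (u + 1) - skel f 0 u‖ ^ 2 := by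
    gcongr
    exact h3.trans h1
  linarith

variable {f}

/-- Adaptedness: sampling up to time `t` uses only the history up to `t`, which sibling nodes of a
tree share. -/
theorem runMax_congr {g : ℕ → H} {t : ℕ} (h : ∀ s ≤ t, f s = g s) : runMax f t = runMax g t := by
  induction t with
  | zero => simp [runMax, h 0 le_rfl]
  | succ t ih => rw [runMax, runMax, ih fun s hs => h s (by omega), h _ le_rfl]

theorem skel_congr {g : ℕ → H} {m t : ℕ} (h : ∀ s ≤ t, f s = g s) : skel f m t = skel g m t := by
  induction t with
  | zero => simp [skel, h 0 le_rfl]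
  | succ t ih =>
    rw [skel, skel, ih fun s hs => h s (by omega), h _ le_rfl, runMax_congr h]

theorem skelSq_congr {g : ℕ → H} {m t : ℕ} (h : ∀ s ≤ t, f s = g s) :
    skelSq f m t = skelSq g m t := by
  rw [skelSq, skelSq, h 0 (zero_le)]
  congr 1
  refine Finset.sum_congr rfl fun u hu => ?_
  rw [Finset.mem_range] at hu
  rw [skel_congr fun s hs => h s (by omega), skel_congr fun s hs => h s (by omega)]

end Path

/-! ### Martingale inequalities on a dyadic tree. -/

section Tree

variable {H : Type*} [NormedAddCommGroup H] [InnerProductSpace ℂ H]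

/-- The sequence of values met along the dyadic tree from a root to the leaf `n` at depth `T`. -/
def leafPath (F : ℕ → ℤ → H) (T : ℕ) (n : ℤ) : ℕ → H := fun t => F t (n / 2 ^ (T - t))

theorem sum_Ico_two_mul (h : ℤ → ℝ) (a b : ℤ) :
    ∑ n ∈ Finset.Ico (2 * a) (2 * b), h n = ∑ p ∈ Finset.Ico a b, (h (2 * p) + h (2 * p + 1)) := by
  rw [← Finset.sum_fiberwise_of_maps_to (s := Finset.Ico (2 * a) (2 * b)) (t := Finset.Ico a b)
    (g := fun n => n / 2) (fun n hn => by simp only [Finset.mem_Ico] at hn ⊢; omega)]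
  refine Finset.sum_congr rfl fun p hp => ?_
  have : (Finset.Ico (2 * a) (2 * b)).filter (fun n => n / 2 = p) = {2 * p, 2 * p + 1} := by
    ext n
    simp only [Finset.mem_filter, Finset.mem_Ico, Finset.mem_insert, Finset.mem_singleton] at hp ⊢
    omega
  rw [this, Finset.sum_pair (by omega)]

/-- The supermartingale principle: `Φ` depends on the past only, and its mean over two children
whose mean is the parent does not exceed its value at the parent. Summing over leaves and descending
to the roots gives the sign. -/
theorem tree_sum_nonpos (F : ℕ → ℤ → H) (Φ : ℕ → (ℕ → H) → ℝ)
    (hcongr : ∀ t f g, (∀ s ≤ t, f s = g s) → Φ t f = Φ t g) (h0 : ∀ f, Φ 0 f ≤ 0)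
    (hstep : ∀ t f g, (∀ s ≤ t, f s = g s) → (2 : ℂ) • f t = f (t + 1) + g (t + 1) →
      Φ (t + 1) f + Φ (t + 1) g ≤ 2 * Φ t f) (a b : ℤ) (T : ℕ)
    (hF : ∀ t < T, ∀ q, (2 : ℂ) • F t q = F (t + 1) (2 * q) + F (t + 1) (2 * q + 1)) :
    ∑ n ∈ Finset.Ico (2 ^ T * a) (2 ^ T * b), Φ T (leafPath F T n) ≤ 0 := by
  induction T with
  | zero => exact Finset.sum_nonpos fun n _ => h0 _
  | succ T ih =>
    have hpath : ∀ p e : ℤ, 0 ≤ e → e < 2 → ∀ s ≤ T,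
        leafPath F (T + 1) (2 * p + e) s = leafPath F T p s := by
      intro p e he he' s hs
      unfold leafPath
      have h1 : T + 1 - s = (T - s) + 1 := by omega
      rw [h1, pow_succ', ← Int.ediv_ediv_of_nonneg (by norm_num)]
      congr 2
      omega
    rw [pow_succ', mul_assoc, mul_assoc, sum_Ico_two_mul]
    refine le_trans (Finset.sum_le_sum (g := fun p => 2 * Φ T (leafPath F T p)) fun p _ => ?_) ?_
    · have hL := hpath p 0 le_rfl (by norm_num)
      have hR := hpath p 1 (by norm_num) (by norm_num)
      rw [add_zero] at hL
      refine (hstep T _ (leafPath F (T + 1) (2 * p + 1)) (fun s hs => by rw [hL s hs, hR s hs]) ?_).trans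
        (by rw [hcongr T _ _ hL])
      rw [hL T le_rfl]
      have := hF T (by omega) p
      simpa [leafPath] using this
    · rw [← Finset.mul_sum]
      have := ih fun t ht => hF t (by omega)
      linarith

/-- Whether or not a jump occurs, `skelSq + ‖f - skel‖²` becomes its old `skelSq` plus `‖f (t+1) -
p‖²`, where `p` is the previous sample. Since `‖f - p‖² - ‖f‖²` is affine in `f`, the compensated
quantity is a martingale. The jump rule plays no role. -/
theorem tree_sum_skelSq_le (F : ℕ → ℤ → H) (m : ℕ) (a b : ℤ) (T : ℕ)
    (hF : ∀ t < T, ∀ q, (2 : ℂ) • F t q = F (t + 1) (2 * q) + F (t + 1) (2 * q + 1)) :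
    ∑ n ∈ Finset.Ico (2 ^ T * a) (2 ^ T * b), skelSq (leafPath F T n) m T
      ≤ ∑ n ∈ Finset.Ico (2 ^ T * a) (2 ^ T * b), ‖F T n‖ ^ 2 := by
  have key := tree_sum_nonpos F
    (fun t f => skelSq f m t + ‖f t - skel f m t‖ ^ 2 - ‖f t‖ ^ 2) ?_ ?_ ?_ a b T hF
  · rw [Finset.sum_sub_distrib, Finset.sum_add_distrib] at key
    have h1 : 0 ≤ ∑ n ∈ Finset.Ico (2 ^ T * a) (2 ^ T * b),
        ‖leafPath F T n T - skel (leafPath F T n) m T‖ ^ 2 := Finset.sum_nonneg fun _ _ => by positivity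
    have h2 : ∀ n, leafPath F T n T = F T n := fun n => by simp [leafPath]
    simp only [h2] at key h1
    linarith
  · intro t f g h
    rw [skelSq_congr h, skel_congr h, h t le_rfl]
  · intro f
    simp [skelSq, skel]
  · intro t f g h hfg
    have hone : ∀ e : ℕ → H, skelSq e m (t + 1) + ‖e (t + 1) - skel e m (t + 1)‖ ^ 2
        = skelSq e m t + ‖e (t + 1) - skel e m t‖ ^ 2 := by
      intro e
      rw [skelSq, Finset.sum_range_succ, ← add_assoc, ← skelSq]
      by_cases hc : (1 / 2 : ℝ) ^ m * runMax e (t + 1) ≤ ‖e (t + 1) - skel e m t‖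
      · have : skel e m (t + 1) = e (t + 1) := by rw [skel, if_pos hc]
        rw [this]
        simp
      · have : skel e m (t + 1) = skel e m t := by rw [skel, if_neg hc]
        rw [this]
        simp
    rw [hone f, hone g, ← skelSq_congr h, ← skel_congr h]
    set p := skel f m t
    have e1 := norm_sub_sq (𝕜 := ℂ) (f (t + 1)) p
    have e2 := norm_sub_sq (𝕜 := ℂ) (g (t + 1)) p
    have e3 := norm_sub_sq (𝕜 := ℂ) (f t) p
    have e4 : RCLike.re (inner ℂ (f (t + 1)) p) + RCLike.re (inner ℂ (g (t + 1)) p)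
        = 2 * RCLike.re (inner ℂ (f t) p) := by
      rw [← map_add, ← inner_add_left, ← hfg, inner_smul_left]
      simp
    linarith

/-- Doob's `L²` maximal inequality, proved with the supermartingale `M² - 2 M ‖f‖` and the pointwise
bound `M² - 4‖f‖² ≤ 2 (M² - 2 M ‖f‖)`. -/
theorem tree_sum_runMax_sq_le (F : ℕ → ℤ → H) (a b : ℤ) (T : ℕ)
    (hF : ∀ t < T, ∀ q, (2 : ℂ) • F t q = F (t + 1) (2 * q) + F (t + 1) (2 * q + 1)) :
    ∑ n ∈ Finset.Ico (2 ^ T * a) (2 ^ T * b), runMax (leafPath F T n) T ^ 2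
      ≤ 4 * ∑ n ∈ Finset.Ico (2 ^ T * a) (2 ^ T * b), ‖F T n‖ ^ 2 := by
  have key := tree_sum_nonpos F
    (fun t f => runMax f t ^ 2 - 2 * runMax f t * ‖f t‖) ?_ ?_ ?_ a b T hF
  · have h2 : ∀ n, leafPath F T n T = F T n := fun n => by simp [leafPath]
    simp only [h2] at key
    have h3 : ∑ n ∈ Finset.Ico (2 ^ T * a) (2 ^ T * b), (runMax (leafPath F T n) T ^ 2 - 4 * ‖F T n‖ ^ 2)
        ≤ ∑ n ∈ Finset.Ico (2 ^ T * a) (2 ^ T * b),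
          2 * (runMax (leafPath F T n) T ^ 2 - 2 * runMax (leafPath F T n) T * ‖F T n‖) :=
      Finset.sum_le_sum fun n _ => by nlinarith [sq_nonneg (runMax (leafPath F T n) T - 2 * ‖F T n‖)]
    rw [← Finset.mul_sum, Finset.sum_sub_distrib, ← Finset.mul_sum] at h3
    linarith
  · intro t f g h
    rw [runMax_congr h, h t le_rfl]
  · intro f
    simp only [runMax]
    nlinarith [sq_nonneg ‖f 0‖]
  · intro t f g h hfg
    have hone : ∀ e : ℕ → H, runMax e (t + 1) ^ 2 - 2 * runMax e (t + 1) * ‖e (t + 1)‖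
        ≤ runMax e t ^ 2 - 2 * runMax e t * ‖e (t + 1)‖ := by
      intro e
      rw [runMax]
      rcases le_total (runMax e t) ‖e (t + 1)‖ with h | h
      · rw [max_eq_right h]
        nlinarith [sq_nonneg (runMax e t - ‖e (t + 1)‖)]
      · rw [max_eq_left h]
    have h1 := hone f
    have h2 := hone g
    rw [← runMax_congr h] at h2
    have h3 : 2 * ‖f t‖ ≤ ‖f (t + 1)‖ + ‖g (t + 1)‖ := by
      have := norm_add_le (f (t + 1)) (g (t + 1))
      rw [← hfg, norm_smul] at this
      simpa using this
    have h4 := mul_le_mul_of_nonneg_left h3 (runMax_nonneg f t)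
    linarith

end Tree
-- The inverse Fourier transform on `L²` and on compactly supported functions.
theorem fourierInv_continuous {h : ℝ → ℂ} (hi : Integrable h) : Continuous (𝓕⁻ h) := by
  have : (𝓕⁻ h : ℝ → ℂ) = fun x => (𝓕 h : ℝ → ℂ) (-x) :=
    funext fun x => Real.fourierInv_eq_fourier_neg h x
  rw [this]
  have hc : Continuous (𝓕 h : ℝ → ℂ) :=
    VectorFourier.fourierIntegral_continuous Real.continuous_fourierChar
      (by exact continuous_inner) hi
  exact hc.comp continuous_neg

/-- Both sides are tested against smooth compactly supported functions. The `L²` transform passes to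
the test function by duality of tempered distributions, the integral by the multiplication formula.
-/
theorem fourierInv_toLp_ae_eq {h : ℝ → ℂ} (hi : Integrable h) (h2 : MemLp h 2 volume) :
    (𝓕⁻ (h2.toLp h) : Lp ℂ 2 (volume : Measure ℝ)) =ᵐ[volume] (𝓕⁻ h : ℝ → ℂ) := by
  refine ae_eq_of_integral_contDiff_smul_eq
    ((Lp.memLp _).locallyIntegrable (by norm_num)) (fourierInv_continuous hi).locallyIntegrable ?_
  intro g g_smooth g_cpt
  have hg₁ : HasCompactSupport (Complex.ofRealCLM ∘ g) := g_cpt.comp_left rfl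
  have hg₂ : ContDiff ℝ ((⊤ : ℕ∞) : WithTop ℕ∞) (Complex.ofRealCLM ∘ g) := by fun_prop
  set φ := hg₁.toSchwartzMap hg₂ with hφ
  have hφg : ∀ x, φ x = (g x : ℂ) := fun x => rfl
  have e1 : ∫ x, g x • (𝓕⁻ (h2.toLp h) : Lp ℂ 2 (volume : Measure ℝ)) x
      = Lp.toTemperedDistribution (𝓕⁻ (h2.toLp h)) φ := by
    rw [Lp.toTemperedDistribution_apply]
    simp [hφg]
  have e2 : Lp.toTemperedDistribution (𝓕⁻ (h2.toLp h)) φ = ∫ x, (𝓕⁻ φ) x • h x := by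
    rw [← Lp.fourierInv_toTemperedDistribution_eq, TemperedDistribution.fourierInv_apply,
      Lp.toTemperedDistribution_apply]
    refine integral_congr_ae ?_
    filter_upwards [h2.coeFn_toLp] with x hx
    rw [hx]
  rw [e1, e2, SchwartzMap.fourierInv_coe, Real.fourierInv_eq_fourier_comp_neg,
    Real.fourierInv_eq_fourier_comp_neg]
  have hφi : Integrable (fun x => φ (-x)) := φ.integrable.comp_neg
  have := VectorFourier.integral_fourierIntegral_smul_eq_flip (L := innerₗ ℝ)
    Real.continuous_fourierChar (by exact continuous_inner) hφi hi
  rw [flip_innerₗ] at this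
  refine Eq.trans this ?_
  rw [← integral_neg_eq_self]
  refine integral_congr_ae (Filter.Eventually.of_forall fun x => ?_)
  change φ (- -x) • (𝓕 h : ℝ → ℂ) (-x) = g x • (𝓕 (fun y => h (-y)) : ℝ → ℂ) x
  rw [neg_neg, hφg, ← Real.fourierInv_eq_fourier_comp_neg, Real.fourierInv_eq_fourier_neg]
  simp

theorem eLpNorm_two_sq {α E : Type*} [MeasurableSpace α] {μ : Measure α} [ENorm E] (f : α → E) :
    eLpNorm f 2 μ ^ 2 = ∫⁻ x, ‖f x‖ₑ ^ 2 ∂μ := by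
  rw [eLpNorm_eq_lintegral_rpow_enorm_toReal (by norm_num) (by norm_num), ← ENNReal.rpow_two,
    ← ENNReal.rpow_mul]
  norm_num

/-- Plancherel's theorem for the inverse Fourier integral. -/
theorem lintegral_fourierInv_sq {h : ℝ → ℂ} (hi : Integrable h) (h2 : MemLp h 2 volume) :
    ∫⁻ x, ‖(𝓕⁻ h : ℝ → ℂ) x‖ₑ ^ 2 = ∫⁻ η, ‖h η‖ₑ ^ 2 := by
  rw [← eLpNorm_two_sq, ← eLpNorm_two_sq, ← eLpNorm_congr_ae (fourierInv_toLp_ae_eq hi h2),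
    ← Lp.enorm_def]
  have : ‖(𝓕⁻ (h2.toLp h) : Lp ℂ 2 (volume : Measure ℝ))‖ = ‖h2.toLp h‖ :=
    (Lp.fourierTransformₗᵢ ℝ ℂ).symm.norm_map _
  rw [← ofReal_norm, this, ofReal_norm, Lp.enorm_def,
    eLpNorm_congr_ae h2.coeFn_toLp]

/-- Square integrable functions supported in `[-ρ, ρ]`. -/
structure IsBand (ρ : ℝ) (h : ℝ → ℂ) : Prop where
  memLp : MemLp h 2 volume
  support : ∀ η, ρ < |η| → h η = 0

namespace IsBand

variable {ρ : ℝ} {h : ℝ → ℂ}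

theorem integrable (hh : IsBand ρ h) : Integrable h := by
  have hs : Function.support h ⊆ Set.Icc (-ρ) ρ := fun η hη => by
    by_contra hc
    exact hη (hh.support η (by rw [← not_le, abs_le]; exact hc))
  rw [← integrableOn_iff_integrable_of_support_subset hs]
  exact (hh.memLp.restrict _).integrable (by norm_num)

theorem indicator (hh : IsBand ρ h) {s : Set ℝ} (hs : MeasurableSet s) :
    IsBand ρ (s.indicator h) :=
  ⟨hh.memLp.indicator hs, fun η hη => by simp [hh.support η hη]⟩

theorem mul_bounded (hh : IsBand ρ h) {c : ℝ} {m : ℝ → ℂ} (hm : Measurable m)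
    (hc : ∀ η, h η ≠ 0 → ‖m η‖ ≤ c) : IsBand ρ (fun η => m η * h η) := by
  refine ⟨hh.memLp.of_le_mul (c := c) (hm.aestronglyMeasurable.mul hh.memLp.1) ?_,
    fun η hη => by simp [hh.support η hη]⟩
  refine Filter.Eventually.of_forall fun η => ?_
  by_cases h0 : h η = 0
  · simp [h0]
  · rw [norm_mul]
    exact mul_le_mul_of_nonneg_right (hc η h0) (norm_nonneg _)

theorem deriv_symbol (hh : IsBand ρ h) : IsBand ρ (fun η => (2 * Real.pi * Complex.I * η) * h η) := by
  refine hh.mul_bounded (c := 2 * Real.pi * ρ) (by fun_prop) fun η hη => ?_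
  have : |η| ≤ ρ := not_lt.1 fun hc => hη (hh.support η hc)
  simp only [norm_mul, Complex.norm_real, Complex.norm_I, Complex.norm_ofNat, Real.norm_eq_abs,
    abs_of_pos Real.pi_pos, mul_one]
  gcongr

theorem plancherel (hh : IsBand ρ h) :
    ∫⁻ x, ‖(𝓕⁻ h : ℝ → ℂ) x‖ₑ ^ 2 = ∫⁻ η, ‖h η‖ₑ ^ 2 :=
  lintegral_fourierInv_sq hh.integrable hh.memLp

theorem continuous (hh : IsBand ρ h) : Continuous (𝓕⁻ h) := fourierInv_continuous hh.integrable

theorem hasDerivAt (hh : IsBand ρ h) (x : ℝ) :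
    HasDerivAt (𝓕⁻ h) ((𝓕⁻ (fun η => (2 * Real.pi * Complex.I * η) * h η) : ℝ → ℂ) x) x := by
  have h1 : Integrable (fun η : ℝ => η • h η) := by
    have := (hh.mul_bounded (m := fun η => (η : ℂ)) (c := ρ) (by fun_prop) fun η hη => by
      rw [Complex.norm_real]
      exact not_lt.1 fun hc => hη (hh.support η hc)).integrable
    simpa using this
  have h2 := (Real.hasDerivAt_fourier hh.integrable h1 (-x)).scomp x (hasDerivAt_neg x)
  have e : (𝓕⁻ h : ℝ → ℂ) = (𝓕 h : ℝ → ℂ) ∘ fun y => -y :=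
    funext fun y => Real.fourierInv_eq_fourier_neg h y
  rw [e]
  refine HasDerivAt.congr_deriv h2 ?_
  rw [Real.fourierInv_eq_fourier_neg, neg_smul, one_smul, Real.fourier_eq, Real.fourier_eq,
    ← integral_neg]
  refine integral_congr_ae (Filter.Eventually.of_forall fun η => ?_)
  simp only [smul_eq_mul, Circle.smul_def]
  ring

end IsBand

/-! ### Exponential sums and the large sieve. -/

/-- `e(y) = exp(2πiy)`. -/
noncomputable def ex (y : ℝ) : ℂ := (Real.fourierChar y : ℂ)

theorem norm_ex (y : ℝ) : ‖ex y‖ = 1 := Circle.norm_coe _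

theorem ex_add (x y : ℝ) : ex (x + y) = ex x * ex y := by
  simp [ex, AddChar.map_add_eq_mul]

theorem continuous_ex : Continuous ex := by
  unfold ex
  exact continuous_subtype_val.comp Real.continuous_fourierChar

theorem fourierInv_apply (h : ℝ → ℂ) (x : ℝ) : (𝓕⁻ h : ℝ → ℂ) x = ∫ η, ex (η * x) * h η := by
  rw [Real.fourierInv_eq]
  refine integral_congr_ae (Filter.Eventually.of_forall fun η => ?_)
  simp [ex, Circle.smul_def, mul_comm]

theorem fourierInv_shift (h : ℝ → ℂ) (ξ x : ℝ) :
    (𝓕⁻ h : ℝ → ℂ) x = ex (ξ * x) * (𝓕⁻ (fun η => h (η + ξ)) : ℝ → ℂ) x := by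
  rw [fourierInv_apply, fourierInv_apply, ← integral_add_right_eq_self _ ξ, ← integral_const_mul]
  refine integral_congr_ae (Filter.Eventually.of_forall fun η => ?_)
  simp only
  rw [add_mul, ex_add]
  ring

theorem integrable_ex_mul {h : ℝ → ℂ} (hi : Integrable h) (x : ℝ) :
    Integrable (fun η => ex (η * x) * h η) := by
  refine hi.bdd_mul (c := 1) ?_ (Filter.Eventually.of_forall fun η => (norm_ex _).le)
  exact (continuous_ex.comp (by fun_prop)).aestronglyMeasurable

theorem fourierInv_finset_sum {α : Type*} (s : Finset α) {h : α → ℝ → ℂ}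
    (hi : ∀ i ∈ s, Integrable (h i)) (x : ℝ) :
    (𝓕⁻ (fun η => ∑ i ∈ s, h i η) : ℝ → ℂ) x = ∑ i ∈ s, (𝓕⁻ (h i) : ℝ → ℂ) x := by
  simp only [fourierInv_apply, Finset.mul_sum]
  exact integral_finsetSum _ fun i hi' => integrable_ex_mul (hi i hi') x

theorem fourierInv_sub' {h g : ℝ → ℂ} (hi : Integrable h) (hg : Integrable g) (x : ℝ) :
    (𝓕⁻ (fun η => h η - g η) : ℝ → ℂ) x = (𝓕⁻ h : ℝ → ℂ) x - (𝓕⁻ g : ℝ → ℂ) x := by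
  simp only [fourierInv_apply, mul_sub]
  exact integral_sub (integrable_ex_mul hi x) (integrable_ex_mul hg x)

theorem norm_ex_sub_one_le (y : ℝ) : ‖ex y - 1‖ ≤ 2 * Real.pi * |y| := by
  have h : ex y = Complex.exp (Complex.I * ((2 * Real.pi * y : ℝ) : ℂ)) := by
    rw [ex, Real.fourierChar_apply, mul_comm]
  rw [h]
  refine (Real.norm_exp_I_mul_ofReal_sub_one_le).trans ?_
  rw [Real.norm_eq_abs, abs_mul, abs_of_pos (by positivity)]

/-- The exponential sum with frequencies `ξ` and coefficients `c`. -/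
noncomputable def expSum {ι : Type*} [Fintype ι] (ξ : ι → ℝ) (c : ι → ℂ) (x : ℝ) : ℂ :=
  ∑ i, ex (ξ i * x) * c i

theorem continuous_expSum {ι : Type*} [Fintype ι] (ξ : ι → ℝ) (c : ι → ℂ) :
    Continuous (expSum ξ c) := by
  unfold expSum
  exact continuous_finsetSum _ fun i _ =>
    (continuous_ex.comp (by fun_prop)).mul continuous_const

theorem enorm_sq_sum_indicator {ι : Type*} [Fintype ι] {S : ι → Set ℝ}
    (hS : Pairwise (Function.onFun Disjoint S)) (c : ι → ℂ) (η : ℝ) :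
    ‖∑ i, (S i).indicator (fun _ => c i) η‖ₑ ^ 2
      = ∑ i, (S i).indicator (fun _ => ‖c i‖ₑ ^ 2) η := by
  by_cases h : ∃ i, η ∈ S i
  · obtain ⟨i, hi⟩ := h
    have hne : ∀ j, j ≠ i → η ∉ S j := fun j hj hj' =>
      Set.disjoint_left.1 (hS hj) hj' hi
    rw [Finset.sum_eq_single i (fun j _ hj => by simp [hne j hj]) (by simp),
      Finset.sum_eq_single i (fun j _ hj => by simp [hne j hj]) (by simp)]
    simp [hi]
  · push Not at h
    simp [h]

/-- The large sieve inequality on an interval whose length is at least the inverse of the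
separation. -/
theorem lintegral_expSum_sq_le {ι : Type*} [Fintype ι] {ξ : ι → ℝ} {ℓ : ℝ} (hℓ : 0 < ℓ)
    (hsep : ∀ i j, i ≠ j → ℓ⁻¹ ≤ |ξ i - ξ j|) (c : ι → ℂ) (a : ℝ) :
    ∫⁻ x in Set.Ico a (a + ℓ), ‖expSum ξ c x‖ₑ ^ 2 ≤ ENNReal.ofReal (32 * ℓ) * ∑ i, ‖c i‖ₑ ^ 2 := by
  -- Small enough that the intervals `[ξ i, ξ i + δ)` are disjoint and that their phases barely turn
  -- over a window of length `ℓ`. The final constant is `(4 / δ²) * δ = 32 ℓ`.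
  set δ : ℝ := (8 * ℓ)⁻¹ with hδ
  have hδ0 : 0 < δ := by positivity
  have hδℓ : δ * ℓ = 1 / 8 := by rw [hδ]; field_simp
  set x₀ := a + ℓ / 2
  -- This modulation moves the centre `x₀` of the window to the origin. The step function `h` with
  -- heights `d i` then has inverse transform equal to the exponential sum times the kernel `K`.
  set d : ι → ℂ := fun i => c i * ex (ξ i * x₀) with hd
  set S : ι → Set ℝ := fun i => Set.Ico (ξ i) (ξ i + δ)
  have hS : Pairwise (Function.onFun Disjoint S) := by
    intro i j hij
    refine Set.disjoint_left.2 fun η h1 h2 => ?_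
    have h3 := hsep i j hij
    have h4 : δ < ℓ⁻¹ := by
      rw [hδ, mul_inv]
      have : 0 < ℓ⁻¹ := by positivity
      linarith
    simp only [S, Set.mem_Ico] at h1 h2
    have : |ξ i - ξ j| < δ := by
      rw [abs_lt]
      constructor <;> linarith
    linarith
  set h : ℝ → ℂ := fun η => ∑ i, (S i).indicator (fun _ => d i) η with hh
  have hSm : ∀ i, MeasurableSet (S i) := fun i => measurableSet_Ico
  have hSv : ∀ i, volume (S i) = ENNReal.ofReal δ := fun i => by simp [S]
  have hmem : ∀ p : ℝ≥0∞, ∀ i, MemLp ((S i).indicator (fun _ => d i)) p volume := fun p i =>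
    memLp_indicator_const p (hSm i) (d i) (Or.inr (by rw [hSv]; simp))
  have hint : ∀ i, Integrable ((S i).indicator (fun _ => d i)) := fun i =>
    memLp_one_iff_integrable.1 (hmem 1 i)
  have hi : Integrable h := integrable_finsetSum _ fun i _ => hint i
  have h2 : MemLp h 2 volume := memLp_finsetSum _ fun i _ => hmem 2 i
  set K : ℝ → ℂ := fun y => ∫ t in Set.Ico 0 δ, ex (t * y) with hK
  have hF : ∀ y, (𝓕⁻ h : ℝ → ℂ) y = (∑ i, d i * ex (ξ i * y)) * K y := by
    intro y
    rw [hh, fourierInv_finset_sum _ fun i _ => hint i, Finset.sum_mul]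
    refine Finset.sum_congr rfl fun i _ => ?_
    rw [fourierInv_shift _ (ξ i), fourierInv_apply, hK]
    simp only
    have : ∀ η, ex (η * y) * (S i).indicator (fun _ => d i) (η + ξ i)
        = d i * (Set.Ico 0 δ).indicator (fun t => ex (t * y)) η := by
      intro η
      have e : η + ξ i ∈ S i ↔ η ∈ Set.Ico 0 δ := by
        simp only [S, Set.mem_Ico]
        constructor <;> rintro ⟨h1, h2⟩ <;> constructor <;> linarith
      by_cases hη : η ∈ Set.Ico 0 δ
      · rw [Set.indicator_of_mem hη, Set.indicator_of_mem (e.2 hη), mul_comm]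
      · rw [Set.indicator_of_notMem hη, Set.indicator_of_notMem (mt e.1 hη), mul_zero, mul_zero]
    simp only [this]
    rw [integral_const_mul, integral_indicator measurableSet_Ico]
    ring
  -- Here `|t y| ≤ 1/16`, so the integrand of `K` differs from 1 by at most `2π/16 < 1/2`.
  have hKlow : ∀ y, |y| ≤ ℓ / 2 → δ / 2 ≤ ‖K y‖ := by
    intro y hy
    have hc : Continuous fun t : ℝ => ex (t * y) := continuous_ex.comp (by fun_prop)
    have e1 : K y - δ = ∫ t in Set.Ico 0 δ, (ex (t * y) - 1) := by
      rw [integral_sub]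
      · simp [hK, hδ0.le]
      · exact (hc.integrableOn_Icc).mono_set Set.Ico_subset_Icc_self
      · simp
    have e2 : ‖K y - δ‖ ≤ (1 / 2) * (volume : Measure ℝ).real (Set.Ico 0 δ) := by
      rw [e1]
      refine norm_setIntegral_le_of_norm_le_const (by simp) fun t ht => ?_
      refine (norm_ex_sub_one_le _).trans ?_
      rw [abs_mul, abs_of_nonneg ht.1]
      have : t * |y| ≤ δ * (ℓ / 2) := mul_le_mul ht.2.le hy (abs_nonneg _) hδ0.le
      have : t * |y| ≤ 1 / 16 := by linarith
      have := Real.pi_lt_four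
      nlinarith [Real.pi_pos, mul_nonneg ht.1 (abs_nonneg y)]
    simp only [Measure.real, Real.volume_Ico, sub_zero, ENNReal.toReal_ofReal hδ0.le] at e2
    have e3 : ‖(δ : ℂ)‖ = δ := by rw [Complex.norm_real, Real.norm_of_nonneg hδ0.le]
    have e4 := norm_sub_norm_le (δ : ℂ) (K y)
    rw [norm_sub_rev, e3] at e4
    linarith
  have hpt : ∀ y, |y| ≤ ℓ / 2 → ENNReal.ofReal (δ / 2) ^ 2 * ‖expSum ξ c (y + x₀)‖ₑ ^ 2
      ≤ ‖(𝓕⁻ h : ℝ → ℂ) y‖ₑ ^ 2 := by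
    intro y hy
    rw [← mul_pow]
    gcongr
    rw [hF, enorm_mul, mul_comm]
    refine mul_le_mul' (le_of_eq ?_) ?_
    · congr 1
      refine Finset.sum_congr rfl fun i _ => ?_
      rw [hd, mul_add, ex_add]
      ring
    · rw [← ofReal_norm]
      exact ENNReal.ofReal_le_ofReal (hKlow y hy)
  have hplan : ∫⁻ y, ‖(𝓕⁻ h : ℝ → ℂ) y‖ₑ ^ 2 = ENNReal.ofReal δ * ∑ i, ‖c i‖ₑ ^ 2 := by
    rw [lintegral_fourierInv_sq hi h2]
    simp only [hh, enorm_sq_sum_indicator hS]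
    rw [lintegral_finsetSum _ fun i _ => measurable_const.indicator (hSm i), Finset.mul_sum]
    refine Finset.sum_congr rfl fun i _ => ?_
    rw [lintegral_indicator_const (hSm i), hSv, hd, mul_comm]
    simp only [enorm_mul]
    rw [← ofReal_norm (ex _), norm_ex]
    simp
  have hshift : ∫⁻ x in Set.Ico a (a + ℓ), ‖expSum ξ c x‖ₑ ^ 2
      = ∫⁻ y in Set.Ico (-(ℓ / 2)) (ℓ / 2), ‖expSum ξ c (y + x₀)‖ₑ ^ 2 := by
    rw [← lintegral_indicator measurableSet_Ico, ← lintegral_indicator measurableSet_Ico,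
      ← lintegral_add_right_eq_self _ x₀]
    refine lintegral_congr fun y => ?_
    have e : y + x₀ ∈ Set.Ico a (a + ℓ) ↔ y ∈ Set.Ico (-(ℓ / 2)) (ℓ / 2) := by
      simp only [x₀, Set.mem_Ico]
      constructor <;> rintro ⟨h1, h2⟩ <;> constructor <;> linarith
    by_cases hy : y ∈ Set.Ico (-(ℓ / 2)) (ℓ / 2)
    · rw [Set.indicator_of_mem hy, Set.indicator_of_mem (e.2 hy)]
    · rw [Set.indicator_of_notMem hy, Set.indicator_of_notMem (mt e.1 hy)]
  have hfin : ENNReal.ofReal (δ / 2) ^ 2 * ∫⁻ x in Set.Ico a (a + ℓ), ‖expSum ξ c x‖ₑ ^ 2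
      ≤ ENNReal.ofReal δ * ∑ i, ‖c i‖ₑ ^ 2 := by
    rw [hshift, ← hplan, ← lintegral_const_mul' _ _ (by simp)]
    refine le_trans (setLIntegral_mono' measurableSet_Ico fun y hy => hpt y ?_)
      (setLIntegral_le_lintegral _ _)
    rw [abs_le]
    exact ⟨hy.1, hy.2.le⟩
  have hc1 : ENNReal.ofReal (32 * ℓ) = ENNReal.ofReal ((4 / δ ^ 2)) * ENNReal.ofReal δ := by
    rw [← ENNReal.ofReal_mul (by positivity)]
    congr 1
    rw [hδ]
    field_simp
    norm_num
  have hc2 : ENNReal.ofReal (4 / δ ^ 2) * ENNReal.ofReal (δ / 2) ^ 2 = 1 := by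
    rw [← ENNReal.ofReal_pow (by positivity), ← ENNReal.ofReal_mul (by positivity),
      ← ENNReal.ofReal_one]
    congr 1
    field_simp
    norm_num
  calc _ = ENNReal.ofReal (4 / δ ^ 2) * (ENNReal.ofReal (δ / 2) ^ 2
        * ∫⁻ x in Set.Ico a (a + ℓ), ‖expSum ξ c x‖ₑ ^ 2) := by rw [← mul_assoc, hc2, one_mul]
    _ ≤ ENNReal.ofReal (4 / δ ^ 2) * (ENNReal.ofReal δ * ∑ i, ‖c i‖ₑ ^ 2) := by gcongr
    _ = _ := by rw [← mul_assoc, hc1]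

theorem lintegral_sq_le_measure_mul {α : Type*} [MeasurableSpace α] (μ : Measure α)
    {g : α → ℝ≥0∞} (hg : AEMeasurable g μ) :
    (∫⁻ x, g x ∂μ) ^ 2 ≤ μ Set.univ * ∫⁻ x, g x ^ 2 ∂μ := by
  have := ENNReal.lintegral_mul_le_Lp_mul_Lq μ Real.HolderConjugate.two_two
    (f := fun _ => 1) aemeasurable_const hg
  simp only [Pi.mul_apply, one_mul, ENNReal.one_rpow, lintegral_const] at this
  calc _ ≤ (μ Set.univ ^ (1 / 2 : ℝ) * (∫⁻ x, g x ^ (2 : ℝ) ∂μ) ^ (1 / 2 : ℝ)) ^ 2 := by gcongr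
    _ = _ := by
      rw [mul_pow, ← ENNReal.rpow_two, ← ENNReal.rpow_mul, ← ENNReal.rpow_two, ← ENNReal.rpow_mul]
      norm_num

theorem enorm_sub_sq_le_lintegral_deriv {w w' : ℝ → ℂ} (hw : ∀ x, HasDerivAt w (w' x) x)
    (hc : Continuous w') {a ℓ x y : ℝ} (hx : x ∈ Set.Ico a (a + ℓ)) (hy : y ∈ Set.Ico a (a + ℓ)) :
    ‖w x - w y‖ₑ ^ 2 ≤ ENNReal.ofReal ℓ * ∫⁻ t in Set.Ico a (a + ℓ), ‖w' t‖ₑ ^ 2 := by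
  have h1 : w x - w y = ∫ t in y..x, w' t :=
    (intervalIntegral.integral_eq_sub_of_hasDerivAt (fun t _ => hw t)
      (hc.intervalIntegrable _ _)).symm
  have h2 : ‖w x - w y‖ₑ ≤ ∫⁻ t in Set.Ico a (a + ℓ), ‖w' t‖ₑ := by
    rw [h1, ← ofReal_norm, intervalIntegral.norm_integral_eq_norm_integral_uIoc, ofReal_norm]
    refine (enorm_integral_le_lintegral_enorm _).trans (lintegral_mono_set fun t ht => ?_)
    rw [Set.uIoc, Set.mem_Ioc] at ht
    exact ⟨(le_min hy.1 hx.1).trans ht.1.le, ht.2.trans_lt (max_lt hy.2 hx.2)⟩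
  calc _ ≤ (∫⁻ t in Set.Ico a (a + ℓ), ‖w' t‖ₑ) ^ 2 := by gcongr
    _ ≤ _ := by
      refine (lintegral_sq_le_measure_mul _ hc.measurable.enorm.aemeasurable).trans (le_of_eq ?_)
      simp

/-! ### Cell averages of low and high frequency functions. -/

/-- The average of `g` over the cell `[ℓq, ℓ(q+1))`. -/
noncomputable def cellAvg (ℓ : ℝ) (g : ℝ → ℂ) (q : ℤ) : ℂ :=
  (ℓ : ℂ)⁻¹ * ∫ y in Set.Ico (ℓ * q) (ℓ * q + ℓ), g y

theorem iUnion_cells {ℓ : ℝ} (hℓ : 0 < ℓ) :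
    ⋃ q : ℤ, Set.Ico (ℓ * q) (ℓ * q + ℓ) = Set.univ := by
  refine Set.eq_univ_of_forall fun x => Set.mem_iUnion.2 ⟨⌊x / ℓ⌋, ?_, ?_⟩
  · have := Int.floor_le (x / ℓ)
    rw [le_div_iff₀ hℓ] at this
    linarith
  · have := Int.lt_floor_add_one (x / ℓ)
    rw [div_lt_iff₀ hℓ] at this
    linarith

theorem floor_of_mem_cell {ℓ : ℝ} (hℓ : 0 < ℓ) {q : ℤ} {x : ℝ}
    (hx : x ∈ Set.Ico (ℓ * q) (ℓ * q + ℓ)) : ⌊x / ℓ⌋ = q := by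
  rw [Int.floor_eq_iff, le_div_iff₀ hℓ, div_lt_iff₀ hℓ]
  constructor <;> linarith [hx.1, hx.2]

theorem lintegral_eq_tsum_cells {ℓ : ℝ} (hℓ : 0 < ℓ) (g : ℝ → ℝ≥0∞) :
    ∫⁻ x, g x = ∑' q : ℤ, ∫⁻ x in Set.Ico (ℓ * q) (ℓ * q + ℓ), g x := by
  rw [← lintegral_iUnion (fun q => measurableSet_Ico), iUnion_cells hℓ, Measure.restrict_univ]
  intro p q hpq
  refine Set.disjoint_left.2 fun x h1 h2 => hpq ?_
  rw [← floor_of_mem_cell hℓ h1, floor_of_mem_cell hℓ h2]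

section Vector

variable {ι : Type*} [Fintype ι] {ξ : ι → ℝ} {ℓ : ℝ}

theorem lintegral_expSum_cell_le (hℓ : 0 < ℓ) (hsep : ∀ i j, i ≠ j → ℓ⁻¹ ≤ |ξ i - ξ j|)
    (c : ι → ℤ → ℂ) :
    ∫⁻ x, ‖expSum ξ (fun i => c i ⌊x / ℓ⌋) x‖ₑ ^ 2
      ≤ ENNReal.ofReal (32 * ℓ) * ∑ i, ∑' q, ‖c i q‖ₑ ^ 2 := by
  rw [lintegral_eq_tsum_cells hℓ, ← Summable.tsum_finsetSum fun _ _ => ENNReal.summable,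
    ← ENNReal.tsum_mul_left]
  refine ENNReal.tsum_le_tsum fun q => ?_
  refine le_trans (le_of_eq ?_) (lintegral_expSum_sq_le hℓ hsep (fun i => c i q) (ℓ * q))
  refine setLIntegral_congr_fun measurableSet_Ico fun x hx => ?_
  rw [floor_of_mem_cell hℓ hx]

/-- A Poincaré inequality with decoupled variables: the phases are frozen at `x` while the
coefficients vary in `t`. After Fubini the large sieve is applied in `x` for each fixed `t`. -/
theorem lintegral_expSum_sub_avg_le (hℓ : 0 < ℓ) (hsep : ∀ i j, i ≠ j → ℓ⁻¹ ≤ |ξ i - ξ j|)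
    {u u' : ι → ℝ → ℂ} (hu : ∀ i x, HasDerivAt (u i) (u' i x) x) (hc : ∀ i, Continuous (u' i)) :
    ∫⁻ x, ‖expSum ξ (fun i => u i x - cellAvg ℓ (u i) ⌊x / ℓ⌋) x‖ₑ ^ 2
      ≤ ENNReal.ofReal (32 * ℓ ^ 2) * ∑ i, ∫⁻ x, ‖u' i x‖ₑ ^ 2 := by
  have huc : ∀ i, Continuous (u i) := fun i =>
    continuous_iff_continuousAt.2 fun x => (hu i x).continuousAt
  have hcell : ∀ q : ℤ, ∫⁻ x in Set.Ico (ℓ * q) (ℓ * q + ℓ),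
      ‖expSum ξ (fun i => u i x - cellAvg ℓ (u i) ⌊x / ℓ⌋) x‖ₑ ^ 2
      ≤ ENNReal.ofReal (32 * ℓ ^ 2) * ∑ i, ∫⁻ x in Set.Ico (ℓ * q) (ℓ * q + ℓ), ‖u' i x‖ₑ ^ 2 := by
    intro q
    set a := ℓ * q
    have hpt : ∀ x ∈ Set.Ico a (a + ℓ),
        ‖expSum ξ (fun i => u i x - cellAvg ℓ (u i) ⌊x / ℓ⌋) x‖ₑ ^ 2
        ≤ ENNReal.ofReal ℓ * ∫⁻ t in Set.Ico a (a + ℓ), ‖expSum ξ (fun i => u' i t) x‖ₑ ^ 2 := by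
      intro x hx
      set B := ENNReal.ofReal ℓ * ∫⁻ t in Set.Ico a (a + ℓ), ‖expSum ξ (fun i => u' i t) x‖ₑ ^ 2
      rw [floor_of_mem_cell hℓ hx]
      have hderiv : ∀ t, HasDerivAt (fun t => expSum ξ (fun i => u i t) x)
          (expSum ξ (fun i => u' i t) x) t := by
        intro t
        unfold expSum
        exact HasDerivAt.fun_sum fun i _ => (hu i t).const_mul _
      have hcont : Continuous fun t => expSum ξ (fun i => u' i t) x := by
        unfold expSum
        exact continuous_finsetSum _ fun i _ => continuous_const.mul (hc i)
      have hB : ∀ y ∈ Set.Ico a (a + ℓ), ‖expSum ξ (fun i => u i x) x - expSum ξ (fun i => u i y) x‖ₑ ^ 2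
          ≤ B := fun y hy => enorm_sub_sq_le_lintegral_deriv hderiv hcont hx hy
      have hucont : Continuous fun t => expSum ξ (fun i => u i t) x := by
        unfold expSum
        exact continuous_finsetSum _ fun i _ => continuous_const.mul (huc i)
      have hio : ∀ {g : ℝ → ℂ}, Continuous g → IntegrableOn g (Set.Ico a (a + ℓ)) := fun hg =>
        (hg.integrableOn_Icc).mono_set Set.Ico_subset_Icc_self
      have e : expSum ξ (fun i => u i x - cellAvg ℓ (u i) q) x = (ℓ : ℂ)⁻¹ *
          ∫ y in Set.Ico a (a + ℓ), (expSum ξ (fun i => u i x) x - expSum ξ (fun i => u i y) x) := by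
        rw [integral_sub (by simp) (hio hucont)]
        have h1 : ∫ y in Set.Ico a (a + ℓ), expSum ξ (fun i => u i y) x
            = ∑ i, ex (ξ i * x) * ∫ y in Set.Ico a (a + ℓ), u i y := by
          unfold expSum
          rw [integral_finsetSum _ fun i _ => (hio (huc i)).const_mul _]
          simp only [integral_const_mul]
        have h2 : ∫ y in Set.Ico a (a + ℓ), expSum ξ (fun i => u i x) x
            = ℓ * expSum ξ (fun i => u i x) x := by
          simp [Measure.real, hℓ.le]
        have hℓ' : (ℓ : ℂ) ≠ 0 := by exact_mod_cast hℓ.ne'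
        rw [h1, h2, mul_sub, ← mul_assoc, inv_mul_cancel₀ hℓ', one_mul, Finset.mul_sum]
        unfold expSum cellAvg
        rw [← Finset.sum_sub_distrib]
        refine Finset.sum_congr rfl fun i _ => ?_
        ring
      rw [e, enorm_mul, mul_pow]
      have h3 : ‖∫ y in Set.Ico a (a + ℓ), (expSum ξ (fun i => u i x) x - expSum ξ (fun i => u i y) x)‖ₑ ^ 2
          ≤ ENNReal.ofReal ℓ * (ENNReal.ofReal ℓ * B) := by
        calc _ ≤ (∫⁻ y in Set.Ico a (a + ℓ),
              ‖expSum ξ (fun i => u i x) x - expSum ξ (fun i => u i y) x‖ₑ) ^ 2 := by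
              gcongr
              exact enorm_integral_le_lintegral_enorm _
          _ ≤ ENNReal.ofReal ℓ * ∫⁻ y in Set.Ico a (a + ℓ),
              ‖expSum ξ (fun i => u i x) x - expSum ξ (fun i => u i y) x‖ₑ ^ 2 := by
              refine (lintegral_sq_le_measure_mul _
                (continuous_const.sub hucont).measurable.enorm.aemeasurable).trans (le_of_eq ?_)
              simp
          _ ≤ ENNReal.ofReal ℓ * ∫⁻ y in Set.Ico a (a + ℓ), B := by
              refine mul_le_mul' le_rfl ?_
              exact setLIntegral_mono' measurableSet_Ico hB
          _ = _ := by simp [mul_comm]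
      calc _ ≤ ‖(ℓ : ℂ)⁻¹‖ₑ ^ 2 * (ENNReal.ofReal ℓ * (ENNReal.ofReal ℓ * B)) := by gcongr
        _ = B := by
          have : ‖(ℓ : ℂ)⁻¹‖ₑ = ENNReal.ofReal ℓ⁻¹ := by
            rw [← ofReal_norm, norm_inv, Complex.norm_real, Real.norm_of_nonneg hℓ.le]
          have h5 : ENNReal.ofReal ℓ⁻¹ * ENNReal.ofReal ℓ = 1 := by
            rw [← ENNReal.ofReal_mul (by positivity), inv_mul_cancel₀ hℓ.ne', ENNReal.ofReal_one]
          rw [this]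
          calc _ = (ENNReal.ofReal ℓ⁻¹ * ENNReal.ofReal ℓ) ^ 2 * B := by ring
            _ = B := by rw [h5, one_pow, one_mul]
    calc _ ≤ ∫⁻ x in Set.Ico a (a + ℓ), ENNReal.ofReal ℓ *
          ∫⁻ t in Set.Ico a (a + ℓ), ‖expSum ξ (fun i => u' i t) x‖ₑ ^ 2 :=
          setLIntegral_mono' measurableSet_Ico hpt
      _ = ENNReal.ofReal ℓ * ∫⁻ t in Set.Ico a (a + ℓ),
          ∫⁻ x in Set.Ico a (a + ℓ), ‖expSum ξ (fun i => u' i t) x‖ₑ ^ 2 := by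
          rw [lintegral_const_mul' _ _ (by simp), lintegral_lintegral_swap]
          refine Measurable.aemeasurable ?_
          have : Continuous fun p : ℝ × ℝ => expSum ξ (fun i => u' i p.2) p.1 := by
            unfold expSum
            exact continuous_finsetSum _ fun i _ =>
              (continuous_ex.comp (by fun_prop)).mul ((hc i).comp continuous_snd)
          exact this.measurable.enorm.pow_const 2
      _ ≤ ENNReal.ofReal ℓ * ∫⁻ t in Set.Ico a (a + ℓ),
          ENNReal.ofReal (32 * ℓ) * ∑ i, ‖u' i t‖ₑ ^ 2 := by
          gcongr with t
          exact lintegral_expSum_sq_le hℓ hsep _ a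
      _ = _ := by
          rw [lintegral_const_mul' _ _ ENNReal.ofReal_ne_top,
            lintegral_finsetSum _ fun i _ => (hc i).measurable.enorm.pow_const 2, ← mul_assoc,
            ← ENNReal.ofReal_mul hℓ.le]
          congr 2
          ring
  rw [lintegral_eq_tsum_cells hℓ]
  refine (ENNReal.tsum_le_tsum hcell).trans (le_of_eq ?_)
  rw [ENNReal.tsum_mul_left, Summable.tsum_finsetSum fun _ _ => ENNReal.summable]
  simp only [← lintegral_eq_tsum_cells hℓ]

end Vector

/-- Sampling bound for a function on the lattice `ℓℤ`. -/
theorem tsum_enorm_sq_lattice_le {w w' : ℝ → ℂ} (hw : ∀ x, HasDerivAt w (w' x) x)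
    (hc : Continuous w') {ℓ L : ℝ} (hL : 0 < L) (hLℓ : L ≤ ℓ) :
    ∑' q : ℤ, ‖w (ℓ * q)‖ₑ ^ 2 ≤ ENNReal.ofReal (2 / L) * (∫⁻ x, ‖w x‖ₑ ^ 2)
      + ENNReal.ofReal (2 * L) * (∫⁻ x, ‖w' x‖ₑ ^ 2) := by
  have hℓ : 0 < ℓ := hL.trans_le hLℓ
  have hwc : Continuous w := continuous_iff_continuousAt.2 fun x => (hw x).continuousAt
  rw [lintegral_eq_tsum_cells hℓ, lintegral_eq_tsum_cells hℓ (fun x => ‖w' x‖ₑ ^ 2),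
    ← ENNReal.tsum_mul_left, ← ENNReal.tsum_mul_left, ← ENNReal.tsum_add]
  refine ENNReal.tsum_le_tsum fun q => ?_
  set a := ℓ * q
  have hsub : Set.Ico a (a + L) ⊆ Set.Ico a (a + ℓ) := Set.Ico_subset_Ico le_rfl (by linarith)
  set D := ∫⁻ t in Set.Ico a (a + L), ‖w' t‖ₑ ^ 2
  have hpt : ∀ y ∈ Set.Ico a (a + L), ‖w a‖ₑ ^ 2 ≤ 2 * ‖w y‖ₑ ^ 2 + 2 * (ENNReal.ofReal L * D) := by
    intro y hy
    have h1 := enorm_sub_sq_le_lintegral_deriv hw hc (x := y) (y := a) hy ⟨le_rfl, by linarith⟩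
    have h2 := enorm_sub_sq_le (w y) (w y - w a)
    rw [sub_sub_cancel, mul_add] at h2
    refine h2.trans ?_
    gcongr
  have hint : ENNReal.ofReal L * ‖w a‖ₑ ^ 2 ≤ 2 * (∫⁻ y in Set.Ico a (a + L), ‖w y‖ₑ ^ 2)
      + 2 * (ENNReal.ofReal L * D) * ENNReal.ofReal L := by
    have := setLIntegral_mono' (μ := volume) measurableSet_Ico hpt
    rw [lintegral_add_right _ measurable_const, lintegral_const_mul' _ _ (by simp)] at this
    simpa [mul_comm] using this
  have hL' : ENNReal.ofReal L⁻¹ * ENNReal.ofReal L = 1 := by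
    rw [← ENNReal.ofReal_mul (by positivity), inv_mul_cancel₀ hL.ne', ENNReal.ofReal_one]
  calc _ = ENNReal.ofReal L⁻¹ * (ENNReal.ofReal L * ‖w a‖ₑ ^ 2) := by rw [← mul_assoc, hL', one_mul]
    _ ≤ ENNReal.ofReal L⁻¹ * (2 * (∫⁻ y in Set.Ico a (a + L), ‖w y‖ₑ ^ 2)
      + 2 * (ENNReal.ofReal L * D) * ENNReal.ofReal L) := by gcongr
    _ = ENNReal.ofReal (2 / L) * (∫⁻ y in Set.Ico a (a + L), ‖w y‖ₑ ^ 2)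
      + (ENNReal.ofReal L⁻¹ * ENNReal.ofReal L) * (ENNReal.ofReal (2 * L) * D) := by
        rw [div_eq_mul_inv, ENNReal.ofReal_mul (by norm_num), ENNReal.ofReal_mul (by norm_num),
          ENNReal.ofReal_ofNat]
        ring
    _ ≤ _ := by
      rw [hL', one_mul]
      gcongr
      exact lintegral_mono_set hsub

/-- The average of a derivative is a difference quotient between neighbouring lattice points. -/
theorem tsum_cellAvg_deriv_le {w w' : ℝ → ℂ} (hw : ∀ x, HasDerivAt w (w' x) x)
    (hc : Continuous w') {ℓ : ℝ} (hℓ : 0 < ℓ) :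
    ∑' q : ℤ, ‖cellAvg ℓ w' q‖ₑ ^ 2
      ≤ ENNReal.ofReal (4 / ℓ ^ 2) * ∑' q : ℤ, ‖w (ℓ * q)‖ₑ ^ 2 := by
  have e : ∀ q : ℤ, cellAvg ℓ w' q = (ℓ : ℂ)⁻¹ * (w (ℓ * (q + 1 : ℤ)) - w (ℓ * q)) := by
    intro q
    rw [cellAvg, integral_Ico_eq_integral_Ioc, ← intervalIntegral.integral_of_le (by linarith),
      intervalIntegral.integral_eq_sub_of_hasDerivAt (fun t _ => hw t) (hc.intervalIntegrable _ _)]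
    congr 3
    push_cast
    ring
  have h1 : ‖(ℓ : ℂ)⁻¹‖ₑ ^ 2 = ENNReal.ofReal (1 / ℓ ^ 2) := by
    rw [← ofReal_norm, norm_inv, Complex.norm_real, Real.norm_of_nonneg hℓ.le,
      ← ENNReal.ofReal_pow (by positivity)]
    congr 1
    field_simp
  have h2 : ∑' q : ℤ, ‖w (ℓ * (q + 1 : ℤ))‖ₑ ^ 2 = ∑' q : ℤ, ‖w (ℓ * q)‖ₑ ^ 2 :=
    (Equiv.addRight (1 : ℤ)).tsum_eq fun q : ℤ => ‖w (ℓ * q)‖ₑ ^ 2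
  simp only [e, enorm_mul, mul_pow, h1]
  rw [ENNReal.tsum_mul_left]
  calc _ ≤ ENNReal.ofReal (1 / ℓ ^ 2) * ∑' q : ℤ, 2 * (‖w (ℓ * (q + 1 : ℤ))‖ₑ ^ 2 + ‖w (ℓ * q)‖ₑ ^ 2) := by
        gcongr with q
        exact enorm_sub_sq_le _ _
    _ = _ := by
        rw [ENNReal.tsum_mul_left, ENNReal.tsum_add, h2, show (4 / ℓ ^ 2) = 4 * (1 / ℓ ^ 2) by ring,
          ENNReal.ofReal_mul (by norm_num), ENNReal.ofReal_ofNat]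
        ring

/-- With truncated subtraction the exponent is `|j - s|`; the two sides of `j` give one geometric
series each. -/
theorem sum_pow_dist_le {θ : ℝ} (h0 : 0 ≤ θ) (h1 : θ < 1) (n j : ℕ) :
    ∑ s ∈ Finset.range n, θ ^ ((j - s) + (s - j)) ≤ 2 * (1 - θ)⁻¹ := by
  have hsum := summable_geometric_of_lt_one h0 h1
  have key : ∀ (S : Finset ℕ) (g : ℕ → ℕ), Set.InjOn g S → ∑ s ∈ S, θ ^ g s ≤ (1 - θ)⁻¹ := by
    intro S g hg
    rw [← Finset.sum_image (f := fun i => θ ^ i) hg, ← tsum_geometric_of_lt_one h0 h1]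
    exact hsum.sum_le_tsum _ fun i _ => pow_nonneg h0 i
  rw [← Finset.sum_filter_add_sum_filter_not _ (fun s => s < j), two_mul]
  refine add_le_add (key _ _ fun a ha b hb hab => ?_) (key _ _ fun a ha b hb hab => ?_)
  · simp only [Finset.coe_filter, Set.mem_ofPred_eq] at ha hb
    omega
  · simp only [Finset.coe_filter, Set.mem_ofPred_eq] at ha hb
    omega

theorem sum_sq_le_weighted {α : Type*} (S : Finset α) {w : α → ℝ} (hw : ∀ i, 0 < w i)
    (x : α → ℝ≥0∞) :
    (∑ i ∈ S, x i) ^ 2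
      ≤ ENNReal.ofReal (∑ i ∈ S, w i) * ∑ i ∈ S, ENNReal.ofReal (w i)⁻¹ * x i ^ 2 := by
  have h := ENNReal.inner_le_weight_mul_Lp_of_nonneg S (p := 2) (by norm_num)
    (fun i => ENNReal.ofReal (w i)) (fun i => ENNReal.ofReal (w i)⁻¹ * x i)
  have hone : ∀ i, ENNReal.ofReal (w i) * ENNReal.ofReal (w i)⁻¹ = 1 := fun i => by
    rw [← ENNReal.ofReal_mul (hw i).le, mul_inv_cancel₀ (hw i).ne', ENNReal.ofReal_one]
  have e1 : ∀ i, ENNReal.ofReal (w i) * (ENNReal.ofReal (w i)⁻¹ * x i) = x i := fun i => by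
    rw [← mul_assoc, hone, one_mul]
  have e2 : ∀ i, ENNReal.ofReal (w i) * (ENNReal.ofReal (w i)⁻¹ * x i) ^ (2 : ℝ)
      = ENNReal.ofReal (w i)⁻¹ * x i ^ 2 := fun i => by
    rw [ENNReal.rpow_two]
    calc _ = (ENNReal.ofReal (w i) * ENNReal.ofReal (w i)⁻¹) * (ENNReal.ofReal (w i)⁻¹ * x i ^ 2) := by ring
      _ = _ := by rw [hone, one_mul]
  simp only [e1, e2] at h
  rw [ENNReal.ofReal_sum_of_nonneg fun i _ => (hw i).le]
  calc _ ≤ ((∑ i ∈ S, ENNReal.ofReal (w i)) ^ (1 - (2 : ℝ)⁻¹)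
        * (∑ i ∈ S, ENNReal.ofReal (w i)⁻¹ * x i ^ 2) ^ (2 : ℝ)⁻¹) ^ 2 := by gcongr
    _ = _ := by
      rw [mul_pow, ← ENNReal.rpow_two, ← ENNReal.rpow_mul, ← ENNReal.rpow_two, ← ENNReal.rpow_mul]
      norm_num

theorem sum_lintegral_sdiff_add {B : ℕ → Set ℝ} (hB : Antitone B) (hm : ∀ s, MeasurableSet (B s))
    (φ : ℝ → ℝ≥0∞) (n : ℕ) :
    ∑ s ∈ Finset.range n, (∫⁻ x in B s \ B (s + 1), φ x) + ∫⁻ x in B n, φ x = ∫⁻ x in B 0, φ x := by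
  induction n with
  | zero => simp
  | succ n ih =>
    rw [Finset.sum_range_succ, add_assoc, ← ih]
    congr 1
    rw [add_comm, ← lintegral_inter_add_sdiff φ (B n) (hm (n + 1)),
      Set.inter_eq_right.2 (hB n.le_succ)]

theorem sum_lintegral_sdiff_le {B : ℕ → Set ℝ} (hB : Antitone B) (hm : ∀ s, MeasurableSet (B s))
    (φ : ℝ → ℝ≥0∞) (n : ℕ) :
    ∑ s ∈ Finset.range n, (∫⁻ x in B s \ B (s + 1), φ x) ≤ ∫⁻ x, φ x :=
  le_self_add.trans ((sum_lintegral_sdiff_add hB hm φ n).le.trans (setLIntegral_le_lintegral _ _))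

theorem lintegral_enorm_sq_indicator {s : Set ℝ} (hs : MeasurableSet s) (h : ℝ → ℂ) :
    ∫⁻ η, ‖s.indicator h η‖ₑ ^ 2 = ∫⁻ η in s, ‖h η‖ₑ ^ 2 := by
  rw [← lintegral_indicator hs]
  refine lintegral_congr fun η => ?_
  by_cases hη : η ∈ s <;> simp [hη]

theorem IsBand.lintegral_deriv_le {ρ : ℝ} {h : ℝ → ℂ} (hh : IsBand ρ h) :
    ∫⁻ x, ‖(𝓕⁻ (fun η => (2 * Real.pi * Complex.I * η) * h η) : ℝ → ℂ) x‖ₑ ^ 2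
      ≤ ENNReal.ofReal (40 * ρ ^ 2) * ∫⁻ η, ‖h η‖ₑ ^ 2 := by
  rw [hh.deriv_symbol.plancherel, ← lintegral_const_mul' _ _ ENNReal.ofReal_ne_top]
  refine lintegral_mono fun η => ?_
  by_cases h0 : h η = 0
  · simp [h0]
  have hη : |η| ≤ ρ := not_lt.1 fun hc => h0 (hh.support η hc)
  have hρ : 0 ≤ ρ := (abs_nonneg η).trans hη
  rw [enorm_mul, mul_pow]
  gcongr
  rw [← ofReal_norm, ← ENNReal.ofReal_pow (norm_nonneg _)]
  refine ENNReal.ofReal_le_ofReal ?_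
  simp only [norm_mul, Complex.norm_real, Complex.norm_I, Complex.norm_ofNat, Real.norm_eq_abs,
    abs_of_pos Real.pi_pos, mul_one]
  have h2 : η ^ 2 ≤ ρ ^ 2 := sq_le_sq' (by linarith [neg_abs_le η]) ((le_abs_self η).trans hη)
  have h3 : Real.pi ^ 2 ≤ 10 := by nlinarith [Real.pi_lt_d2, Real.pi_pos]
  calc _ = 4 * Real.pi ^ 2 * η ^ 2 := by rw [mul_pow, mul_pow, sq_abs]; ring
    _ ≤ 4 * 10 * ρ ^ 2 := by gcongr
    _ = _ := by ring

section Vector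

variable {ι : Type*} [Fintype ι] {ξ : ι → ℝ} {ℓ ρ : ℝ} {h : ι → ℝ → ℂ}

/-- Useful when `ρ` is below `1/ℓ`: the coefficients are then nearly constant on cells. The gain
combines the Poincaré bound (32) with Bernstein's inequality (40). -/
theorem lintegral_low_le (hℓ : 0 < ℓ) (hsep : ∀ i j, i ≠ j → ℓ⁻¹ ≤ |ξ i - ξ j|)
    (hh : ∀ i, IsBand ρ (h i)) :
    ∫⁻ x, ‖expSum ξ (fun i => (𝓕⁻ (h i) : ℝ → ℂ) x - cellAvg ℓ (𝓕⁻ (h i)) ⌊x / ℓ⌋) x‖ₑ ^ 2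
      ≤ ENNReal.ofReal (1280 * (ℓ * ρ) ^ 2) * ∑ i, ∫⁻ η, ‖h i η‖ₑ ^ 2 := by
  refine (lintegral_expSum_sub_avg_le hℓ hsep (fun i => (hh i).hasDerivAt)
    fun i => (hh i).deriv_symbol.continuous).trans ?_
  rw [Finset.mul_sum, Finset.mul_sum]
  refine Finset.sum_le_sum fun i _ => ?_
  calc _ ≤ ENNReal.ofReal (32 * ℓ ^ 2) * (ENNReal.ofReal (40 * ρ ^ 2) * ∫⁻ η, ‖h i η‖ₑ ^ 2) := by
        gcongr
        exact (hh i).lintegral_deriv_le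
    _ = _ := by
        rw [← mul_assoc, ← ENNReal.ofReal_mul (by positivity)]
        congr 2
        ring

/-- Away from the origin the function is the derivative of one smaller by `ρ⁻¹`, obtained by
dividing the symbol by `2πiη`. Its cell averages are therefore difference quotients of a small
function. -/
theorem IsBand.tsum_cellAvg_le {g : ℝ → ℂ} (hg : IsBand ρ g) (hρ : 0 < ρ)
    (hlow : ∀ η, g η ≠ 0 → ρ / 2 ≤ |η|) (hρℓ : ρ⁻¹ ≤ ℓ) :
    ∑' q : ℤ, ‖cellAvg ℓ (𝓕⁻ g) q‖ₑ ^ 2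
      ≤ ENNReal.ofReal (16 / (ρ * ℓ ^ 2)) * ∫⁻ η, ‖g η‖ₑ ^ 2 := by
  have hℓ : 0 < ℓ := (inv_pos.2 hρ).trans_le hρℓ
  have hsymb : ∀ η, g η ≠ 0 → (2 * Real.pi * Complex.I * η : ℂ) ≠ 0 := fun η hη => by
    have := hlow η hη
    have h1 : η ≠ 0 := by
      rintro rfl
      simp at this
      linarith
    have : (η : ℂ) ≠ 0 := by exact_mod_cast h1
    have : (Real.pi : ℂ) ≠ 0 := by exact_mod_cast Real.pi_ne_zero
    simp [*]
  have hinv : ∀ η, g η ≠ 0 → ‖(2 * Real.pi * Complex.I * η : ℂ)⁻¹‖ ≤ ρ⁻¹ := fun η hη => by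
    have := hlow η hη
    rw [norm_inv]
    refine inv_anti₀ hρ ?_
    simp only [norm_mul, Complex.norm_real, Complex.norm_I, Complex.norm_ofNat, Real.norm_eq_abs,
      abs_of_pos Real.pi_pos, mul_one]
    nlinarith [Real.pi_gt_three]
  set k : ℝ → ℂ := fun η => (2 * Real.pi * Complex.I * η)⁻¹ * g η with hk
  have hkb : IsBand ρ k := hg.mul_bounded (by fun_prop) hinv
  have hkd : (fun η => (2 * Real.pi * Complex.I * η) * k η) = g := by
    funext η
    by_cases h0 : g η = 0
    · simp [hk, h0]
    · rw [hk, ← mul_assoc, mul_inv_cancel₀ (hsymb η h0), one_mul]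
  have hd := hkb.hasDerivAt
  rw [hkd] at hd
  have hkn : ∫⁻ η, ‖k η‖ₑ ^ 2 ≤ ENNReal.ofReal (ρ⁻¹ ^ 2) * ∫⁻ η, ‖g η‖ₑ ^ 2 := by
    rw [← lintegral_const_mul' _ _ ENNReal.ofReal_ne_top]
    refine lintegral_mono fun η => ?_
    by_cases h0 : g η = 0
    · simp [hk, h0]
    rw [hk, enorm_mul, mul_pow, ENNReal.ofReal_pow (by positivity)]
    gcongr
    rw [← ofReal_norm]
    exact ENNReal.ofReal_le_ofReal (hinv η h0)
  refine (tsum_cellAvg_deriv_le hd hg.continuous hℓ).trans ?_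
  -- Sampling uses only a piece of length `ρ⁻¹` of each cell, the natural scale of the frequency
  -- band.
  have h1 := tsum_enorm_sq_lattice_le hd hg.continuous (inv_pos.2 hρ) hρℓ
  rw [hkb.plancherel, hg.plancherel] at h1
  set G := ∫⁻ η, ‖g η‖ₑ ^ 2
  calc _ ≤ ENNReal.ofReal (4 / ℓ ^ 2) * (ENNReal.ofReal (2 / ρ⁻¹) * (ENNReal.ofReal (ρ⁻¹ ^ 2) * G)
        + ENNReal.ofReal (2 * ρ⁻¹) * G) := by
        gcongr
        exact h1.trans (by gcongr)
    _ = ENNReal.ofReal (4 / ℓ ^ 2 * (2 / ρ⁻¹ * ρ⁻¹ ^ 2 + 2 * ρ⁻¹)) * G := by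
        rw [← mul_assoc (ENNReal.ofReal (2 / ρ⁻¹)), ← add_mul, ← mul_assoc,
          ← ENNReal.ofReal_mul (by positivity), ← ENNReal.ofReal_add (by positivity) (by positivity),
          ← ENNReal.ofReal_mul (by positivity)]
    _ = _ := by
        congr 2
        field_simp
        ring

theorem lintegral_high_le (hsep : ∀ i j, i ≠ j → ℓ⁻¹ ≤ |ξ i - ξ j|)
    (hh : ∀ i, IsBand ρ (h i)) (hρ : 0 < ρ) (hlow : ∀ i η, h i η ≠ 0 → ρ / 2 ≤ |η|)
    (hρℓ : ρ⁻¹ ≤ ℓ) :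
    ∫⁻ x, ‖expSum ξ (fun i => cellAvg ℓ (𝓕⁻ (h i)) ⌊x / ℓ⌋) x‖ₑ ^ 2
      ≤ ENNReal.ofReal (1280 * (ρ * ℓ)⁻¹) * ∑ i, ∫⁻ η, ‖h i η‖ₑ ^ 2 := by
  have hℓ : 0 < ℓ := (inv_pos.2 hρ).trans_le hρℓ
  refine (lintegral_expSum_cell_le hℓ hsep _).trans ?_
  rw [Finset.mul_sum, Finset.mul_sum]
  refine Finset.sum_le_sum fun i _ => ?_
  calc _ ≤ ENNReal.ofReal (32 * ℓ) * (ENNReal.ofReal (16 / (ρ * ℓ ^ 2)) * ∫⁻ η, ‖h i η‖ₑ ^ 2) := by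
        gcongr
        exact (hh i).tsum_cellAvg_le hρ (hlow i) hρℓ
    _ = ENNReal.ofReal (512 * (ρ * ℓ)⁻¹) * ∫⁻ η, ‖h i η‖ₑ ^ 2 := by
        rw [← mul_assoc, ← ENNReal.ofReal_mul (by positivity)]
        congr 2
        field_simp
        norm_num
    -- The constant is enlarged to match `lintegral_low_le`.
    _ ≤ _ := by
        gcongr
        norm_num

end Vector

theorem measurable_cellAvg_floor (ℓ : ℝ) (g : ℝ → ℂ) :
    Measurable fun x : ℝ => cellAvg ℓ g ⌊x / ℓ⌋ :=
  (measurable_of_countable (cellAvg ℓ g)).comp (Int.measurable_floor.comp (by fun_prop))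

theorem measurable_expSum {ι : Type*} [Fintype ι] (ξ : ι → ℝ) {c : ι → ℝ → ℂ}
    (hc : ∀ i, Measurable (c i)) : Measurable fun x => expSum ξ (fun i => c i x) x := by
  unfold expSum
  exact Finset.measurable_fun_sum _ fun i _ =>
    (continuous_ex.comp (by fun_prop)).measurable.mul (hc i)

/-! ### Sharp truncations compared with dyadic averages. -/

/-- The symmetric open interval of radius `ρ`. -/
def band (ρ : ℝ) : Set ℝ := {η | |η| < ρ}

theorem measurableSet_band (ρ : ℝ) : MeasurableSet (band ρ) :=
  measurableSet_lt (by fun_prop) measurable_const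

theorem band_mono {ρ ρ' : ℝ} (h : ρ ≤ ρ') : band ρ ⊆ band ρ' := fun _ hη => lt_of_lt_of_le hη h

/-- Bands of radii `2⁻ˢ/λ`, cut off after `T` steps. -/
def bandSeq (lam : ℝ) (T s : ℕ) : Set ℝ := if s ≤ T then band (lam⁻¹ * (1 / 2) ^ s) else ∅

section Bands

variable {lam : ℝ} {T : ℕ}

theorem bandSeq_antitone (hl : 0 < lam) : Antitone (bandSeq lam T) := by
  refine antitone_nat_of_succ_le fun s => ?_
  unfold bandSeq
  by_cases h : s + 1 ≤ T
  · rw [if_pos h, if_pos (by omega)]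
    exact band_mono (mul_le_mul_of_nonneg_left
      (pow_le_pow_of_le_one (by norm_num) (by norm_num) s.le_succ) (inv_pos.2 hl).le)
  · rw [if_neg h]
    exact Set.empty_subset _

theorem measurableSet_bandSeq (s : ℕ) : MeasurableSet (bandSeq lam T s) := by
  unfold bandSeq
  split_ifs
  · exact measurableSet_band _
  · exact MeasurableSet.empty

theorem sum_shell_indicator (hl : 0 < lam) (h : ℝ → ℂ) {j : ℕ} (hj : j ≤ T) (η : ℝ) :
    ∑ s ∈ Finset.range (T + 1), (if j ≤ s then
      (bandSeq lam T s \ bandSeq lam T (s + 1)).indicator h η else 0)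
      = (band (lam⁻¹ * (1 / 2) ^ j)).indicator h η := by
  have e : ∀ s, (bandSeq lam T s \ bandSeq lam T (s + 1)).indicator h η
      = (bandSeq lam T s).indicator h η - (bandSeq lam T (s + 1)).indicator h η := fun s => by
    rw [Set.indicator_sdiff (bandSeq_antitone hl s.le_succ)]
    rfl
  rw [← Finset.sum_filter]
  have hf : (Finset.range (T + 1)).filter (fun s => j ≤ s) = Finset.Ico j (T + 1) := by
    ext s
    simp
    omega
  simp only [hf, e]
  rw [Finset.sum_Ico_eq_sum_range]
  have := Finset.sum_range_sub' (fun s => (bandSeq lam T (j + s)).indicator h η) (T + 1 - j)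
  simp only [← add_assoc] at this
  rw [this, show j + (T + 1 - j) = T + 1 by omega]
  simp [bandSeq, hj]

end Bands

section Error

variable {ι : Type*} [Fintype ι] {ξ : ι → ℝ} {lam : ℝ} {h : ι → ℝ → ℂ}

theorem cellAvg_sum {α : Type*} (S : Finset α) (ℓ : ℝ) {g : α → ℝ → ℂ}
    (hg : ∀ s ∈ S, Continuous (g s)) (q : ℤ) :
    cellAvg ℓ (fun x => ∑ s ∈ S, g s x) q = ∑ s ∈ S, cellAvg ℓ (g s) q := by
  unfold cellAvg
  rw [integral_finsetSum _ fun s hs =>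
    ((hg s hs).integrableOn_Icc.mono_set Set.Ico_subset_Icc_self), Finset.mul_sum]

/-- Comparison of the sharp frequency truncations with the dyadic averages. -/
theorem sum_lintegral_error_le (hl : 0 < lam) (hsep : ∀ i j, i ≠ j → lam⁻¹ ≤ |ξ i - ξ j|)
    (hh : ∀ i, IsBand lam⁻¹ (h i)) (hsupp : ∀ i η, h i η ≠ 0 → η ∈ band lam⁻¹) (T : ℕ) :
    ∑ j ∈ Finset.range (T + 1), ∫⁻ x, ‖expSum ξ (fun i =>
      (𝓕⁻ ((band (lam⁻¹ * (1 / 2) ^ j)).indicator (h i)) : ℝ → ℂ) x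
        - cellAvg (lam * 2 ^ j) (𝓕⁻ (h i)) ⌊x / (lam * 2 ^ j)⌋) x‖ₑ ^ 2
      ≤ 61440 * ∑ i, ∫⁻ η, ‖h i η‖ₑ ^ 2 := by
  set S : ℕ → Set ℝ := fun s => bandSeq lam T s \ bandSeq lam T (s + 1) with hS
  have hSm : ∀ s, MeasurableSet (S s) := fun s =>
    (measurableSet_bandSeq s).diff (measurableSet_bandSeq (s + 1))
  set g : ℕ → ι → ℝ → ℂ := fun s i => (S s).indicator (h i) with hg
  set u : ℕ → ι → ℝ → ℂ := fun s i => (𝓕⁻ (g s i) : ℝ → ℂ) with hu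
  set ℓ : ℕ → ℝ := fun j => lam * 2 ^ j with hℓ
  set ρ : ℕ → ℝ := fun s => lam⁻¹ * (1 / 2) ^ s with hρ
  have hℓ0 : ∀ j, 0 < ℓ j := fun j => by positivity
  have hρ0 : ∀ j, 0 < ρ j := fun j => by positivity
  have hgb0 : ∀ s i, IsBand lam⁻¹ (g s i) := fun s i => (hh i).indicator (hSm s)
  have hsepj : ∀ j, ∀ i i', i ≠ i' → (ℓ j)⁻¹ ≤ |ξ i - ξ i'| := fun j i i' hii' => by
    refine le_trans (inv_anti₀ hl ?_) (hsep i i' hii')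
    exact le_mul_of_one_le_right hl.le (one_le_pow₀ (by norm_num))
  set H : ℕ → ℝ≥0∞ := fun s => ∑ i, ∫⁻ η, ‖g s i η‖ₑ ^ 2 with hH
  have hHsum : ∑ s ∈ Finset.range (T + 1), H s ≤ ∑ i, ∫⁻ η, ‖h i η‖ₑ ^ 2 := by
    rw [hH, Finset.sum_comm]
    refine Finset.sum_le_sum fun i _ => ?_
    simp only [hg, lintegral_enorm_sq_indicator (hSm _)]
    exact sum_lintegral_sdiff_le (bandSeq_antitone hl) (fun s => measurableSet_bandSeq s) _ _
  -- The contribution of shell `s` to the error at scale `j`: shells with `s ≥ j` survive the sharp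
  -- truncation, and of the others only the average remains.
  set D : ℕ → ℕ → ℝ → ℂ := fun j s x =>
    if j ≤ s then expSum ξ (fun i => u s i x - cellAvg (ℓ j) (u s i) ⌊x / ℓ j⌋) x
    else - expSum ξ (fun i => cellAvg (ℓ j) (u s i) ⌊x / ℓ j⌋) x with hD
  have hDm : ∀ j s, Measurable (D j s) := fun j s => by
    simp only [hD]
    split_ifs
    · exact measurable_expSum ξ fun i =>
        (hgb0 s i).continuous.measurable.sub (measurable_cellAvg_floor _ _)
    · exact (measurable_expSum ξ fun i => measurable_cellAvg_floor _ _).neg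
  have hdecomp : ∀ j ≤ T, ∀ x, expSum ξ (fun i =>
      (𝓕⁻ ((band (ρ j)).indicator (h i)) : ℝ → ℂ) x
        - cellAvg (ℓ j) (𝓕⁻ (h i)) ⌊x / ℓ j⌋) x = ∑ s ∈ Finset.range (T + 1), D j s x := by
    intro j hj x
    have e1 : ∀ i, (𝓕⁻ ((band (ρ j)).indicator (h i)) : ℝ → ℂ) x
        = ∑ s ∈ Finset.range (T + 1), if j ≤ s then u s i x else 0 := by
      intro i
      have : (band (ρ j)).indicator (h i)
          = fun η => ∑ s ∈ Finset.range (T + 1), (if j ≤ s then g s i else 0) η := by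
        funext η
        rw [← sum_shell_indicator hl (h i) hj η]
        refine Finset.sum_congr rfl fun s _ => ?_
        split_ifs <;> rfl
      rw [this, fourierInv_finset_sum]
      · refine Finset.sum_congr rfl fun s _ => ?_
        split_ifs
        · rfl
        · rw [fourierInv_apply]
          simp
      · intro s _
        split_ifs
        · exact (hgb0 s i).integrable
        · exact integrable_zero _ _ _
    have e2 : ∀ i, (𝓕⁻ (h i) : ℝ → ℂ) = fun x => ∑ s ∈ Finset.range (T + 1), u s i x := by
      intro i
      funext y
      have : h i = fun η => ∑ s ∈ Finset.range (T + 1), g s i η := by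
        funext η
        have := sum_shell_indicator (T := T) hl (h i) (Nat.zero_le T) η
        simp only [zero_le, if_true, pow_zero, mul_one] at this
        rw [this]
        by_cases h0 : h i η = 0
        · by_cases hη : η ∈ band lam⁻¹ <;> simp [hη, h0]
        · rw [Set.indicator_of_mem (hsupp i η h0)]
      conv_lhs => rw [this]
      exact fourierInv_finset_sum _ (fun s _ => (hgb0 s i).integrable) y
    have e3 : ∀ i q, cellAvg (ℓ j) (𝓕⁻ (h i)) q
        = ∑ s ∈ Finset.range (T + 1), cellAvg (ℓ j) (u s i) q := fun i q => by
      rw [e2, cellAvg_sum _ _ fun s _ => (hgb0 s i).continuous]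
    unfold expSum at hD ⊢
    simp only [e1, e3, hD, ← Finset.sum_sub_distrib, Finset.mul_sum]
    rw [Finset.sum_comm]
    refine Finset.sum_congr rfl fun s _ => ?_
    split_ifs
    · rfl
    · rw [← Finset.sum_neg_distrib]
      refine Finset.sum_congr rfl fun i _ => ?_
      ring
  have hDbound : ∀ j ≤ T, ∀ s ≤ T, ∫⁻ x, ‖D j s x‖ₑ ^ 2
      ≤ ENNReal.ofReal (1280 * (1 / 2) ^ ((j - s) + (s - j))) * H s := by
    intro j hj s hs
    have hgb : ∀ i, IsBand (ρ s) (g s i) := fun i => by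
      refine ⟨(hgb0 s i).memLp, fun η hη => Set.indicator_of_notMem (fun hc => ?_) _⟩
      have := hc.1
      rw [bandSeq, if_pos hs] at this
      exact absurd this (not_lt.2 hη.le)
    have hρℓ : ρ s * ℓ j = 2 ^ j * (1 / 2) ^ s := by
      simp only [hρ, hℓ]
      field_simp
    simp only [hD]
    by_cases hjs : j ≤ s
    · simp only [hjs, if_true]
      refine (lintegral_low_le (hℓ0 j) (hsepj j) hgb).trans ?_
      gcongr ENNReal.ofReal (1280 * ?_) * _
      obtain ⟨d, rfl⟩ := Nat.exists_eq_add_of_le hjs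
      rw [mul_comm (ℓ j), hρℓ]
      have e : j - (j + d) + (j + d - j) = d := by omega
      have e' : (2 : ℝ) ^ j * (1 / 2) ^ (j + d) = (1 / 2) ^ d := by
        rw [pow_add, ← mul_assoc, ← mul_pow]
        norm_num
      rw [e, e']
      -- The low side decays like `4⁻ᵈ`; only `2⁻ᵈ` is kept, to agree with the high side.
      calc ((1 / 2 : ℝ) ^ d) ^ 2 ≤ ((1 / 2 : ℝ) ^ d) ^ 1 :=
            pow_le_pow_of_le_one (by positivity) (pow_le_one₀ (by norm_num) (by norm_num)) (by norm_num)
        _ = _ := pow_one _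
    · simp only [hjs, if_false, enorm_neg]
      obtain ⟨d, rfl⟩ := Nat.exists_eq_add_of_le (not_le.1 hjs).le
      have e' : ρ s * ℓ (s + d) = 2 ^ d := by
        rw [hρℓ, pow_add, mul_right_comm, ← mul_pow]
        norm_num
      refine (lintegral_high_le (hsepj _) hgb (hρ0 s) (fun i η hη => ?_) ?_).trans ?_
      · have hmem : η ∈ S s := by
          by_contra hc
          exact hη (Set.indicator_of_notMem hc _)
        have := hmem.2
        -- Since `s < j ≤ T`, the shell is not the last one and has a genuine inner radius. The last
        -- shell contains the origin but never enters this case.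
        rw [bandSeq, if_pos (by omega)] at this
        have : lam⁻¹ * (1 / 2) ^ (s + 1) ≤ |η| := not_lt.1 this
        simp only [hρ]
        rw [pow_succ] at this
        linarith
      · rw [inv_le_iff_one_le_mul₀ (hρ0 s), mul_comm, e']
        exact one_le_pow₀ (by norm_num)
      · rw [e']
        have e : s + d - s + (s - (s + d)) = d := by omega
        rw [e, one_div, inv_pow]
  have hcs : ∀ j ≤ T, ∫⁻ x, ‖expSum ξ (fun i =>
      (𝓕⁻ ((band (ρ j)).indicator (h i)) : ℝ → ℂ) x
        - cellAvg (ℓ j) (𝓕⁻ (h i)) ⌊x / ℓ j⌋) x‖ₑ ^ 2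
      ≤ ∑ s ∈ Finset.range (T + 1), ENNReal.ofReal (8 * 1280 * (2 / 3) ^ ((j - s) + (s - j))) * H s := by
    intro j hj
    -- Any ratio strictly between `1/2` and 1 would do. The weights sum to at most 8, the decay left
    -- over has ratio `(1/2) / (3/4) = 2/3` and sums to at most 6, and `8 * 1280 * 6 = 61440`.
    set w : ℕ → ℝ := fun s => (3 / 4) ^ ((j - s) + (s - j)) with hw
    have hw8 : ∑ s ∈ Finset.range (T + 1), w s ≤ 8 := by
      have := sum_pow_dist_le (θ := 3 / 4) (by norm_num) (by norm_num) (T + 1) j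
      norm_num at this ⊢
      exact this
    calc _ ≤ ∫⁻ x, ENNReal.ofReal 8 * ∑ s ∈ Finset.range (T + 1),
          ENNReal.ofReal (w s)⁻¹ * ‖D j s x‖ₑ ^ 2 := by
          refine lintegral_mono fun x => ?_
          rw [hdecomp j hj x]
          calc _ ≤ (∑ s ∈ Finset.range (T + 1), ‖D j s x‖ₑ) ^ 2 := by
                gcongr
                exact enorm_sum_le _ _
            _ ≤ _ := sum_sq_le_weighted _ (w := w) (fun s => by positivity) _
            _ ≤ _ := by gcongr
      _ = ∑ s ∈ Finset.range (T + 1), ENNReal.ofReal 8 *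
          (ENNReal.ofReal (w s)⁻¹ * ∫⁻ x, ‖D j s x‖ₑ ^ 2) := by
          rw [lintegral_const_mul' _ _ ENNReal.ofReal_ne_top, lintegral_finsetSum, Finset.mul_sum]
          · refine Finset.sum_congr rfl fun s _ => ?_
            rw [lintegral_const_mul' _ _ ENNReal.ofReal_ne_top]
          · exact fun s _ => ((hDm j s).enorm.pow_const 2).const_mul _
      _ ≤ _ := by
          refine Finset.sum_le_sum fun s hs => ?_
          calc _ ≤ ENNReal.ofReal 8 * (ENNReal.ofReal (w s)⁻¹ *
                (ENNReal.ofReal (1280 * (1 / 2) ^ ((j - s) + (s - j))) * H s)) := by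
                gcongr
                exact hDbound j hj s (by simpa [Nat.lt_succ_iff] using hs)
            _ = _ := by
                rw [← mul_assoc, ← mul_assoc, ← ENNReal.ofReal_mul (by norm_num),
                  ← ENNReal.ofReal_mul (by positivity)]
                congr 2
                rw [hw, ← inv_pow, mul_assoc, mul_left_comm _ (1280 : ℝ), ← mul_pow, mul_assoc]
                norm_num
  calc _ ≤ ∑ j ∈ Finset.range (T + 1), ∑ s ∈ Finset.range (T + 1),
        ENNReal.ofReal (8 * 1280 * (2 / 3) ^ ((j - s) + (s - j))) * H s :=
        Finset.sum_le_sum fun j hj => hcs j (by simpa [Nat.lt_succ_iff] using hj)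
    _ = ∑ s ∈ Finset.range (T + 1), ENNReal.ofReal (∑ j ∈ Finset.range (T + 1),
        8 * 1280 * (2 / 3) ^ ((j - s) + (s - j))) * H s := by
        rw [Finset.sum_comm]
        refine Finset.sum_congr rfl fun s _ => ?_
        rw [ENNReal.ofReal_sum_of_nonneg fun j _ => by positivity, Finset.sum_mul]
    _ ≤ ∑ s ∈ Finset.range (T + 1), 61440 * H s := by
        refine Finset.sum_le_sum fun s _ => ?_
        gcongr
        rw [← Finset.mul_sum]
        have := sum_pow_dist_le (θ := 2 / 3) (by norm_num) (by norm_num) (T + 1) s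
        have h6 : ∑ j ∈ Finset.range (T + 1), (2 / 3 : ℝ) ^ ((j - s) + (s - j)) ≤ 6 := by
          simp only [add_comm (_ - s)]
          norm_num at this ⊢
          exact this
        rw [show (61440 : ℝ≥0∞) = ENNReal.ofReal 61440 by simp]
        refine ENNReal.ofReal_le_ofReal ?_
        linarith
    _ ≤ _ := by
        rw [← Finset.mul_sum]
        gcongr

end Error

/-! ### Variation of exponential sums with coefficients along a path. -/

section PathExpSum

variable {ι : Type*} [Fintype ι] {ξ : ι → ℝ} {r : ℝ}

theorem expSum_sub (ξ : ι → ℝ) (c d : ι → ℂ) (x : ℝ) :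
    expSum ξ (c - d) x = expSum ξ c x - expSum ξ d x := by
  simp [expSum, mul_sub, Finset.sum_sub_distrib]

theorem expSum_add (ξ : ι → ℝ) (c d : ι → ℂ) (x : ℝ) :
    expSum ξ (c + d) x = expSum ξ c x + expSum ξ d x := by
  simp [expSum, mul_add, Finset.sum_add_distrib]

theorem norm_expSum_le (ξ : ι → ℝ) (c : EuclideanSpace ℂ ι) (x : ℝ) :
    ‖expSum ξ c.ofLp x‖ ≤ √(Fintype.card ι) * ‖c‖ := by
  have h1 : ‖expSum ξ c.ofLp x‖ ≤ ∑ i, 1 * ‖c i‖ := by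
    refine (norm_sum_le _ _).trans (Finset.sum_le_sum fun i _ => ?_)
    rw [norm_mul, norm_ex]
  refine h1.trans ((Real.sum_mul_le_sqrt_mul_sqrt _ _ _).trans (le_of_eq ?_))
  rw [EuclideanSpace.norm_eq]
  simp

theorem enorm_expSum_rpow_le (hr : 0 ≤ r) (ξ : ι → ℝ) (c : EuclideanSpace ℂ ι) (x : ℝ) {y : ℝ}
    (hy : ‖c‖ ^ r ≤ y) :
    ‖expSum ξ c.ofLp x‖ₑ ^ r ≤ ENNReal.ofReal (√(Fintype.card ι) ^ r * y) := by
  rw [← ofReal_norm, ENNReal.ofReal_rpow_of_nonneg (norm_nonneg _) hr]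
  refine ENNReal.ofReal_le_ofReal ?_
  calc _ ≤ (√(Fintype.card ι) * ‖c‖) ^ r :=
        Real.rpow_le_rpow (norm_nonneg _) (norm_expSum_le ξ c x) hr
    _ = √(Fintype.card ι) ^ r * ‖c‖ ^ r := Real.mul_rpow (by positivity) (by positivity)
    _ ≤ _ := by gcongr

/-- Majorant of the variation of the residual of a sampling. -/
noncomputable def residualBound (r : ℝ) {H : Type*} [NormedAddCommGroup H] (f : ℕ → H)
    (m₀ T : ℕ) : ℝ≥0∞ :=
  ENNReal.ofReal (runMax f T ^ 2) + ENNReal.ofReal (64 * 4 ^ (r - 2)) *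
    ∑' i : ℕ, ENNReal.ofReal (((1 / 2 : ℝ) ^ (r - 2)) ^ i) * ENNReal.ofReal (skelSq f (m₀ + i) T)

/-- In `z ^ r = z ^ (r - 2) * z ^ 2` the first factor is bounded by the tolerance at level `m₀ + i`,
giving the geometric weight in `i`, and the second by a single jump at that level. The
Cauchy–Schwarz loss `√N ^ r` is absorbed by `hQ`. -/
theorem varNorm_residual_sq_le (hr : 2 < r) (f : ℕ → EuclideanSpace ℂ ι) {m₀ T : ℕ} (hm₀ : 1 ≤ m₀)
    (hQ : √(Fintype.card ι) ^ r * ((1 / 2 : ℝ) ^ m₀) ^ (r - 2) ≤ 1)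
    {θ : ℤ → ℕ} (hθ : Monotone θ ∨ Antitone θ) (hT : ∀ k, θ k ≤ T) (ξ : ι → ℝ) (x : ℝ) :
    varNorm r (fun k => expSum ξ (f (θ k) - skel f m₀ (θ k)).ofLp x) ^ 2
      ≤ residualBound r f m₀ T := by
  have hr0 : 0 < r := by linarith
  have hr2 : 0 < r - 2 := by linarith
  set M := runMax f T with hM
  have hM0 : 0 ≤ M := runMax_nonneg f T
  set κ : ℝ := (1 / 2 : ℝ) ^ (r - 2) with hκ
  set N := √(Fintype.card ι) with hN
  set Z : ℝ := ((1 / 2 : ℝ) ^ m₀ * M) ^ (r - 2) with hZ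
  have hZ0 : 0 ≤ Z := by positivity
  set Y := residualBound r f m₀ T with hY
  set jump : ℕ → ℕ → ℝ := fun i u => ‖skel f (m₀ + i) (u + 1) - skel f (m₀ + i) u‖ ^ 2 with hjump
  have hsplit : ∀ z : ℝ, 0 ≤ z → z ^ r = z ^ (r - 2) * z ^ 2 := fun z hz => by
    rw [← Real.rpow_two, ← Real.rpow_add_of_nonneg hz hr2.le (by norm_num), sub_add_cancel]
  have key := varNorm_comp_rpow_le (r := r) hr0 hθ hT
    (b := fun t => expSum ξ (f t - skel f m₀ t).ofLp x)
    (B := ENNReal.ofReal (N ^ r * Z) * ENNReal.ofReal (M ^ 2))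
    (w := fun u => ENNReal.ofReal (N ^ r * Z) * (ENNReal.ofReal (64 * 4 ^ (r - 2)) *
      ∑' i : ℕ, ENNReal.ofReal (κ ^ i) * ENNReal.ofReal (jump i u))) ?_ ?_
  · have hsum : ENNReal.ofReal (N ^ r * Z) * ENNReal.ofReal (M ^ 2)
        + ∑ u ∈ Finset.range T, ENNReal.ofReal (N ^ r * Z) * (ENNReal.ofReal (64 * 4 ^ (r - 2)) *
          ∑' i : ℕ, ENNReal.ofReal (κ ^ i) * ENNReal.ofReal (jump i u))
        ≤ ENNReal.ofReal (N ^ r * Z) * Y := by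
      rw [← Finset.mul_sum, ← mul_add, ← Finset.mul_sum,
        ← Summable.tsum_finsetSum fun _ _ => ENNReal.summable]
      rw [hY, residualBound]
      gcongr with i
      rw [← Finset.mul_sum]
      gcongr
      rw [← ENNReal.ofReal_sum_of_nonneg fun _ _ => by positivity]
      refine ENNReal.ofReal_le_ofReal ?_
      rw [skelSq]
      have : 0 ≤ ‖f 0‖ ^ 2 := by positivity
      simp only [hjump]
      linarith
    -- By `hQ` the prefactor is at most `M ^ (r - 2)`, and `M ^ 2` is one of the terms of `Y`. The
    -- total becomes `Y ^ (r / 2)`, as homogeneity requires.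
    have hZY : ENNReal.ofReal (N ^ r * Z) ≤ Y ^ ((r - 2) / 2) := by
      have e1 : N ^ r * Z ≤ (M ^ 2) ^ ((r - 2) / 2) := by
        have e2 : (M ^ 2) ^ ((r - 2) / 2) = M ^ (r - 2) := by
          rw [← Real.rpow_two, ← Real.rpow_mul hM0]
          congr 1
          ring
        rw [e2, hZ, Real.mul_rpow (by positivity) hM0, ← mul_assoc]
        exact mul_le_of_le_one_left (by positivity) hQ
      refine (ENNReal.ofReal_le_ofReal e1).trans ?_
      rw [← ENNReal.ofReal_rpow_of_nonneg (by positivity) (by positivity)]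
      refine ENNReal.rpow_le_rpow ?_ (by positivity)
      rw [hY, residualBound]
      exact le_self_add
    have hfin : varNorm r (fun k => expSum ξ (f (θ k) - skel f m₀ (θ k)).ofLp x) ^ r
        ≤ Y ^ (r / 2) := by
      refine key.trans (hsum.trans ?_)
      calc _ ≤ Y ^ ((r - 2) / 2) * Y ^ (1 : ℝ) := by
            rw [ENNReal.rpow_one]
            gcongr
        _ = _ := by
            rw [← ENNReal.rpow_add_of_nonneg _ _ (by positivity) (by norm_num)]
            congr 1
            ring
    have h2 := ENNReal.rpow_le_rpow hfin (show 0 ≤ 2 / r by positivity)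
    rw [← ENNReal.rpow_mul, ← ENNReal.rpow_mul] at h2
    have e3 : r * (2 / r) = 2 := by field_simp
    have e4 : r / 2 * (2 / r) = 1 := by field_simp
    rw [e3, e4, ENNReal.rpow_one, ENNReal.rpow_two] at h2
    exact h2
  · intro t htT
    rw [← ENNReal.ofReal_mul (by positivity), mul_assoc]
    refine enorm_expSum_rpow_le hr0.le ξ _ x ?_
    have h1 : ‖f t - skel f m₀ t‖ ≤ (1 / 2 : ℝ) ^ m₀ * M := by
      refine (norm_sub_skel_le f m₀ t).trans ?_
      gcongr
      exact runMax_mono f htT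
    calc _ ≤ ((1 / 2 : ℝ) ^ m₀ * M) ^ r := Real.rpow_le_rpow (norm_nonneg _) h1 hr0.le
      _ = Z * ((1 / 2 : ℝ) ^ m₀ * M) ^ 2 := hsplit _ (by positivity)
      _ ≤ Z * M ^ 2 := by
        gcongr
        exact mul_le_of_le_one_left hM0 (pow_le_one₀ (by norm_num) (by norm_num))
  · intro s t hst htT
    obtain ⟨m, hm, u, hu, h1, h2⟩ := exists_jump_residual f hm₀ hst
    obtain ⟨i, rfl⟩ := Nat.exists_eq_add_of_le hm
    rw [← expSum_sub, ← WithLp.ofLp_sub]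
    set z := ‖(f t - skel f m₀ t) - (f s - skel f m₀ s)‖ with hz
    have hz1 : z ≤ 4 * ((1 / 2 : ℝ) ^ (m₀ + i) * M) := h1.trans (by
      gcongr
      exact runMax_mono f htT)
    have hzr : z ^ r ≤ Z * (64 * 4 ^ (r - 2)) * (κ ^ i * jump i u) := by
      rw [hsplit z (norm_nonneg _)]
      calc _ ≤ (4 * ((1 / 2 : ℝ) ^ (m₀ + i) * M)) ^ (r - 2) * (8 * ‖skel f (m₀ + i) (u + 1) - skel f (m₀ + i) u‖) ^ 2 := by
            gcongr
        _ = _ := by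
            have e1 : 4 * ((1 / 2 : ℝ) ^ (m₀ + i) * M) = 4 * ((1 / 2 : ℝ) ^ m₀ * M) * (1 / 2) ^ i := by
              rw [pow_add]; ring
            have e2 : ((1 / 2 : ℝ) ^ i) ^ (r - 2) = κ ^ i := by
              rw [hκ, ← Real.rpow_natCast, ← Real.rpow_natCast, ← Real.rpow_mul (by norm_num),
                ← Real.rpow_mul (by norm_num), mul_comm]
            rw [e1, Real.mul_rpow (by positivity) (by positivity),
              Real.mul_rpow (by norm_num) (by positivity), e2, mul_pow, hZ, hjump]
            ring
    refine (enorm_expSum_rpow_le hr0.le ξ _ x hzr).trans ?_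
    refine le_trans ?_ (Finset.single_le_sum (f := fun u => ENNReal.ofReal (N ^ r * Z) *
      (ENNReal.ofReal (64 * 4 ^ (r - 2)) * ∑' i : ℕ, ENNReal.ofReal (κ ^ i) *
        ENNReal.ofReal (jump i u))) (fun _ _ => bot_le) hu)
    calc _ = ENNReal.ofReal (N ^ r * Z) * (ENNReal.ofReal (64 * 4 ^ (r - 2)) *
          (ENNReal.ofReal (κ ^ i) * ENNReal.ofReal (jump i u))) := by
          rw [← ENNReal.ofReal_mul (by positivity), ← ENNReal.ofReal_mul (by positivity),
            ← ENNReal.ofReal_mul (by positivity)]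
          congr 1
          ring
      _ ≤ _ := by
          gcongr
          exact ENNReal.le_tsum (f := fun i => ENNReal.ofReal (κ ^ i) * ENNReal.ofReal (jump i u)) i

variable {ℓ : ℝ}

theorem lintegral_expSum_euclidean_le (hℓ : 0 < ℓ) (hsep : ∀ i j, i ≠ j → ℓ⁻¹ ≤ |ξ i - ξ j|)
    (c : EuclideanSpace ℂ ι) (a : ℝ) :
    ∫⁻ x in Set.Ico a (a + ℓ), ‖expSum ξ c.ofLp x‖ₑ ^ 2 ≤ ENNReal.ofReal (32 * ℓ * ‖c‖ ^ 2) := by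
  refine (lintegral_expSum_sq_le hℓ hsep c.ofLp a).trans (le_of_eq ?_)
  rw [ENNReal.ofReal_mul (p := 32 * ℓ) (by positivity), EuclideanSpace.norm_sq_eq,
    ENNReal.ofReal_sum_of_nonneg fun _ _ => by positivity]
  congr 1
  refine Finset.sum_congr rfl fun i _ => ?_
  rw [← ofReal_norm, ENNReal.ofReal_pow (norm_nonneg _)]

/-- For a fixed path the jump times do not depend on `x`, so the large sieve applies separately to
each value next to a jump. -/
theorem lintegral_varNorm_two_step_le (hℓ : 0 < ℓ) (hsep : ∀ i j, i ≠ j → ℓ⁻¹ ≤ |ξ i - ξ j|)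
    {θ : ℤ → ℕ} (hθ : Monotone θ ∨ Antitone θ) {T : ℕ} (hT : ∀ k, θ k ≤ T)
    (b : ℕ → EuclideanSpace ℂ ι) (J : Finset ℕ) (hJ : ∀ u < T, u ∉ J → b (u + 1) = b u) (a : ℝ) :
    ∫⁻ x in Set.Ico a (a + ℓ), varNorm 2 (fun k => expSum ξ (b (θ k)).ofLp x) ^ 2
      ≤ ENNReal.ofReal (32 * ℓ * (‖b 0‖ ^ 2 + 5 * ∑ u ∈ J, (‖b u‖ ^ 2 + ‖b (u + 1)‖ ^ 2))) := by
  have hmeas : ∀ c : EuclideanSpace ℂ ι, Measurable fun x => ‖expSum ξ c.ofLp x‖ₑ ^ 2 := fun c =>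
    (continuous_expSum ξ _).measurable.enorm.pow_const 2
  calc _ ≤ ∫⁻ x in Set.Ico a (a + ℓ), (‖expSum ξ (b 0).ofLp x‖ₑ ^ 2
        + 5 * ∑ u ∈ J, (‖expSum ξ (b u).ofLp x‖ₑ ^ 2 + ‖expSum ξ (b (u + 1)).ofLp x‖ₑ ^ 2)) := by
        refine lintegral_mono fun x => ?_
        exact varNorm_two_step_le hθ hT (fun t => expSum ξ (b t).ofLp x) J
          fun u hu h => by rw [hJ u hu h]
    _ = (∫⁻ x in Set.Ico a (a + ℓ), ‖expSum ξ (b 0).ofLp x‖ₑ ^ 2)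
        + 5 * ∑ u ∈ J, ((∫⁻ x in Set.Ico a (a + ℓ), ‖expSum ξ (b u).ofLp x‖ₑ ^ 2)
          + ∫⁻ x in Set.Ico a (a + ℓ), ‖expSum ξ (b (u + 1)).ofLp x‖ₑ ^ 2) := by
        rw [lintegral_add_left (hmeas _), lintegral_const_mul' _ _ (by simp), lintegral_finsetSum]
        · congr 2
          refine Finset.sum_congr rfl fun u _ => ?_
          rw [lintegral_add_left (hmeas _)]
        · exact fun u _ => (hmeas _).add (hmeas _)
    _ ≤ ENNReal.ofReal (32 * ℓ * ‖b 0‖ ^ 2) + 5 * ∑ u ∈ J, (ENNReal.ofReal (32 * ℓ * ‖b u‖ ^ 2)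
          + ENNReal.ofReal (32 * ℓ * ‖b (u + 1)‖ ^ 2)) := by
        gcongr <;> exact lintegral_expSum_euclidean_le hℓ hsep _ a
    _ = _ := by
        have : ∀ u, ENNReal.ofReal (32 * ℓ * ‖b u‖ ^ 2) + ENNReal.ofReal (32 * ℓ * ‖b (u + 1)‖ ^ 2)
            = ENNReal.ofReal (32 * ℓ * ‖b u‖ ^ 2 + 32 * ℓ * ‖b (u + 1)‖ ^ 2) := fun u => by
          rw [ENNReal.ofReal_add (by positivity) (by positivity)]
        simp only [this]
        rw [← ENNReal.ofReal_sum_of_nonneg fun _ _ => by positivity,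
          show (5 : ℝ≥0∞) = ENNReal.ofReal 5 by simp, ← ENNReal.ofReal_mul (by norm_num),
          ← ENNReal.ofReal_add (by positivity) (by positivity)]
        congr 1
        simp only [← mul_add, ← Finset.mul_sum]
        ring

theorem lintegral_varNorm_skel_zero_le (hℓ : 0 < ℓ) (hsep : ∀ i j, i ≠ j → ℓ⁻¹ ≤ |ξ i - ξ j|)
    {θ : ℤ → ℕ} (hθ : Monotone θ ∨ Antitone θ) {T : ℕ} (hT : ∀ k, θ k ≤ T)
    (f : ℕ → EuclideanSpace ℂ ι) (a : ℝ) :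
    ∫⁻ x in Set.Ico a (a + ℓ), varNorm 2 (fun k => expSum ξ (skel f 0 (θ k)).ofLp x) ^ 2
      ≤ ENNReal.ofReal (320 * ℓ * skelSq f 0 T) := by
  classical
  refine (lintegral_varNorm_two_step_le hℓ hsep hθ hT (skel f 0)
    ((Finset.range T).filter fun u => skel f 0 (u + 1) ≠ skel f 0 u) (fun u hu h => ?_) a).trans ?_
  · by_contra hc
    exact h (Finset.mem_filter.2 ⟨Finset.mem_range.2 hu, hc⟩)
  refine ENNReal.ofReal_le_ofReal ?_
  have h1 : ∑ u ∈ (Finset.range T).filter fun u => skel f 0 (u + 1) ≠ skel f 0 u,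
      (‖skel f 0 u‖ ^ 2 + ‖skel f 0 (u + 1)‖ ^ 2)
      ≤ ∑ u ∈ Finset.range T, 2 * ‖skel f 0 (u + 1) - skel f 0 u‖ ^ 2 := by
    refine (Finset.sum_le_sum fun u hu => skel_zero_jump_le f (Finset.mem_filter.1 hu).2).trans ?_
    exact Finset.sum_le_sum_of_subset_of_nonneg (Finset.filter_subset _ _)
      fun _ _ _ => by positivity
  rw [← Finset.mul_sum] at h1
  rw [skelSq]
  have h2 : ‖skel f 0 0‖ ^ 2 = ‖f 0‖ ^ 2 := rfl
  have h3 : 0 ≤ ‖f 0‖ ^ 2 := by positivity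
  rw [h2]
  calc _ ≤ 32 * ℓ * (10 * (‖f 0‖ ^ 2 + ∑ u ∈ Finset.range T, ‖skel f 0 (u + 1) - skel f 0 u‖ ^ 2)) := by
        gcongr
        linarith
    _ = _ := by ring

/-- The difference of two samplings moves only when one of them jumps, and is then no larger than a
multiple of that jump; `2880 = 32 * 5 * 18`. -/
theorem lintegral_varNorm_skel_succ_le (hℓ : 0 < ℓ) (hsep : ∀ i j, i ≠ j → ℓ⁻¹ ≤ |ξ i - ξ j|)
    {θ : ℤ → ℕ} (hθ : Monotone θ ∨ Antitone θ) {T : ℕ} (hT : ∀ k, θ k ≤ T)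
    (f : ℕ → EuclideanSpace ℂ ι) (m : ℕ) (a : ℝ) :
    ∫⁻ x in Set.Ico a (a + ℓ),
        varNorm 2 (fun k => expSum ξ (skel f (m + 1) (θ k) - skel f m (θ k)).ofLp x) ^ 2
      ≤ ENNReal.ofReal (2880 * ℓ * (skelSq f (m + 1) T + skelSq f m T)) := by
  classical
  set J := (Finset.range T).filter fun u =>
    skel f (m + 1) (u + 1) ≠ skel f (m + 1) u ∨ skel f m (u + 1) ≠ skel f m u with hJ
  refine (lintegral_varNorm_two_step_le hℓ hsep hθ hT (fun t => skel f (m + 1) t - skel f m t)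
    J (fun u hu h => ?_) a).trans ?_
  · simp only [hJ, Finset.mem_filter, Finset.mem_range, not_and, not_or, not_not] at h
    rw [(h hu).1, (h hu).2]
  refine ENNReal.ofReal_le_ofReal ?_
  have h1 : ∑ u ∈ J, (‖skel f (m + 1) u - skel f m u‖ ^ 2
      + ‖skel f (m + 1) (u + 1) - skel f m (u + 1)‖ ^ 2)
      ≤ ∑ u ∈ Finset.range T, 18 * (‖skel f (m + 1) (u + 1) - skel f (m + 1) u‖ ^ 2
        + ‖skel f m (u + 1) - skel f m u‖ ^ 2) := by
    refine (Finset.sum_le_sum fun u hu => skel_succ_sub_skel_jump_le f (Finset.mem_filter.1 hu).2).trans ?_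
    exact Finset.sum_le_sum_of_subset_of_nonneg (Finset.filter_subset _ _)
      fun _ _ _ => by positivity
  rw [← Finset.mul_sum, Finset.sum_add_distrib (s := Finset.range T)] at h1
  have h2 : skel f (m + 1) 0 - skel f m 0 = 0 := sub_self _
  have h3 : 0 ≤ ‖f 0‖ ^ 2 := by positivity
  rw [h2, skelSq, skelSq]
  calc _ ≤ 32 * ℓ * (90 * (‖f 0‖ ^ 2 + ∑ u ∈ Finset.range T, ‖skel f (m + 1) (u + 1) - skel f (m + 1) u‖ ^ 2
        + (‖f 0‖ ^ 2 + ∑ u ∈ Finset.range T, ‖skel f m (u + 1) - skel f m u‖ ^ 2))) := by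
        gcongr
        rw [norm_zero]
        linarith
    _ = _ := by ring

theorem sum_sq_le_card_mul {α : Type*} (S : Finset α) (x : α → ℝ≥0∞) :
    (∑ i ∈ S, x i) ^ 2 ≤ S.card * ∑ i ∈ S, x i ^ 2 := by
  have := sum_sq_le_weighted S (w := fun _ => 1) (fun _ => one_pos) x
  simpa using this

/-- Index 0 is the residual, index 1 the coarsest sampling, and the remaining indices the
differences of consecutive levels below `m₀`. -/
theorem skel_telescope (f : ℕ → EuclideanSpace ℂ ι) (m₀ t : ℕ) (ξ : ι → ℝ) (x : ℝ) :
    expSum ξ (f t).ofLp x = ∑ j ∈ Finset.range (m₀ + 2),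
      (if j = 0 then expSum ξ (f t - skel f m₀ t).ofLp x
        else if j = 1 then expSum ξ (skel f 0 t).ofLp x
        else expSum ξ (skel f (j - 2 + 1) t - skel f (j - 2) t).ofLp x) := by
  rw [Finset.sum_range_succ', Finset.sum_range_succ']
  simp only [Nat.add_eq_zero_iff, one_ne_zero, and_false, if_false, if_true,
    zero_add, Nat.add_eq_right, WithLp.ofLp_sub, expSum_sub]
  have := Finset.sum_range_sub (fun j => expSum ξ (skel f j t).ofLp x) m₀
  simp only [show ∀ j, j + 1 + 1 - 2 = j by omega, this]
  ring

/-- The variation of an exponential sum whose coefficients run along a path, on an interval of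
length at least the inverse of the separation of the frequencies. -/
theorem lintegral_varNorm_path_le (hr : 2 < r) (hℓ : 0 < ℓ)
    (hsep : ∀ i j, i ≠ j → ℓ⁻¹ ≤ |ξ i - ξ j|)
    {θ : ℤ → ℕ} (hθ : Monotone θ ∨ Antitone θ) {T : ℕ} (hT : ∀ k, θ k ≤ T)
    (f : ℕ → EuclideanSpace ℂ ι) {m₀ : ℕ} (hm₀ : 1 ≤ m₀)
    (hQ : √(Fintype.card ι) ^ r * ((1 / 2 : ℝ) ^ m₀) ^ (r - 2) ≤ 1) (a : ℝ) :
    ∫⁻ x in Set.Ico a (a + ℓ), varNorm r (fun k => expSum ξ (f (θ k)).ofLp x) ^ 2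
      ≤ (m₀ + 2 : ℕ) * (ENNReal.ofReal ℓ * residualBound r f m₀ T
        + ENNReal.ofReal (320 * ℓ * skelSq f 0 T)
        + ∑ m ∈ Finset.range m₀, ENNReal.ofReal (2880 * ℓ * (skelSq f (m + 1) T + skelSq f m T))) := by
  set g : ℕ → ℝ → ℕ → ℂ := fun j x t => if j = 0 then expSum ξ (f t - skel f m₀ t).ofLp x
        else if j = 1 then expSum ξ (skel f 0 t).ofLp x
        else expSum ξ (skel f (j - 2 + 1) t - skel f (j - 2) t).ofLp x with hg
  have hgm : ∀ j, Measurable fun x => varNorm r (fun k => g j x (θ k)) := by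
    intro j
    refine measurable_varNorm (a := fun k x => g j x (θ k)) fun k => ?_
    simp only [hg]
    split_ifs <;> exact (continuous_expSum ξ _).measurable
  calc _ ≤ ∫⁻ x in Set.Ico a (a + ℓ), (m₀ + 2 : ℕ) *
        ∑ j ∈ Finset.range (m₀ + 2), varNorm r (fun k => g j x (θ k)) ^ 2 := by
        refine lintegral_mono fun x => ?_
        simp only [skel_telescope f m₀]
        have h1 := varNorm_sum_le (r := r) (by linarith) (Finset.range (m₀ + 2))
          (fun j (k : ℤ) => g j x (θ k))
        have h2 := sum_sq_le_card_mul (Finset.range (m₀ + 2)) (fun j => varNorm r (fun k => g j x (θ k)))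
        rw [Finset.card_range] at h2
        exact le_trans (by gcongr) h2
    _ = (m₀ + 2 : ℕ) * ∑ j ∈ Finset.range (m₀ + 2),
        ∫⁻ x in Set.Ico a (a + ℓ), varNorm r (fun k => g j x (θ k)) ^ 2 := by
        rw [lintegral_const_mul' _ _ (by simp), lintegral_finsetSum]
        exact fun j _ => (hgm j).pow_const 2
    _ ≤ _ := by
        gcongr
        rw [Finset.sum_range_succ', Finset.sum_range_succ', add_assoc, add_comm, add_comm
          (∫⁻ x in Set.Ico a (a + ℓ), varNorm r (fun k => g (0 + 1) x (θ k)) ^ 2)]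
        refine add_le_add (add_le_add ?_ ?_) (Finset.sum_le_sum fun m _ => ?_)
        · calc _ ≤ ∫⁻ x in Set.Ico a (a + ℓ), residualBound r f m₀ T := by
                refine lintegral_mono fun x => ?_
                simp only [hg, if_true]
                exact varNorm_residual_sq_le hr f hm₀ hQ hθ hT ξ x
            _ = _ := by simp [mul_comm]
        · refine le_trans (lintegral_mono fun x => ?_)
            (lintegral_varNorm_skel_zero_le hℓ hsep hθ hT f a)
          simp only [hg, zero_add, one_ne_zero, if_false, if_true]
          gcongr
          exact varNorm_le_varNorm_two hr.le _
        · refine le_trans (lintegral_mono fun x => ?_)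
            (lintegral_varNorm_skel_succ_le hℓ hsep hθ hT f m a)
          have e : ∀ k, g (m + 1 + 1) x (θ k)
              = expSum ξ (skel f (m + 1) (θ k) - skel f m (θ k)).ofLp x := fun k => by
            simp [hg]
          simp only [e]
          gcongr
          exact varNorm_le_varNorm_two hr.le _

end PathExpSum

/-! ### Summation of the path estimates over all leaves. -/

theorem tsum_ofReal_le_of_sum_Ico_le {T : ℕ} {S E : ℤ → ℝ} (hS : ∀ n, 0 ≤ S n) (hE : ∀ n, 0 ≤ E n)
    {C : ℝ} (hC : 0 ≤ C) (h : ∀ a b : ℤ, ∑ n ∈ Finset.Ico (2 ^ T * a) (2 ^ T * b), S n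
      ≤ C * ∑ n ∈ Finset.Ico (2 ^ T * a) (2 ^ T * b), E n) :
    ∑' n, ENNReal.ofReal (S n) ≤ ENNReal.ofReal C * ∑' n, ENNReal.ofReal (E n) := by
  rw [ENNReal.tsum_eq_iSup_sum]
  refine iSup_le fun s => ?_
  obtain ⟨R, hR⟩ : ∃ R : ℕ, ∀ n ∈ s, n.natAbs < R :=
    ⟨∑ n ∈ s, n.natAbs + 1, fun n hn => Nat.lt_succ_of_le
      (Finset.single_le_sum (f := Int.natAbs) (fun _ _ => bot_le) hn)⟩
  have hsub : s ⊆ Finset.Ico (2 ^ T * (-(R : ℤ))) (2 ^ T * (R : ℤ)) := fun n hn => by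
    have h1 := hR n hn
    have h2 : (R : ℤ) ≤ 2 ^ T * R := le_mul_of_one_le_left (by positivity) (one_le_pow₀ (by norm_num))
    rw [Finset.mem_Ico, mul_neg]
    omega
  calc _ ≤ ∑ n ∈ Finset.Ico (2 ^ T * (-(R : ℤ))) (2 ^ T * (R : ℤ)), ENNReal.ofReal (S n) :=
        Finset.sum_le_sum_of_subset hsub
    _ = ENNReal.ofReal (∑ n ∈ Finset.Ico (2 ^ T * (-(R : ℤ))) (2 ^ T * (R : ℤ)), S n) := by
        rw [ENNReal.ofReal_sum_of_nonneg fun n _ => hS n]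
    _ ≤ ENNReal.ofReal (C * ∑ n ∈ Finset.Ico (2 ^ T * (-(R : ℤ))) (2 ^ T * (R : ℤ)), E n) :=
        ENNReal.ofReal_le_ofReal (h _ _)
    _ = ENNReal.ofReal C * ∑ n ∈ Finset.Ico (2 ^ T * (-(R : ℤ))) (2 ^ T * (R : ℤ)), ENNReal.ofReal (E n) := by
        rw [ENNReal.ofReal_mul hC, ENNReal.ofReal_sum_of_nonneg fun n _ => hE n]
    _ ≤ _ := by
        gcongr
        exact ENNReal.sum_le_tsum _

theorem skelSq_nonneg {H : Type*} [NormedAddCommGroup H] (f : ℕ → H) (m t : ℕ) :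
    0 ≤ skelSq f m t := by
  unfold skelSq
  positivity

/-- The constant bounding the residual part. -/
noncomputable def residualConst (r : ℝ) : ℝ≥0∞ :=
  4 + ENNReal.ofReal (64 * 4 ^ (r - 2)) * ∑' i : ℕ, ENNReal.ofReal (((1 / 2 : ℝ) ^ (r - 2)) ^ i)

theorem residualConst_ne_top {r : ℝ} (hr : 2 < r) : residualConst r ≠ ∞ := by
  have hκ : (1 / 2 : ℝ) ^ (r - 2) < 1 := Real.rpow_lt_one (by norm_num) (by norm_num) (by linarith)
  have hκ0 : 0 ≤ (1 / 2 : ℝ) ^ (r - 2) := by positivity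
  unfold residualConst
  rw [← ENNReal.ofReal_tsum_of_nonneg (fun i => by positivity)
    (summable_geometric_of_lt_one hκ0 hκ)]
  exact ENNReal.add_ne_top.2 ⟨by simp, ENNReal.mul_ne_top ENNReal.ofReal_ne_top ENNReal.ofReal_ne_top⟩

section Tree

variable {ι : Type*} [Fintype ι] {ξ : ι → ℝ} {r ℓ : ℝ}

theorem tsum_skelSq_le {H : Type*} [NormedAddCommGroup H] [InnerProductSpace ℂ H]
    (F : ℕ → ℤ → H) (m T : ℕ)
    (hF : ∀ t < T, ∀ q, (2 : ℂ) • F t q = F (t + 1) (2 * q) + F (t + 1) (2 * q + 1)) :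
    ∑' n, ENNReal.ofReal (skelSq (leafPath F T n) m T) ≤ ∑' n, ENNReal.ofReal (‖F T n‖ ^ 2) := by
  have := tsum_ofReal_le_of_sum_Ico_le (T := T) (S := fun n => skelSq (leafPath F T n) m T)
    (E := fun n => ‖F T n‖ ^ 2) (fun n => skelSq_nonneg _ _ _) (fun n => by positivity) zero_le_one
    (fun a b => by rw [one_mul]; exact tree_sum_skelSq_le F m a b T hF)
  simpa using this

theorem tsum_residualBound_le {H : Type*} [NormedAddCommGroup H] [InnerProductSpace ℂ H]
    (r : ℝ) (F : ℕ → ℤ → H) (m₀ T : ℕ)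
    (hF : ∀ t < T, ∀ q, (2 : ℂ) • F t q = F (t + 1) (2 * q) + F (t + 1) (2 * q + 1)) :
    ∑' n, residualBound r (leafPath F T n) m₀ T
      ≤ residualConst r * ∑' n, ENNReal.ofReal (‖F T n‖ ^ 2) := by
  unfold residualBound residualConst
  rw [ENNReal.tsum_add, ENNReal.tsum_mul_left, ENNReal.tsum_comm, add_mul, mul_assoc,
    ← ENNReal.tsum_mul_right]
  refine add_le_add ?_ ?_
  · have := tsum_ofReal_le_of_sum_Ico_le (T := T) (S := fun n => runMax (leafPath F T n) T ^ 2)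
      (E := fun n => ‖F T n‖ ^ 2) (fun n => by positivity) (fun n => by positivity)
      (C := 4) (by norm_num) (fun a b => tree_sum_runMax_sq_le F a b T hF)
    simpa using this
  · gcongr with i
    rw [ENNReal.tsum_mul_left]
    exact mul_le_mul' le_rfl (tsum_skelSq_le F _ T hF)

/-- On a finest cell the coefficient path is fixed, so the path estimate applies; summed over
leaves, every level is bounded by the same energy. One factor `m₀ + 2` comes from Cauchy–Schwarz
over the pieces, the other from their number. -/
theorem lintegral_varNorm_tree_le (hr : 2 < r) (hℓ : 0 < ℓ)
    (hsep : ∀ i j, i ≠ j → ℓ⁻¹ ≤ |ξ i - ξ j|)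
    {θ : ℤ → ℕ} (hθ : Monotone θ ∨ Antitone θ) {T : ℕ} (hT : ∀ k, θ k ≤ T)
    (F : ℕ → ℤ → EuclideanSpace ℂ ι)
    (hF : ∀ t < T, ∀ q, (2 : ℂ) • F t q = F (t + 1) (2 * q) + F (t + 1) (2 * q + 1))
    {m₀ : ℕ} (hm₀ : 1 ≤ m₀)
    (hQ : √(Fintype.card ι) ^ r * ((1 / 2 : ℝ) ^ m₀) ^ (r - 2) ≤ 1) :
    ∫⁻ x, varNorm r (fun k => expSum ξ (leafPath F T ⌊x / ℓ⌋ (θ k)).ofLp x) ^ 2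
      ≤ (residualConst r + 5760) * (m₀ + 2 : ℕ) ^ 2 *
        (ENNReal.ofReal ℓ * ∑' n, ENNReal.ofReal (‖F T n‖ ^ 2)) := by
  set E := ∑' n, ENNReal.ofReal (‖F T n‖ ^ 2) with hE
  have hS : ∀ m, ∑' n, ENNReal.ofReal (skelSq (leafPath F T n) m T) ≤ E :=
    fun m => tsum_skelSq_le F m T hF
  rw [lintegral_eq_tsum_cells hℓ]
  have hcell : ∀ q : ℤ, ∫⁻ x in Set.Ico (ℓ * q) (ℓ * q + ℓ),
      varNorm r (fun k => expSum ξ (leafPath F T ⌊x / ℓ⌋ (θ k)).ofLp x) ^ 2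
      ≤ (m₀ + 2 : ℕ) * (ENNReal.ofReal ℓ * residualBound r (leafPath F T q) m₀ T
        + ENNReal.ofReal (320 * ℓ) * ENNReal.ofReal (skelSq (leafPath F T q) 0 T)
        + ∑ m ∈ Finset.range m₀, ENNReal.ofReal (2880 * ℓ) *
          (ENNReal.ofReal (skelSq (leafPath F T q) (m + 1) T)
            + ENNReal.ofReal (skelSq (leafPath F T q) m T))) := by
    intro q
    have h1 := lintegral_varNorm_path_le hr hℓ hsep hθ hT (leafPath F T q) hm₀ hQ (ℓ * q)
    have h2 : ∀ m, 0 ≤ skelSq (leafPath F T q) m T := fun m => skelSq_nonneg _ _ _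
    simp only [ENNReal.ofReal_mul (show 0 ≤ 320 * ℓ by positivity),
      ENNReal.ofReal_mul (show 0 ≤ 2880 * ℓ by positivity),
      ENNReal.ofReal_add (h2 _) (h2 _)] at h1
    refine le_trans (le_of_eq ?_) h1
    refine setLIntegral_congr_fun measurableSet_Ico fun x hx => ?_
    simp only [floor_of_mem_cell hℓ hx]
  refine (ENNReal.tsum_le_tsum hcell).trans ?_
  rw [ENNReal.tsum_mul_left, ENNReal.tsum_add, ENNReal.tsum_add, ENNReal.tsum_mul_left,
    ENNReal.tsum_mul_left, Summable.tsum_finsetSum fun _ _ => ENNReal.summable]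
  simp only [ENNReal.tsum_mul_left, ENNReal.tsum_add]
  calc _ ≤ ((m₀ + 2 : ℕ) : ℝ≥0∞) * (ENNReal.ofReal ℓ * (residualConst r * E)
        + ENNReal.ofReal (320 * ℓ) * E
        + ∑ m ∈ Finset.range m₀, ENNReal.ofReal (2880 * ℓ) * (E + E)) := by
        gcongr
        · exact tsum_residualBound_le r F m₀ T hF
        · exact hS 0
        · exact hS _
        · exact hS _
    _ = ((m₀ + 2 : ℕ) : ℝ≥0∞) * (residualConst r + 320 + m₀ * 5760) * (ENNReal.ofReal ℓ * E) := by
        rw [Finset.sum_const, Finset.card_range, nsmul_eq_mul, ENNReal.ofReal_mul (by norm_num),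
          ENNReal.ofReal_mul (by norm_num)]
        simp only [ENNReal.ofReal_ofNat]
        ring
    _ ≤ ((m₀ + 2 : ℕ) : ℝ≥0∞) * ((residualConst r + 5760) * (m₀ + 2 : ℕ)) * (ENNReal.ofReal ℓ * E) := by
        gcongr
        have h1 : (1 : ℝ≥0∞) ≤ (m₀ + 2 : ℕ) := by exact_mod_cast (by omega : 1 ≤ m₀ + 2)
        have h2 : (320 : ℝ≥0∞) + m₀ * 5760 ≤ 5760 * (m₀ + 2 : ℕ) := by
          exact_mod_cast (by omega : 320 + m₀ * 5760 ≤ 5760 * (m₀ + 2))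
        rw [add_mul, add_assoc]
        exact add_le_add (le_mul_of_one_le_right' h1) h2
    _ = _ := by ring

end Tree

/-! ### Separated frequencies. -/

theorem floor_div_two_pow (lam x : ℝ) (j : ℕ) :
    ⌊x / (lam * 2 ^ j)⌋ = ⌊x / lam⌋ / 2 ^ j := by
  rw [← div_div]
  have := Int.floor_div_natCast (x / lam) (2 ^ j)
  push_cast at this
  exact this

/-- The martingale property of dyadic averages. -/
theorem two_mul_cellAvg {ℓ : ℝ} (hℓ : 0 < ℓ) {g : ℝ → ℂ} (hg : Continuous g) (q : ℤ) :
    2 * cellAvg (ℓ * 2) g q = cellAvg ℓ g (2 * q) + cellAvg ℓ g (2 * q + 1) := by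
  unfold cellAvg
  have hio : ∀ a b, IntegrableOn g (Set.Ico a b) := fun a b =>
    hg.integrableOn_Icc.mono_set Set.Ico_subset_Icc_self
  have hunion : Set.Ico (ℓ * 2 * q) (ℓ * 2 * q + ℓ * 2)
      = Set.Ico (ℓ * (2 * q : ℤ)) (ℓ * (2 * q : ℤ) + ℓ)
        ∪ Set.Ico (ℓ * (2 * q + 1 : ℤ)) (ℓ * (2 * q + 1 : ℤ) + ℓ) := by
    have e1 : ℓ * (2 * q + 1 : ℤ) = ℓ * (2 * q : ℤ) + ℓ := by push_cast; ring
    rw [e1, Set.Ico_union_Ico_eq_Ico (by linarith) (by linarith)]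
    congr 1 <;> (push_cast; ring)
  rw [hunion, setIntegral_union _ measurableSet_Ico (hio _ _) (hio _ _)]
  · have : (ℓ : ℂ) ≠ 0 := by exact_mod_cast hℓ.ne'
    push_cast
    field_simp
  · refine Set.disjoint_left.2 fun x h1 h2 => ?_
    have := floor_of_mem_cell hℓ h1
    rw [floor_of_mem_cell hℓ h2] at this
    omega

theorem tsum_cellAvg_le {ℓ : ℝ} (hℓ : 0 < ℓ) {g : ℝ → ℂ} (hg : Continuous g) :
    ENNReal.ofReal ℓ * ∑' q : ℤ, ‖cellAvg ℓ g q‖ₑ ^ 2 ≤ ∫⁻ x, ‖g x‖ₑ ^ 2 := by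
  rw [lintegral_eq_tsum_cells hℓ, ← ENNReal.tsum_mul_left]
  refine ENNReal.tsum_le_tsum fun q => ?_
  unfold cellAvg
  have h1 : ‖(ℓ : ℂ)⁻¹‖ₑ = ENNReal.ofReal ℓ⁻¹ := by
    rw [← ofReal_norm, norm_inv, Complex.norm_real, Real.norm_of_nonneg hℓ.le]
  have h5 : ENNReal.ofReal ℓ⁻¹ * ENNReal.ofReal ℓ = 1 := by
    rw [← ENNReal.ofReal_mul (by positivity), inv_mul_cancel₀ hℓ.ne', ENNReal.ofReal_one]
  rw [enorm_mul, h1, mul_pow]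
  calc _ ≤ ENNReal.ofReal ℓ * (ENNReal.ofReal ℓ⁻¹ ^ 2 *
        (ENNReal.ofReal ℓ * ∫⁻ y in Set.Ico (ℓ * q) (ℓ * q + ℓ), ‖g y‖ₑ ^ 2)) := by
        gcongr
        calc _ ≤ (∫⁻ y in Set.Ico (ℓ * q) (ℓ * q + ℓ), ‖g y‖ₑ) ^ 2 := by
              gcongr
              exact enorm_integral_le_lintegral_enorm _
          _ ≤ _ := by
              refine (lintegral_sq_le_measure_mul _ hg.measurable.enorm.aemeasurable).trans
                (le_of_eq ?_)
              simp
    _ = (ENNReal.ofReal ℓ⁻¹ * ENNReal.ofReal ℓ) ^ 2 *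
        ∫⁻ y in Set.Ico (ℓ * q) (ℓ * q + ℓ), ‖g y‖ₑ ^ 2 := by ring
    _ ≤ _ := by rw [h5, one_pow, one_mul]

/-- The constant in the estimate for separated frequencies. -/
noncomputable def blockConst (r : ℝ) : ℝ≥0∞ := 2 * (11 * 61440 + (residualConst r + 5760))

theorem blockConst_ne_top {r : ℝ} (hr : 2 < r) : blockConst r ≠ ∞ := by
  have := residualConst_ne_top hr
  unfold blockConst
  finiteness

/-- Variational estimate for sharp frequency truncations around separated frequencies. -/
theorem lintegral_varNorm_separated_le {ι : Type*} [Fintype ι] {ξ : ι → ℝ} {r lam : ℝ}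
    {h : ι → ℝ → ℂ} (hr : 2 < r) (hl : 0 < lam)
    (hsep : ∀ i j, i ≠ j → lam⁻¹ ≤ |ξ i - ξ j|)
    (hh : ∀ i, IsBand lam⁻¹ (h i)) (hsupp : ∀ i η, h i η ≠ 0 → η ∈ band lam⁻¹)
    {T : ℕ} {θ : ℤ → ℕ} (hθ : Monotone θ ∨ Antitone θ) (hT : ∀ k, θ k ≤ T)
    {m₀ : ℕ} (hm₀ : 1 ≤ m₀)
    (hQ : √(Fintype.card ι) ^ r * ((1 / 2 : ℝ) ^ m₀) ^ (r - 2) ≤ 1) :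
    ∫⁻ x, varNorm r (fun k => expSum ξ (fun i =>
      (𝓕⁻ ((band (lam⁻¹ * (1 / 2) ^ (T - θ k))).indicator (h i)) : ℝ → ℂ) x) x) ^ 2
      ≤ blockConst r * (m₀ + 2 : ℕ) ^ 2 * ∑ i, ∫⁻ η, ‖h i η‖ₑ ^ 2 := by
  set X := ∑ i, ∫⁻ η, ‖h i η‖ₑ ^ 2 with hX
  -- Time runs from coarse to fine: time `t` is the scale `lam * 2 ^ (T - t)`, so the leaves are
  -- cells of length `lam`.
  set F : ℕ → ℤ → EuclideanSpace ℂ ι := fun t q =>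
    WithLp.toLp 2 fun i => cellAvg (lam * 2 ^ (T - t)) (𝓕⁻ (h i)) q with hFdef
  have hF : ∀ t < T, ∀ q, (2 : ℂ) • F t q = F (t + 1) (2 * q) + F (t + 1) (2 * q + 1) := by
    intro t ht q
    ext i
    have e : lam * 2 ^ (T - t) = lam * 2 ^ (T - (t + 1)) * 2 := by
      rw [show T - t = T - (t + 1) + 1 by omega, pow_succ, mul_assoc]
    simp only [hFdef, PiLp.smul_apply, PiLp.add_apply, smul_eq_mul, e]
    exact two_mul_cellAvg (by positivity) (hh i).continuous q
  set G : ℝ → ℕ → ℂ := fun x t => expSum ξ (leafPath F T ⌊x / lam⌋ t).ofLp x with hG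
  set er : ℕ → ℝ → ℂ := fun j x => expSum ξ (fun i =>
      (𝓕⁻ ((band (lam⁻¹ * (1 / 2) ^ j)).indicator (h i)) : ℝ → ℂ) x
        - cellAvg (lam * 2 ^ j) (𝓕⁻ (h i)) ⌊x / (lam * 2 ^ j)⌋) x with her
  have hdec : ∀ x k, expSum ξ (fun i =>
      (𝓕⁻ ((band (lam⁻¹ * (1 / 2) ^ (T - θ k))).indicator (h i)) : ℝ → ℂ) x) x
      = er (T - θ k) x + G x (θ k) := by
    intro x k
    simp only [her, hG]
    rw [← expSum_add]
    congr 1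
    funext i
    simp [leafPath, hFdef, floor_div_two_pow]
  have herm : ∀ j, Measurable (er j) := fun j => measurable_expSum ξ fun i =>
    ((hh i).indicator (measurableSet_band _)).continuous.measurable.sub (measurable_cellAvg_floor _ _)
  have hermT : Measurable fun x => varNorm r (fun k => er (T - θ k) x) ^ 2 :=
    (measurable_varNorm (a := fun k x => er (T - θ k) x) fun k => herm _).pow_const 2
  have h1 : ∫⁻ x, varNorm r (fun k => er (T - θ k) x) ^ 2 ≤ 11 * 61440 * X := by
    calc _ ≤ ∫⁻ x, 11 * ∑ j ∈ Finset.range (T + 1), ‖er j x‖ₑ ^ 2 := by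
          refine lintegral_mono fun x => ?_
          have hmon : (Monotone fun k => T - θ k) ∨ Antitone fun k => T - θ k :=
            hθ.symm.imp (fun h _ _ hk => Nat.sub_le_sub_left (h hk) T)
              (fun h _ _ hk => Nat.sub_le_sub_left (h hk) T)
          exact le_trans (by gcongr; exact varNorm_le_varNorm_two hr.le _)
            (varNorm_two_le_sum_sq hmon (fun k => Nat.sub_le _ _) (fun j => er j x))
      _ = 11 * ∑ j ∈ Finset.range (T + 1), ∫⁻ x, ‖er j x‖ₑ ^ 2 := by
          rw [lintegral_const_mul' _ _ (by simp), lintegral_finsetSum]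
          exact fun j _ => (herm j).enorm.pow_const 2
      _ ≤ 11 * (61440 * X) := by
          gcongr
          exact sum_lintegral_error_le hl hsep hh hsupp T
      _ = _ := by ring
  have h2 : ∫⁻ x, varNorm r (fun k => G x (θ k)) ^ 2
      ≤ (residualConst r + 5760) * (m₀ + 2 : ℕ) ^ 2 * X := by
    refine (lintegral_varNorm_tree_le hr hl hsep hθ hT F hF hm₀ hQ).trans ?_
    gcongr
    have e : ∀ n, ENNReal.ofReal (‖F T n‖ ^ 2) = ∑ i, ‖cellAvg lam (𝓕⁻ (h i)) n‖ₑ ^ 2 := by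
      intro n
      rw [EuclideanSpace.norm_sq_eq, ENNReal.ofReal_sum_of_nonneg fun _ _ => by positivity]
      refine Finset.sum_congr rfl fun i _ => ?_
      rw [ENNReal.ofReal_pow (norm_nonneg _), ofReal_norm]
      simp [hFdef]
    simp only [e]
    rw [Summable.tsum_finsetSum fun _ _ => ENNReal.summable, Finset.mul_sum]
    refine Finset.sum_le_sum fun i _ => ?_
    exact (tsum_cellAvg_le hl (hh i).continuous).trans (hh i).plancherel.le
  have hone : (1 : ℝ≥0∞) ≤ ((m₀ + 2 : ℕ) : ℝ≥0∞) ^ 2 :=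
    one_le_pow₀ (by exact_mod_cast (by omega : 1 ≤ m₀ + 2))
  calc _ ≤ ∫⁻ x, 2 * (varNorm r (fun k => er (T - θ k) x) ^ 2 + varNorm r (fun k => G x (θ k)) ^ 2) := by
        refine lintegral_mono fun x => ?_
        simp only [hdec]
        have h3 := varNorm_add_le (r := r) (by linarith) (fun k : ℤ => er (T - θ k) x) (fun k => G x (θ k))
        have h4 := ENNReal.rpow_add_le_mul_rpow_add_rpow (varNorm r (fun k : ℤ => er (T - θ k) x))
          (varNorm r (fun k => G x (θ k))) (p := 2) (by norm_num)
        norm_num at h4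
        exact le_trans (by gcongr) h4
    _ = 2 * (∫⁻ x, varNorm r (fun k => er (T - θ k) x) ^ 2) + 2 * ∫⁻ x, varNorm r (fun k => G x (θ k)) ^ 2 := by
        rw [lintegral_const_mul' _ _ (by simp), lintegral_add_left hermT, mul_add]
    _ ≤ 2 * (11 * 61440 * (((m₀ + 2 : ℕ) : ℝ≥0∞) ^ 2 * X))
        + 2 * ((residualConst r + 5760) * (m₀ + 2 : ℕ) ^ 2 * X) := by
        gcongr
        exact h1.trans (by gcongr; exact le_mul_of_one_le_left' hone)
    _ = _ := by
        unfold blockConst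
        ring

/-! ### Nested frequency sets. -/

section Indicator

variable {ρ : ℝ} {G : ℝ → ℂ}

theorem IsBand.fourierInv_sdiff (hG : IsBand ρ G) {s t : Set ℝ} (hs : MeasurableSet s)
    (ht : MeasurableSet t) (hst : s ⊆ t) (x : ℝ) :
    (𝓕⁻ ((t \ s).indicator G) : ℝ → ℂ) x
      = (𝓕⁻ (t.indicator G) : ℝ → ℂ) x - (𝓕⁻ (s.indicator G) : ℝ → ℂ) x := by
  rw [← fourierInv_sub' (hG.indicator ht).integrable (hG.indicator hs).integrable,
    Set.indicator_sdiff hst]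
  rfl

theorem IsBand.lintegral_fourierInv_indicator (hG : IsBand ρ G) {s : Set ℝ} (hs : MeasurableSet s) :
    ∫⁻ x, ‖(𝓕⁻ (s.indicator G) : ℝ → ℂ) x‖ₑ ^ 2 = ∫⁻ η in s, ‖G η‖ₑ ^ 2 := by
  rw [(hG.indicator hs).plancherel, lintegral_enorm_sq_indicator hs]

theorem IsBand.measurable_fourierInv (hG : IsBand ρ G) {s : Set ℝ} (hs : MeasurableSet s) :
    Measurable (𝓕⁻ (s.indicator G) : ℝ → ℂ) := (hG.indicator hs).continuous.measurable

end Indicator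

theorem add_sq_le_two_mul (x y : ℝ≥0∞) : (x + y) ^ 2 ≤ 2 * (x ^ 2 + y ^ 2) := by
  have := ENNReal.rpow_add_le_mul_rpow_add_rpow x y (p := 2) (by norm_num)
  norm_num at this
  exact this

/-- The binary digits of `q` are cleared one at a time from the lowest, ending at 0 because `q < 2 ^
L`. -/
theorem apply_eq_sum_dyadic (s : ℕ → ℂ) (L q : ℕ) (hq : q < 2 ^ L) :
    s q = s 0 + ∑ l ∈ Finset.range L,
      (s (2 ^ l * (q / 2 ^ l)) - s (2 ^ (l + 1) * (q / 2 ^ l / 2))) := by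
  have h : ∀ l, 2 ^ (l + 1) * (q / 2 ^ l / 2) = 2 ^ (l + 1) * (q / 2 ^ (l + 1)) := fun l => by
    rw [Nat.div_div_eq_div_mul, pow_succ]
  simp only [h]
  rw [Finset.sum_range_sub' (fun l => s (2 ^ l * (q / 2 ^ l)))]
  simp [Nat.div_eq_of_lt hq]

/-- A Rademacher–Menshov inequality for truncations to decreasing frequency sets. -/
theorem lintegral_varNorm_nested_le {ρ : ℝ} {G : ℝ → ℂ} (hG : IsBand ρ G) {B : ℕ → Set ℝ}
    (hB : Antitone B) (hm : ∀ q, MeasurableSet (B q)) {σ : ℤ → ℕ} (hσ : Monotone σ) {L : ℕ}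
    (hL : ∀ k, σ k < 2 ^ L) :
    ∫⁻ x, varNorm 2 (fun k => (𝓕⁻ ((B (σ k)).indicator G) : ℝ → ℂ) x) ^ 2
      ≤ 22 * (L + 1 : ℕ) ^ 2 * ∫⁻ η, ‖G η‖ₑ ^ 2 := by
  set X := ∫⁻ η, ‖G η‖ₑ ^ 2 with hX
  set s : ℕ → ℝ → ℂ := fun q => 𝓕⁻ ((B q).indicator G) with hs
  have hsm : ∀ q, Measurable (s q) := fun q => hG.measurable_fourierInv (hm q)
  set β : ℕ → ℕ → ℝ → ℂ := fun l p x => s (2 ^ l * p) x - s (2 ^ (l + 1) * (p / 2)) x with hβ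
  have hβm : ∀ l p, Measurable (β l p) := fun l p => (hsm _).sub (hsm _)
  have hβ0 : ∀ l x, β l 0 x = 0 := fun l x => by simp [hβ]
  have hβle : ∀ l p, ∫⁻ x, ‖β l (p + 1) x‖ₑ ^ 2
      ≤ ∫⁻ η in B (2 ^ l * p) \ B (2 ^ l * (p + 1)), ‖G η‖ₑ ^ 2 := by
    intro l p
    -- If `p + 1` is even, clearing its last digit changes nothing. If it is odd, the difference is
    -- a truncation to the set between consecutive multiples of `2 ^ l`, and these sets are disjoint
    -- within a level.
    rcases Nat.even_or_odd p with ⟨u, hu⟩ | ⟨u, hu⟩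
    · have e : 2 ^ (l + 1) * ((p + 1) / 2) = 2 ^ l * p := by
        rw [show (p + 1) / 2 = u by omega, hu, pow_succ]
        ring
      rw [← hG.lintegral_fourierInv_indicator ((hm _).diff (hm _))]
      refine le_of_eq (lintegral_congr fun x => ?_)
      rw [hG.fourierInv_sdiff (hm _) (hm _) (hB (Nat.mul_le_mul_left _ p.le_succ))]
      simp only [hβ, e]
      rw [enorm_sub_rev]
    · have e : 2 ^ (l + 1) * ((p + 1) / 2) = 2 ^ l * (p + 1) := by
        rw [show (p + 1) / 2 = u + 1 by omega, hu, pow_succ]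
        ring
      simp [hβ, e]
  have hlevel : ∀ l, ∫⁻ x, varNorm 2 (fun k => β l (σ k / 2 ^ l) x) ^ 2 ≤ 11 * X := by
    intro l
    calc _ ≤ ∫⁻ x, 11 * ∑ p ∈ Finset.range (2 ^ L + 1), ‖β l p x‖ₑ ^ 2 := by
          refine lintegral_mono fun x => ?_
          exact varNorm_two_le_sum_sq (θ := fun k => σ k / 2 ^ l)
            (Or.inl fun a b h => Nat.div_le_div_right (hσ h))
            (fun k => (Nat.div_le_self _ _).trans (hL k).le) (fun p => β l p x)
      _ = 11 * ∑ p ∈ Finset.range (2 ^ L), ∫⁻ x, ‖β l (p + 1) x‖ₑ ^ 2 := by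
          rw [lintegral_const_mul' _ _ (by simp), ← lintegral_finsetSum]
          · simp [Finset.sum_range_succ', hβ0]
          · exact fun p _ => (hβm l _).enorm.pow_const 2
      _ ≤ 11 * X := by
          gcongr
          refine (Finset.sum_le_sum fun p _ => hβle l p).trans ?_
          exact sum_lintegral_sdiff_le (B := fun p => B (2 ^ l * p))
            (fun a b h => hB (Nat.mul_le_mul_left _ h)) (fun p => hm _) _ _
  have hconst : ∫⁻ x, varNorm 2 (fun _ : ℤ => s 0 x) ^ 2 ≤ 11 * X := by
    calc _ ≤ ∫⁻ x, 11 * ‖s 0 x‖ₑ ^ 2 := by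
          refine lintegral_mono fun x => ?_
          simpa using varNorm_two_le_sum_sq (ι := ℤ) (θ := fun _ => 0) (m := 0)
            (Or.inl fun _ _ _ => le_rfl) (fun _ => le_rfl) (fun q => s q x)
      _ ≤ 11 * X := by
          rw [lintegral_const_mul' _ _ (by simp), hG.lintegral_fourierInv_indicator (hm 0)]
          gcongr
          exact setLIntegral_le_lintegral _ _
  have hmv : ∀ l, Measurable fun x => varNorm 2 (fun k => β l (σ k / 2 ^ l) x) ^ 2 := fun l =>
    (measurable_varNorm (a := fun k x => β l (σ k / 2 ^ l) x) fun k => hβm _ _).pow_const 2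
  have hmc : Measurable fun x => varNorm 2 (fun _ : ℤ => s 0 x) ^ 2 :=
    (measurable_varNorm (a := fun (_ : ℤ) x => s 0 x) fun k => hsm 0).pow_const 2
  calc _ ≤ ∫⁻ x, 2 * (varNorm 2 (fun _ : ℤ => s 0 x) ^ 2
        + L * ∑ l ∈ Finset.range L, varNorm 2 (fun k => β l (σ k / 2 ^ l) x) ^ 2) := by
        refine lintegral_mono fun x => ?_
        have e : (fun k => s (σ k) x)
            = fun k => s 0 x + ∑ l ∈ Finset.range L, β l (σ k / 2 ^ l) x :=
          funext fun k => apply_eq_sum_dyadic (fun q => s q x) L (σ k) (hL k)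
        change varNorm 2 (fun k => s (σ k) x) ^ 2 ≤ _
        rw [e]
        calc _ ≤ (varNorm 2 (fun _ : ℤ => s 0 x)
              + ∑ l ∈ Finset.range L, varNorm 2 (fun k => β l (σ k / 2 ^ l) x)) ^ 2 := by
              gcongr
              exact (varNorm_add_le (by norm_num) _ _).trans
                (add_le_add le_rfl (varNorm_sum_le (by norm_num) _ _))
          _ ≤ _ := by
              refine (add_sq_le_two_mul _ _).trans ?_
              gcongr
              simpa using sum_sq_le_card_mul (Finset.range L)
                (fun l => varNorm 2 (fun k => β l (σ k / 2 ^ l) x))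
    _ = 2 * ((∫⁻ x, varNorm 2 (fun _ : ℤ => s 0 x) ^ 2)
        + L * ∑ l ∈ Finset.range L, ∫⁻ x, varNorm 2 (fun k => β l (σ k / 2 ^ l) x) ^ 2) := by
        rw [lintegral_const_mul' _ _ (by simp), lintegral_add_left hmc,
          lintegral_const_mul' _ _ (by simp), lintegral_finsetSum _ fun l _ => hmv l]
    _ ≤ 2 * (11 * X + L * ∑ l ∈ Finset.range L, 11 * X) := by
        gcongr
        exact hlevel _
    _ = 22 * (1 + (L : ℝ≥0∞) ^ 2) * X := by
        rw [Finset.sum_const, Finset.card_range, nsmul_eq_mul]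
        ring
    _ ≤ _ := by
        gcongr
        exact_mod_cast (by nlinarith [Nat.zero_le L] : 1 + L ^ 2 ≤ (L + 1) ^ 2)

/-! ### Decomposition of the scales into blocks. -/

/-- The part of the `2^{-k}`-neighbourhoods of the points `ξ i` in the respective cells `Q i`. -/
def cellSet {ι : Type*} (ξ : ι → ℝ) (Q : ι → Set ℝ) (k : ℤ) : Set ℝ :=
  ⋃ i, Q i ∩ {η | |η - ξ i| < (2 : ℝ) ^ (-k)}

theorem measurableSet_near (ξ δ : ℝ) : MeasurableSet {η : ℝ | |η - ξ| < δ} :=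
  measurableSet_lt (by fun_prop) measurable_const

section Cells

variable {ι : Type*} {ξ : ι → ℝ} {Q : ι → Set ℝ}

theorem measurableSet_cellSet [Countable ι] (hQ : ∀ i, MeasurableSet (Q i)) (k : ℤ) :
    MeasurableSet (cellSet ξ Q k) :=
  MeasurableSet.iUnion fun i => (hQ i).inter (measurableSet_near _ _)

theorem two_zpow_neg_anti {k l : ℤ} (h : k ≤ l) : (2 : ℝ) ^ (-l) ≤ (2 : ℝ) ^ (-k) :=
  zpow_le_zpow_right₀ (by norm_num) (by omega)

theorem cellSet_anti : Antitone (cellSet ξ Q) := fun _ _ h =>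
  Set.iUnion_mono fun _ => Set.inter_subset_inter_right _
    fun _ hη => lt_of_lt_of_le hη (two_zpow_neg_anti h)

/-- Variational estimate over a range of scales in which a separated subfamily of the frequencies
determines the truncations. -/
theorem lintegral_varNorm_block_le [Fintype ι] {r ρ : ℝ} {G : ℝ → ℂ} (hr : 2 < r)
    (hG : IsBand ρ G) (hQm : ∀ i, MeasurableSet (Q i)) (hQd : Pairwise (Function.onFun Disjoint Q))
    {S : Set ℝ} (hS : MeasurableSet S) {act : Finset ι} (hact : ∀ i ∉ act, Q i ⊆ S)
    {k₀ k₁ : ℤ} (hsep : ∀ i ∈ act, ∀ j ∈ act, i ≠ j → (2 : ℝ) ^ (-k₀) ≤ |ξ i - ξ j|)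
    {c : ℤ → ℤ} (hc : Monotone c) (hc₀ : ∀ k, k₀ ≤ c k) (hc₁ : ∀ k, c k ≤ k₁)
    {m₀ : ℕ} (hm₀ : 1 ≤ m₀)
    (hm : √(Fintype.card ι) ^ r * ((1 / 2 : ℝ) ^ m₀) ^ (r - 2) ≤ 1) :
    ∫⁻ x, varNorm r (fun k => (𝓕⁻ ((cellSet ξ Q (c k) \ S).indicator G) : ℝ → ℂ) x) ^ 2
      ≤ blockConst r * (m₀ + 2 : ℕ) ^ 2 * ∫⁻ η in cellSet ξ Q k₀ \ S, ‖G η‖ₑ ^ 2 := by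
  set P : ℤ → ι → Set ℝ := fun k i => (Q i ∩ {η | |η - ξ i| < (2 : ℝ) ^ (-k)}) \ S with hP
  have hPm : ∀ k i, MeasurableSet (P k i) := fun k i =>
    ((hQm i).inter (measurableSet_near _ _)).diff hS
  have hPd : ∀ k, Pairwise (Function.onFun Disjoint fun i : act => P k i) := fun k i j hij =>
    (hQd (Subtype.coe_injective.ne hij)).mono (fun _ h => h.1.1) fun _ h => h.1.1
  have hPU : ∀ k, cellSet ξ Q k \ S = ⋃ i : act, P k i := by
    intro k
    ext η
    simp only [cellSet, hP, Set.mem_sdiff, Set.mem_iUnion, Set.mem_inter_iff]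
    constructor
    · rintro ⟨⟨i, hi⟩, hη⟩
      exact ⟨⟨i, by_contra fun h => hη (hact i h hi.1)⟩, hi, hη⟩
    · rintro ⟨i, hi, hη⟩
      exact ⟨⟨i, hi⟩, hη⟩
  -- Each active piece is moved to the origin. For `k ≥ k₀`, truncating to scale `k` then means
  -- restricting these fixed functions to a smaller symmetric band.
  set h : act → ℝ → ℂ := fun i η => (P k₀ i).indicator G (η + ξ i) with hh
  have hsupp : ∀ i η, h i η ≠ 0 → |η| < (2 : ℝ) ^ (-k₀) := fun i η hη => by
    simpa using (Set.mem_of_indicator_ne_zero hη).1.2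
  have hband : ∀ i, IsBand ((2 : ℝ) ^ (-k₀)) (h i) := fun i =>
    ⟨(hG.indicator (hPm k₀ i)).memLp.comp_measurePreserving (measurePreserving_add_right volume (ξ i)),
      fun η hη => by_contra fun h0 => (hsupp i η h0).not_gt hη⟩
  have hcol : ∀ k, k₀ ≤ k → ∀ x, (𝓕⁻ ((cellSet ξ Q k \ S).indicator G) : ℝ → ℂ) x
      = expSum (fun i : act => ξ i) (fun i =>
        (𝓕⁻ ((band ((2 : ℝ) ^ (-k))).indicator (h i)) : ℝ → ℂ) x) x := by
    intro k hk x
    have e1 : (cellSet ξ Q k \ S).indicator G = fun η => ∑ i : act, (P k i).indicator G η := by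
      funext η
      rw [hPU]
      by_cases hη : ∃ i : act, η ∈ P k i
      · obtain ⟨i, hi⟩ := hη
        rw [Finset.sum_eq_single i, Set.indicator_of_mem (Set.mem_iUnion.2 ⟨i, hi⟩),
          Set.indicator_of_mem hi]
        · exact fun j _ hj => Set.indicator_of_notMem
            (fun hc => Set.disjoint_left.1 (hPd k hj) hc hi) _
        · simp
      · rw [Set.indicator_of_notMem (by simpa using hη), Finset.sum_eq_zero]
        exact fun i _ => Set.indicator_of_notMem (fun hc => hη ⟨i, hc⟩) _
    rw [e1, fourierInv_finset_sum Finset.univ (h := fun i : act => (P k i).indicator G)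
      fun i _ => (hG.indicator (hPm k i)).integrable]
    unfold expSum
    refine Finset.sum_congr rfl fun i _ => ?_
    rw [fourierInv_shift _ (ξ i)]
    congr 1
    refine congrFun (congrArg _ (funext fun η => ?_)) x
    have hmem : ∀ l, η + ξ i ∈ P l i ↔ (η + ξ i ∈ Q i ∧ |η| < (2 : ℝ) ^ (-l)) ∧ η + ξ i ∉ S :=
      fun l => by simp only [hP, Set.mem_sdiff, Set.mem_inter_iff, Set.mem_ofPred_eq,
        add_sub_cancel_right]
    by_cases h1 : |η| < (2 : ℝ) ^ (-k)
    · have h2 := h1.trans_le (two_zpow_neg_anti hk)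
      rw [Set.indicator_of_mem (show η ∈ band ((2 : ℝ) ^ (-k)) from h1)]
      have h3 : η + ξ i ∈ P k i ↔ η + ξ i ∈ P k₀ i := by
        rw [hmem, hmem, iff_true_intro h1, iff_true_intro h2]
      by_cases h4 : η + ξ i ∈ P k i
      · rw [Set.indicator_of_mem h4]
        exact (Set.indicator_of_mem (h3.1 h4) G).symm
      · rw [Set.indicator_of_notMem h4]
        exact (Set.indicator_of_notMem (fun h5 => h4 (h3.2 h5)) G).symm
    · rw [Set.indicator_of_notMem (show η ∉ band ((2 : ℝ) ^ (-k)) from h1),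
        Set.indicator_of_notMem fun h2 => h1 ((hmem k).1 h2).1.2]
  have hpos : (0 : ℝ) < (2 : ℝ) ^ k₀ := by positivity
  have hinv : ((2 : ℝ) ^ k₀)⁻¹ = (2 : ℝ) ^ (-k₀) := (zpow_neg _ _).symm
  -- Larger `k` means a narrower band, hence a coarser average and an earlier martingale time; so
  -- `θ` is antitone and `T - θ k` equals `c k - k₀`.
  have key := lintegral_varNorm_separated_le (ξ := fun i : act => ξ i) (lam := (2 : ℝ) ^ k₀) (h := h)
    (T := (k₁ - k₀).toNat) (θ := fun k => (k₁ - c k).toNat) hr hpos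
    (fun i j hij => by rw [hinv]; exact hsep i i.2 j j.2 (Subtype.coe_injective.ne hij))
    (fun i => by rw [hinv]; exact hband i)
    (fun i η hη => by rw [hinv]; exact hsupp i η hη)
    (Or.inr fun a b hab => by have := hc hab; simp only; omega)
    (fun k => by have := hc₀ k; omega) hm₀
    (le_trans (by
      gcongr
      exact_mod_cast Fintype.card_le_of_injective _ Subtype.coe_injective) hm)
  have hscale : ∀ k, ((2 : ℝ) ^ k₀)⁻¹ * (1 / 2) ^ ((k₁ - k₀).toNat - (k₁ - c k).toNat)
      = (2 : ℝ) ^ (-c k) := by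
    intro k
    have e : (((k₁ - k₀).toNat - (k₁ - c k).toNat : ℕ) : ℤ) = c k - k₀ := by
      have := hc₀ k
      have := hc₁ k
      omega
    rw [hinv, one_div, inv_pow, ← zpow_natCast, e, ← zpow_neg, ← zpow_add₀ (by norm_num)]
    congr 1
    ring
  simp only [hscale] at key
  simp only [fun k x => hcol (c k) (hc₀ k) x]
  refine key.trans (le_of_eq ?_)
  congr 1
  rw [hPU, lintegral_iUnion (fun i : act => hPm k₀ i) (hPd k₀), tsum_fintype]
  refine Finset.sum_congr rfl fun i _ => ?_
  rw [← lintegral_enorm_sq_indicator (hPm k₀ i)]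
  exact lintegral_add_right_eq_self (fun η => ‖(P k₀ i).indicator G η‖ₑ ^ 2) _

end Cells

/-- The constant in the estimate for cells; `L` bounds the logarithm of the number of cells. -/
noncomputable def cellConst (r : ℝ) (L m₀ : ℕ) : ℝ≥0∞ :=
  2 * (22 * (L + 1 : ℕ) ^ 2 + (2 + 2 ^ r) ^ (2 / r) * (blockConst r * (m₀ + 2 : ℕ) ^ 2))

theorem neg_le_clamp (K : ℕ) (k : ℤ) : -(K : ℤ) ≤ clamp K k := le_max_left _ _

theorem clamp_le (K : ℕ) (k : ℤ) : clamp K k ≤ K := by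
  simp only [clamp]
  omega

/-- The embedding `ℓ² ⊂ ℓʳ` over blocks puts the estimate in a form that can be integrated block by
block. -/
theorem varNorm_blocks_sq_le {r : ℝ} (hr : 2 < r) {σ : ℤ → ℕ} (hσ : Monotone σ) {m : ℕ}
    (hm : ∀ k, σ k ≤ m) (A : ℕ → ℤ → ℂ) :
    varNorm r (fun k => A (σ k) k) ^ 2
      ≤ (2 + 2 ^ r) ^ (2 / r) * ∑ q ∈ Finset.range (m + 1), varNorm r (A q) ^ 2 := by
  have h1 := varNorm_blocks_rpow_le (r := r) (by linarith) hσ hm A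
  have h2 := sum_rpow_le_rpow_sum (Finset.range (m + 1)) (fun q => varNorm r (A q) ^ (2 : ℝ))
    (q := r / 2) (by linarith)
  simp only [← ENNReal.rpow_mul, mul_div_cancel₀ r (two_ne_zero' ℝ)] at h2
  have h3 := ENNReal.rpow_le_rpow (h1.trans (mul_le_mul' le_rfl h2)) (z := 2 / r) (by positivity)
  rw [ENNReal.mul_rpow_of_nonneg _ _ (by positivity), ← ENNReal.rpow_mul, ← ENNReal.rpow_mul,
    div_mul_div_cancel₀ (by norm_num), mul_div_cancel₀ _ (by linarith), div_self (by linarith),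
    ENNReal.rpow_one] at h3
  simpa only [ENNReal.rpow_two] using h3

section Cells

variable {ι : Type*} {ξ : ι → ℝ} {Q : ι → Set ℝ}

/-- Variational estimate for truncations to the cell sets. -/
theorem lintegral_varNorm_cellSet_le [Fintype ι] {r ρ : ℝ} {G : ℝ → ℂ} (hr : 2 < r)
    (hG : IsBand ρ G) (hQm : ∀ i, MeasurableSet (Q i)) (hQd : Pairwise (Function.onFun Disjoint Q))
    (hsep : ∀ δ i j, i ≠ j → (∃ x ∈ Q i, δ ≤ |x - ξ i|) → (∃ x ∈ Q j, δ ≤ |x - ξ j|) →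
      δ ≤ |ξ i - ξ j|)
    {L m₀ : ℕ} (hL : Fintype.card ι < 2 ^ L) (hm₀ : 1 ≤ m₀)
    (hm : √(Fintype.card ι) ^ r * ((1 / 2 : ℝ) ^ m₀) ^ (r - 2) ≤ 1) (K : ℕ) :
    ∫⁻ x, varNorm r (fun k => (𝓕⁻ ((cellSet ξ Q (clamp K k)).indicator G) : ℝ → ℂ) x) ^ 2
      ≤ cellConst r L m₀ * ∫⁻ η, ‖G η‖ₑ ^ 2 := by
  classical
  set R := cellSet ξ Q with hR
  have hRm : ∀ k, MeasurableSet (R k) := measurableSet_cellSet hQm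
  have hRa : Antitone R := cellSet_anti
  -- The cells not yet covered at scale `k`; `hsep` makes their frequencies `2⁻ᵏ`-separated. Their
  -- number `σ` indexes the blocks.
  set act : ℤ → Finset ι := fun k => Finset.univ.filter fun i => ∃ x ∈ Q i, (2 : ℝ) ^ (-k) ≤ |x - ξ i|
    with hact
  have hactm : Monotone act := fun k l hkl i hi => by
    simp only [hact, Finset.mem_filter, Finset.mem_univ, true_and] at hi ⊢
    obtain ⟨x, hx, h⟩ := hi
    exact ⟨x, hx, (two_zpow_neg_anti hkl).trans h⟩
  have hinact : ∀ k, ∀ i ∉ act k, Q i ⊆ R k := fun k i hi x hx => by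
    simp only [hact, Finset.mem_filter, Finset.mem_univ, true_and, not_exists, not_and, not_le] at hi
    exact Set.mem_iUnion.2 ⟨i, hx, hi x hx⟩
  set σ : ℤ → ℕ := fun k => (act k).card with hσ
  have hσm : Monotone σ := fun k l h => Finset.card_le_card (hactm h)
  have hσc : ∀ k, σ k ≤ Fintype.card ι := fun k => Finset.card_le_univ _
  set I : Finset ℤ := Finset.Icc (-(K : ℤ)) K with hI
  have hcI : ∀ k, clamp K k ∈ I := fun k => Finset.mem_Icc.2 ⟨neg_le_clamp K k, clamp_le K k⟩
  -- The frequencies surviving every scale of the blocks up to `q`. Intersecting with the largest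
  -- set keeps this correct when no scale has `σ k ≤ q`.
  set S : ℕ → Set ℝ := fun q => R (-(K : ℤ)) ∩ ⋂ k ∈ I.filter (fun k => σ k ≤ q), R k with hS
  have hSm : ∀ q, MeasurableSet (S q) := fun q =>
    (hRm _).inter (Finset.measurableSet_biInter _ fun k _ => hRm k)
  have hmem : ∀ q η, η ∈ S q ↔ η ∈ R (-(K : ℤ)) ∧ ∀ k ∈ I, σ k ≤ q → η ∈ R k := fun q η => by
    simp only [hS, Set.mem_inter_iff, Set.mem_iInter, Finset.mem_filter, and_imp]
  have hSa : Antitone S := fun q q' h η hη => by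
    rw [hmem] at hη ⊢
    exact ⟨hη.1, fun k hk hkq => hη.2 k hk (hkq.trans h)⟩
  have hSR : ∀ k ∈ I, S (σ k) ⊆ R k := fun k hk η hη => ((hmem _ _).1 hη).2 k hk le_rfl
  have hRS : ∀ k ∈ I, ∀ q < σ k, R k ⊆ S q := fun k hk q hq η hη => by
    rw [hmem]
    refine ⟨hRa (Finset.mem_Icc.1 hk).1 hη, fun l hl hlq => hRa ?_ hη⟩
    by_contra hc
    exact absurd (hσm (le_of_not_ge hc)) (by omega)
  -- The frequencies removed during block `q`. Later blocks live inside `S q`, so these sets are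
  -- disjoint and their energies add up.
  set D : ℕ → Set ℝ := fun q => (⋃ k ∈ I.filter (fun k => σ k = q), R k) \ S q with hD
  have hDm : ∀ q, MeasurableSet (D q) := fun q =>
    (Finset.measurableSet_biUnion _ fun k _ => hRm k).diff (hSm q)
  have hDlt : ∀ q q', q < q' → Disjoint (D q) (D q') := fun q q' h => by
    refine Set.disjoint_left.2 fun η h1 h2 => h1.2 ?_
    obtain ⟨k, hk, hη⟩ := Set.mem_iUnion₂.1 h2.1
    rw [Finset.mem_filter] at hk
    exact hRS k hk.1 q (by omega) hη
  have hDd : Pairwise (Function.onFun Disjoint D) := fun q q' h => by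
    rcases lt_or_gt_of_ne h with h | h
    · exact hDlt _ _ h
    · exact (hDlt _ _ h).symm
  have hblock : ∀ q, ∃ A : ℤ → ℝ → ℂ, (∀ k, Measurable (A k)) ∧
      (∀ k x, σ (clamp K k) = q → A k x = (𝓕⁻ ((R (clamp K k) \ S q).indicator G) : ℝ → ℂ) x) ∧
      ∫⁻ x, varNorm r (fun k => A k x) ^ 2
        ≤ blockConst r * (m₀ + 2 : ℕ) ^ 2 * ∫⁻ η in D q, ‖G η‖ₑ ^ 2 := by
    intro q
    by_cases hne : (I.filter fun k => σ k = q).Nonempty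
    · set k₀ := (I.filter fun k => σ k = q).min' hne with hk₀
      set k₁ := (I.filter fun k => σ k = q).max' hne with hk₁
      have m0 := Finset.mem_filter.1 (Finset.min'_mem _ hne)
      have m1 := Finset.mem_filter.1 (Finset.max'_mem _ hne)
      rw [← hk₀] at m0
      rw [← hk₁] at m1
      have h01 : k₀ ≤ k₁ := Finset.min'_le _ _ (Finset.max'_mem _ hne)
      -- Nested sets of equal cardinality coincide. Separation can thus be taken at the first scale
      -- of the block, and coverage of inactive cells at its last.
      have hacteq : act k₀ = act k₁ :=
        Finset.eq_of_subset_of_card_le (hactm h01) (m1.2.trans m0.2.symm).le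
      refine ⟨fun k => 𝓕⁻ ((R (max k₀ (min k₁ (clamp K k))) \ S q).indicator G),
        fun k => hG.measurable_fourierInv ((hRm _).diff (hSm q)), fun k x hk => ?_, ?_⟩
      · have hk' : clamp K k ∈ I.filter fun k => σ k = q := Finset.mem_filter.2 ⟨hcI k, hk⟩
        simp only
        rw [min_eq_right (Finset.le_max' _ _ hk'), max_eq_right (Finset.min'_le _ _ hk')]
      · refine (lintegral_varNorm_block_le (ξ := ξ) (Q := Q) hr hG hQm hQd (hSm q) (act := act k₀)
          (k₀ := k₀) (k₁ := k₁) (c := fun k => max k₀ (min k₁ (clamp K k))) ?_ ?_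
          (fun a b hab => by have := clamp_mono K hab; simp only; omega)
          (fun k => le_max_left _ _) (fun k => max_le h01 (min_le_left _ _)) hm₀ hm).trans ?_
        · intro i hi η hη
          rw [hmem]
          rw [hacteq] at hi
          have hηk := hinact k₁ i hi hη
          refine ⟨hRa (Finset.mem_Icc.1 m1.1).1 hηk, fun l hl hlq => hRa ?_ hηk⟩
          by_contra hc
          have h1 := hσm (le_of_not_ge hc)
          exact hc (Finset.le_max' _ _ (Finset.mem_filter.2 ⟨hl, by omega⟩))
        · intro i hi j hj hij
          exact hsep _ i j hij (Finset.mem_filter.1 hi).2 (Finset.mem_filter.1 hj).2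
        · exact mul_le_mul' le_rfl (lintegral_mono_set fun η hη =>
            ⟨Set.mem_iUnion₂.2 ⟨k₀, Finset.mem_filter.2 m0, hη.1⟩, hη.2⟩)
    · refine ⟨fun _ _ => 0, fun _ => measurable_const, fun k x hk => ?_, ?_⟩
      · exact absurd ⟨clamp K k, Finset.mem_filter.2 ⟨hcI k, hk⟩⟩ hne
      · simp [varNorm_zero (show 0 < r by linarith)]
  choose A hAm hAeq hAle using hblock
  set τ : ℤ → ℕ := fun k => σ (clamp K k) with hτ
  have hτm : Monotone τ := hσm.comp (clamp_mono K)
  set X := ∫⁻ η, ‖G η‖ₑ ^ 2 with hX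
  have hS2 := lintegral_varNorm_nested_le hG hSa hSm hτm (L := L) fun k => (hσc _).trans_lt hL
  have hSmeas : Measurable fun x =>
      varNorm 2 (fun k => (𝓕⁻ ((S (τ k)).indicator G) : ℝ → ℂ) x) ^ 2 :=
    (measurable_varNorm (a := fun k => (𝓕⁻ ((S (τ k)).indicator G) : ℝ → ℂ))
      fun k => hG.measurable_fourierInv (hSm _)).pow_const 2
  have hDsum : ∑ q ∈ Finset.range (Fintype.card ι + 1), ∫⁻ η in D q, ‖G η‖ₑ ^ 2 ≤ X := by
    rw [← lintegral_biUnion_finset (fun a _ b _ h => hDd h) fun q _ => hDm q]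
    exact setLIntegral_le_lintegral _ _
  calc _ ≤ ∫⁻ x, 2 * (varNorm 2 (fun k => (𝓕⁻ ((S (τ k)).indicator G) : ℝ → ℂ) x) ^ 2
        + (2 + 2 ^ r) ^ (2 / r) * ∑ q ∈ Finset.range (Fintype.card ι + 1),
          varNorm r (fun k => A q k x) ^ 2) := by
        refine lintegral_mono fun x => ?_
        have e : ∀ k, (𝓕⁻ ((R (clamp K k)).indicator G) : ℝ → ℂ) x
            = (𝓕⁻ ((S (τ k)).indicator G) : ℝ → ℂ) x + A (τ k) k x := fun k => by
          rw [hAeq (τ k) k x rfl, hG.fourierInv_sdiff (hSm _) (hRm _) (hSR _ (hcI k))]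
          ring
        simp only [e]
        calc _ ≤ (varNorm 2 (fun k => (𝓕⁻ ((S (τ k)).indicator G) : ℝ → ℂ) x)
              + varNorm r (fun k => A (τ k) k x)) ^ 2 := by
              gcongr
              exact (varNorm_add_le (by linarith) _ _).trans
                (add_le_add (varNorm_le_varNorm_two hr.le _) le_rfl)
          _ ≤ _ := by
              refine (add_sq_le_two_mul _ _).trans ?_
              gcongr
              exact varNorm_blocks_sq_le hr hτm (fun k => hσc _) (fun q k => A q k x)
    _ = 2 * ((∫⁻ x, varNorm 2 (fun k => (𝓕⁻ ((S (τ k)).indicator G) : ℝ → ℂ) x) ^ 2)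
        + (2 + 2 ^ r) ^ (2 / r) * ∑ q ∈ Finset.range (Fintype.card ι + 1),
          ∫⁻ x, varNorm r (fun k => A q k x) ^ 2) := by
        have hfin : (2 + 2 ^ r : ℝ≥0∞) ^ (2 / r) ≠ ∞ := by
          refine ENNReal.rpow_ne_top_of_nonneg (by positivity) ?_
          exact ENNReal.add_ne_top.2 ⟨by simp,
            ENNReal.rpow_ne_top_of_nonneg (by linarith) (by simp)⟩
        rw [lintegral_const_mul' _ _ (by simp), lintegral_add_left hSmeas,
          lintegral_const_mul' _ _ hfin, lintegral_finsetSum]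
        exact fun q _ => (measurable_varNorm (hAm q)).pow_const 2
    _ ≤ 2 * (22 * (L + 1 : ℕ) ^ 2 * X + (2 + 2 ^ r) ^ (2 / r) *
        (blockConst r * (m₀ + 2 : ℕ) ^ 2 * X)) := by
        gcongr
        refine (Finset.sum_le_sum fun q _ => hAle q).trans ?_
        rw [← Finset.mul_sum]
        gcongr
    _ = _ := by
        unfold cellConst
        ring

end Cells

/-! ### One-sided Voronoi cells. -/

/-- The points to the right of `ξ i` for which `ξ i` is a nearest frequency. -/
def rightCell {ι : Type*} (ξ : ι → ℝ) (i : ι) : Set ℝ :=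
  {x | ξ i < x} ∩ ⋂ j, {x | |x - ξ i| ≤ |x - ξ j|}

/-- The remaining points to the left of `ξ i` for which `ξ i` is a nearest frequency. -/
def leftCell {ι : Type*} (ξ : ι → ℝ) (i : ι) : Set ℝ :=
  ({x | x ≤ ξ i} ∩ ⋂ j, {x | |x - ξ i| ≤ |x - ξ j|}) \ ⋃ j, rightCell ξ j

section Voronoi

variable {ι : Type*} {ξ : ι → ℝ}

theorem mem_rightCell {i : ι} {x : ℝ} :
    x ∈ rightCell ξ i ↔ ξ i < x ∧ ∀ j, |x - ξ i| ≤ |x - ξ j| := by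
  simp [rightCell]

theorem leftCell_spec {i : ι} {x : ℝ} (hx : x ∈ leftCell ξ i) :
    x ≤ ξ i ∧ ∀ j, |x - ξ i| ≤ |x - ξ j| := by
  simpa using hx.1

theorem measurableSet_nearest [Countable ι] (ξ : ι → ℝ) (i : ι) :
    MeasurableSet (⋂ j, {x : ℝ | |x - ξ i| ≤ |x - ξ j|}) :=
  MeasurableSet.iInter fun _ => measurableSet_le (by fun_prop) (by fun_prop)

theorem measurableSet_rightCell [Countable ι] (i : ι) : MeasurableSet (rightCell ξ i) :=
  measurableSet_Ioi.inter (measurableSet_nearest ξ i)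

theorem measurableSet_leftCell [Countable ι] (i : ι) : MeasurableSet (leftCell ξ i) :=
  (measurableSet_Iic.inter (measurableSet_nearest ξ i)).diff
    (MeasurableSet.iUnion fun j => measurableSet_rightCell j)

theorem pairwise_disjoint_rightCell (hξ : Function.Injective ξ) :
    Pairwise (Function.onFun Disjoint (rightCell ξ)) := fun i j hij => by
  refine Set.disjoint_left.2 fun x h1 h2 => hij (hξ ?_)
  rw [mem_rightCell] at h1 h2
  have := le_antisymm (h1.2 j) (h2.2 i)
  rw [abs_of_pos (by linarith [h1.1]), abs_of_pos (by linarith [h2.1])] at this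
  linarith

theorem pairwise_disjoint_leftCell (hξ : Function.Injective ξ) :
    Pairwise (Function.onFun Disjoint (leftCell ξ)) := fun i j hij => by
  refine Set.disjoint_left.2 fun x h1 h2 => hij (hξ ?_)
  replace h1 := leftCell_spec h1
  replace h2 := leftCell_spec h2
  have := le_antisymm (h1.2 j) (h2.2 i)
  rw [abs_of_nonpos (by linarith [h1.1]), abs_of_nonpos (by linarith [h2.1])] at this
  linarith

/-- Since `x` is to the right of `ξ i` and no nearer to `ξ j`, it cannot pass the midpoint between
them. -/
theorem le_abs_sub_of_mem_rightCell {i j : ι} {x : ℝ} (hx : x ∈ rightCell ξ i) (hij : ξ i < ξ j) :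
    |x - ξ i| ≤ |ξ i - ξ j| := by
  rw [mem_rightCell] at hx
  have h := hx.2 j
  rw [abs_of_pos (sub_pos.2 hx.1)] at h ⊢
  rw [abs_of_neg (sub_neg.2 hij)]
  rcases abs_cases (x - ξ j) with ⟨h1, -⟩ | ⟨h1, h2⟩ <;> linarith

theorem le_abs_sub_of_mem_leftCell {i j : ι} {x : ℝ} (hx : x ∈ leftCell ξ i) (hij : ξ j < ξ i) :
    |x - ξ i| ≤ |ξ i - ξ j| := by
  replace hx := leftCell_spec hx
  have h := hx.2 j
  rw [abs_of_nonpos (sub_nonpos.2 hx.1)] at h ⊢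
  rw [abs_of_pos (sub_pos.2 hij)]
  rcases abs_cases (x - ξ j) with ⟨h1, -⟩ | ⟨h1, h2⟩ <;> linarith

/-- Of two frequencies, the right cell of the left one points towards the other, so its extent is
limited by their gap. Two-sided cells would fail: two close frequencies alone on the line both have
unbounded cells. -/
theorem separated_rightCell (hξ : Function.Injective ξ) (δ : ℝ) (i j : ι) (hij : i ≠ j)
    (hi : ∃ x ∈ rightCell ξ i, δ ≤ |x - ξ i|) (hj : ∃ x ∈ rightCell ξ j, δ ≤ |x - ξ j|) :
    δ ≤ |ξ i - ξ j| := by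
  obtain ⟨x, hx, hxδ⟩ := hi
  obtain ⟨y, hy, hyδ⟩ := hj
  rcases lt_or_gt_of_ne (hξ.ne hij) with h | h
  · exact hxδ.trans (le_abs_sub_of_mem_rightCell hx h)
  · rw [abs_sub_comm]
    exact hyδ.trans (le_abs_sub_of_mem_rightCell hy h)

theorem separated_leftCell (hξ : Function.Injective ξ) (δ : ℝ) (i j : ι) (hij : i ≠ j)
    (hi : ∃ x ∈ leftCell ξ i, δ ≤ |x - ξ i|) (hj : ∃ x ∈ leftCell ξ j, δ ≤ |x - ξ j|) :
    δ ≤ |ξ i - ξ j| := by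
  obtain ⟨x, hx, hxδ⟩ := hi
  obtain ⟨y, hy, hyδ⟩ := hj
  rcases lt_or_gt_of_ne (hξ.ne hij) with h | h
  · rw [abs_sub_comm]
    exact hyδ.trans (le_abs_sub_of_mem_leftCell hy h)
  · exact hxδ.trans (le_abs_sub_of_mem_leftCell hx h)

theorem disjoint_cellSet_right_left (k : ℤ) :
    Disjoint (cellSet ξ (rightCell ξ) k) (cellSet ξ (leftCell ξ) k) := by
  refine Set.disjoint_left.2 fun x h1 h2 => ?_
  obtain ⟨i, hi, -⟩ := Set.mem_iUnion.1 h1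
  obtain ⟨j, hj, -⟩ := Set.mem_iUnion.1 h2
  exact hj.2 (Set.mem_iUnion.2 ⟨i, hi⟩)

end Voronoi

/-! ### Assembly and choice of parameters. -/

theorem mem_freqSet {N : ℕ} {ξ : Fin N → ℝ} {k : ℤ} {η : ℝ} :
    η ∈ freqSet ξ k ↔ ∃ i, |η - ξ i| < (2 : ℝ) ^ (-k) := by
  simp only [freqSet, Set.mem_iUnion, Set.mem_Ioo, abs_lt]
  refine exists_congr fun i => ?_
  constructor <;> rintro ⟨h1, h2⟩ <;> constructor <;> linarith

theorem freqSet_eq_union {N : ℕ} (ξ : Fin N → ℝ) (k : ℤ) :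
    freqSet ξ k = cellSet ξ (rightCell ξ) k ∪ cellSet ξ (leftCell ξ) k := by
  ext η
  rw [mem_freqSet]
  constructor
  · rintro ⟨i₀, hi₀⟩
    obtain ⟨i, -, hi⟩ := Finset.exists_min_image Finset.univ (fun i => |η - ξ i|) ⟨i₀, Finset.mem_univ _⟩
    have hnear : ∀ j, |η - ξ i| ≤ |η - ξ j| := fun j => hi j (Finset.mem_univ _)
    by_cases hU : η ∈ ⋃ j, rightCell ξ j
    · obtain ⟨j, hj⟩ := Set.mem_iUnion.1 hU
      exact Or.inl (Set.mem_iUnion.2 ⟨j, hj, ((mem_rightCell.1 hj).2 i₀).trans_lt hi₀⟩)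
    · refine Or.inr (Set.mem_iUnion.2 ⟨i, ⟨⟨?_, Set.mem_iInter.2 hnear⟩, hU⟩,
        (hnear i₀).trans_lt hi₀⟩)
      exact not_lt.1 fun h => hU (Set.mem_iUnion.2 ⟨i, mem_rightCell.2 ⟨h, hnear⟩⟩)
  · rintro (h | h) <;>
    · obtain ⟨i, -, hi⟩ := Set.mem_iUnion.1 h
      exact ⟨i, hi⟩

theorem freqSet_anti {N : ℕ} (ξ : Fin N → ℝ) : Antitone (freqSet ξ) := fun k l h η hη => by
  rw [mem_freqSet] at hη ⊢
  exact hη.imp fun i hi => hi.trans_le (two_zpow_neg_anti h)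

theorem isBand_indicator_freqSet {N : ℕ} (ξ : Fin N → ℝ) (k : ℤ) {G : ℝ → ℂ}
    (hG : MemLp G 2 volume) :
    IsBand (∑ i, |ξ i| + (2 : ℝ) ^ (-k)) ((freqSet ξ k).indicator G) := by
  refine ⟨hG.indicator (measurableSet_freqSet ξ k), fun η hη => Set.indicator_of_notMem ?_ _⟩
  rw [mem_freqSet]
  rintro ⟨i, hi⟩
  have h1 : |ξ i| ≤ ∑ i, |ξ i| :=
    Finset.single_le_sum (f := fun i => |ξ i|) (fun _ _ => abs_nonneg _) (Finset.mem_univ i)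
  have h2 : |η| ≤ |η - ξ i| + |ξ i| := by simpa using abs_add_le (η - ξ i) (ξ i)
  linarith

theorem freqProj_ae_eq {N : ℕ} (ξ : Fin N → ℝ) (k : ℤ) (f : Lp ℂ 2 (volume : Measure ℝ)) :
    freqProj ξ k f =ᵐ[volume]
      (𝓕⁻ ((freqSet ξ k).indicator (𝓕 f : Lp ℂ 2 (volume : Measure ℝ))) : ℝ → ℂ) :=
  fourierInv_toLp_ae_eq (isBand_indicator_freqSet ξ k (Lp.memLp _)).integrable _

/-- The estimate with an explicit constant, for truncated ranges of scales. -/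
theorem lintegral_varNorm_freqSet_clamp_le {N : ℕ} {ξ : Fin N → ℝ} (hξ : Function.Injective ξ)
    {r : ℝ} {G : ℝ → ℂ} (hr : 2 < r) (hG : MemLp G 2 volume) {L m₀ : ℕ} (hL : N < 2 ^ L)
    (hm₀ : 1 ≤ m₀) (hm : √N ^ r * ((1 / 2 : ℝ) ^ m₀) ^ (r - 2) ≤ 1) (K : ℕ) :
    ∫⁻ x, varNorm r (fun k => (𝓕⁻ ((freqSet ξ (clamp K k)).indicator G) : ℝ → ℂ) x) ^ 2
      ≤ 4 * cellConst r L m₀ * ∫⁻ η, ‖G η‖ₑ ^ 2 := by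
  -- Restricting to the largest set in the window changes none of the truncations and makes the
  -- support bounded.
  set G' := (freqSet ξ (-(K : ℤ))).indicator G with hG'
  have hband := isBand_indicator_freqSet ξ (-(K : ℤ)) hG
  rw [← hG'] at hband
  have hle : ∫⁻ η, ‖G' η‖ₑ ^ 2 ≤ ∫⁻ η, ‖G η‖ₑ ^ 2 := by
    rw [hG', lintegral_enorm_sq_indicator (measurableSet_freqSet _ _)]
    exact setLIntegral_le_lintegral _ _
  have hRm := fun k => measurableSet_cellSet (ξ := ξ) (Q := rightCell ξ) measurableSet_rightCell k
  have hLm := fun k => measurableSet_cellSet (ξ := ξ) (Q := leftCell ξ) measurableSet_leftCell k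
  have e : ∀ k x, (𝓕⁻ ((freqSet ξ (clamp K k)).indicator G) : ℝ → ℂ) x
      = (𝓕⁻ ((cellSet ξ (rightCell ξ) (clamp K k)).indicator G') : ℝ → ℂ) x
        + (𝓕⁻ ((cellSet ξ (leftCell ξ) (clamp K k)).indicator G') : ℝ → ℂ) x := by
    intro k x
    have e1 : (freqSet ξ (clamp K k)).indicator G = (freqSet ξ (clamp K k)).indicator G' := by
      rw [hG', Set.indicator_indicator,
        Set.inter_eq_left.2 (freqSet_anti ξ (neg_le_clamp K k))]
    have e2 := hband.fourierInv_sdiff (hRm (clamp K k)) (measurableSet_freqSet ξ (clamp K k))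
      (by rw [freqSet_eq_union]; exact Set.subset_union_left) x
    rw [freqSet_eq_union, Set.union_sdiff_left,
      (disjoint_cellSet_right_left (clamp K k)).symm.sdiff_eq_left] at e2
    rw [e1, freqSet_eq_union, e2]
    ring
  have hcard : Fintype.card (Fin N) = N := Fintype.card_fin N
  have h1 := lintegral_varNorm_cellSet_le hr hband measurableSet_rightCell
    (pairwise_disjoint_rightCell hξ) (separated_rightCell hξ) (by rwa [hcard]) hm₀
    (by rwa [hcard]) K
  have h2 := lintegral_varNorm_cellSet_le hr hband measurableSet_leftCell
    (pairwise_disjoint_leftCell hξ) (separated_leftCell hξ) (by rwa [hcard]) hm₀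
    (by rwa [hcard]) K
  calc _ ≤ ∫⁻ x, 2 * (varNorm r (fun k =>
          (𝓕⁻ ((cellSet ξ (rightCell ξ) (clamp K k)).indicator G') : ℝ → ℂ) x) ^ 2
        + varNorm r (fun k =>
          (𝓕⁻ ((cellSet ξ (leftCell ξ) (clamp K k)).indicator G') : ℝ → ℂ) x) ^ 2) := by
        refine lintegral_mono fun x => ?_
        simp only [e]
        refine le_trans ?_ (add_sq_le_two_mul _ _)
        gcongr
        exact varNorm_add_le (by linarith) _ _
    _ ≤ 2 * (cellConst r L m₀ * (∫⁻ η, ‖G η‖ₑ ^ 2) + cellConst r L m₀ * ∫⁻ η, ‖G η‖ₑ ^ 2) := by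
        rw [lintegral_const_mul' _ _ (by simp), lintegral_add_left]
        · exact mul_le_mul' le_rfl (add_le_add (h1.trans (mul_le_mul' le_rfl hle))
            (h2.trans (mul_le_mul' le_rfl hle)))
        · exact (measurable_varNorm
            (a := fun k => (𝓕⁻ ((cellSet ξ (rightCell ξ) (clamp K k)).indicator G') : ℝ → ℂ))
            fun k => hband.measurable_fourierInv (hRm _)).pow_const 2
    _ = _ := by ring

theorem lintegral_sq_le_of_liminf {α : Type*} [MeasurableSpace α] {μ : Measure α}
    {u : α → ℝ≥0∞} {v : ℕ → α → ℝ≥0∞} (hv : ∀ n, Measurable (v n)) {C : ℝ≥0∞}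
    (hu : ∀ x, u x ≤ Filter.liminf (fun n => v n x) Filter.atTop)
    (hC : ∀ n, ∫⁻ x, v n x ^ 2 ∂μ ≤ C) : ∫⁻ x, u x ^ 2 ∂μ ≤ C := by
  calc _ ≤ ∫⁻ x, Filter.liminf (fun n => v n x ^ 2) Filter.atTop ∂μ := by
        refine lintegral_mono fun x => ?_
        have hmono : Monotone fun y : ℝ≥0∞ => y ^ 2 := fun _ _ h => pow_le_pow_left' h 2
        refine (hmono (hu x)).trans (le_of_eq ?_)
        exact hmono.map_liminf_of_continuousAt _ (ENNReal.continuous_pow 2).continuousAt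
    _ ≤ Filter.liminf (fun n => ∫⁻ x, v n x ^ 2 ∂μ) Filter.atTop :=
        lintegral_liminf_le fun n => (hv n).pow_const 2
    _ ≤ C := Filter.liminf_le_of_frequently_le' (Filter.Frequently.of_forall hC)

theorem lintegral_fourier_sq (f : Lp ℂ 2 (volume : Measure ℝ)) :
    ∫⁻ η, ‖(𝓕 f : Lp ℂ 2 (volume : Measure ℝ)) η‖ₑ ^ 2 = eLpNorm f 2 volume ^ 2 := by
  have : ‖(𝓕 f : Lp ℂ 2 (volume : Measure ℝ))‖ = ‖f‖ := (Lp.fourierTransformₗᵢ ℝ ℂ).norm_map _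
  rw [← eLpNorm_two_sq, ← Lp.enorm_def, ← Lp.enorm_def, ← ofReal_norm, this, ofReal_norm]

theorem eLpNorm_varNorm_freqProj_sq_le {N : ℕ} {ξ : Fin N → ℝ} (hξ : Function.Injective ξ)
    {r : ℝ} (hr : 2 < r) {L m₀ : ℕ} (hL : N < 2 ^ L) (hm₀ : 1 ≤ m₀)
    (hm : √N ^ r * ((1 / 2 : ℝ) ^ m₀) ^ (r - 2) ≤ 1) (f : Lp ℂ 2 (volume : Measure ℝ)) :
    eLpNorm (fun x : ℝ => varNorm r (fun k : ℤ => freqProj ξ k f x)) 2 volume ^ 2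
      ≤ 4 * cellConst r L m₀ * eLpNorm f 2 volume ^ 2 := by
  set G : ℝ → ℂ := ⇑(𝓕 f : Lp ℂ 2 (volume : Measure ℝ)) with hGdef
  have hG : MemLp G 2 volume := Lp.memLp _
  have hae : (fun x : ℝ => varNorm r (fun k : ℤ => freqProj ξ k f x)) =ᵐ[volume]
      fun x => varNorm r (fun k => (𝓕⁻ ((freqSet ξ k).indicator G) : ℝ → ℂ) x) := by
    filter_upwards [ae_all_iff.2 fun k => freqProj_ae_eq ξ k f] with x hx
    simp only [hx, hGdef]
  rw [eLpNorm_congr_ae hae, eLpNorm_two_sq, ← lintegral_fourier_sq]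
  simp only [enorm_eq_self]
  refine lintegral_sq_le_of_liminf (v := fun K x =>
    varNorm r (fun k => (𝓕⁻ ((freqSet ξ (clamp K k)).indicator G) : ℝ → ℂ) x)) (fun K => ?_)
    (fun x => varNorm_le_liminf_clamp r _)
    (fun K => lintegral_varNorm_freqSet_clamp_le hξ hr hG hL hm₀ hm K)
  exact measurable_varNorm (a := fun k => (𝓕⁻ ((freqSet ξ (clamp K k)).indicator G) : ℝ → ℂ))
    fun k => (isBand_indicator_freqSet ξ _ hG).continuous.measurable

/-- This fixes the number of levels `m₀ = D * L`: the loss is at most `2 ^ (L r / 2)` and the gain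
is `2 ^ (-D L (r - 2))`. -/
theorem sqrt_rpow_mul_le_one {N L D : ℕ} {r : ℝ} (hr : 2 < r) (hL : N ≤ 2 ^ L)
    (hD : r / (2 * (r - 2)) ≤ D) :
    √N ^ r * ((1 / 2 : ℝ) ^ (D * L)) ^ (r - 2) ≤ 1 := by
  have h2 : (0 : ℝ) < 2 := two_pos
  have e1 : √(N : ℝ) ^ r ≤ (2 : ℝ) ^ (L * (r / 2)) := by
    calc √(N : ℝ) ^ r = (N : ℝ) ^ (r / 2) := by
          rw [Real.sqrt_eq_rpow, ← Real.rpow_mul (Nat.cast_nonneg N)]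
          congr 1
          ring
      _ ≤ ((2 : ℝ) ^ (L : ℝ)) ^ (r / 2) := by
          gcongr
          rw [Real.rpow_natCast]
          exact_mod_cast hL
      _ = _ := by rw [← Real.rpow_mul h2.le]
  have e2 : ((1 / 2 : ℝ) ^ (D * L)) ^ (r - 2) = (2 : ℝ) ^ (-(D * L * (r - 2)) : ℝ) := by
    rw [one_div, inv_pow, ← Real.rpow_natCast, Real.inv_rpow (by positivity), ← Real.rpow_mul h2.le,
      ← Real.rpow_neg h2.le]
    push_cast
    rfl
  rw [e2]
  calc _ ≤ (2 : ℝ) ^ (L * (r / 2)) * (2 : ℝ) ^ (-(D * L * (r - 2)) : ℝ) := by gcongr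
    _ = (2 : ℝ) ^ (L * (r / 2) + -(D * L * (r - 2)) : ℝ) := by rw [Real.rpow_add h2]
    _ ≤ 1 := by
      refine Real.rpow_le_one_of_one_le_of_nonpos (by norm_num) ?_
      rw [div_le_iff₀ (by linarith)] at hD
      nlinarith [Nat.cast_nonneg (α := ℝ) L]

theorem natLog_succ_le {ε : ℝ} (hε : 0 < ε) {N : ℕ} (hN : 1 ≤ N) :
    ((Nat.log 2 N + 1 : ℕ) : ℝ) ≤ (1 / (ε * Real.log 2) + 1) * (N : ℝ) ^ ε := by
  have hN0 : (0 : ℝ) < N := by exact_mod_cast hN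
  have h1 : (Nat.log 2 N : ℝ) * Real.log 2 ≤ Real.log N := by
    rw [← Real.log_pow]
    refine Real.log_le_log (by positivity) ?_
    exact_mod_cast Nat.pow_log_le_self 2 (by omega)
  have h2 := Real.log_le_rpow_div hN0.le hε
  have h3 : (1 : ℝ) ≤ (N : ℝ) ^ ε := Real.one_le_rpow (by exact_mod_cast hN) hε.le
  have hl := Real.log_pos one_lt_two
  push_cast
  rw [add_mul, one_mul]
  refine add_le_add ?_ h3
  rw [div_mul_eq_mul_div, one_mul, le_div_iff₀ (by positivity)]
  rw [le_div_iff₀ hε] at h2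
  nlinarith

/-- The coefficient of `L ^ 2` in the upper bound for `cellConst r L (D * L)`. -/
noncomputable def growthConst (r : ℝ) (D : ℕ) : ℝ≥0∞ :=
  2 * (88 + (2 + 2 ^ r) ^ (2 / r) * (blockConst r * (3 * D : ℕ) ^ 2))

theorem growthConst_ne_top {r : ℝ} (hr : 2 < r) (D : ℕ) : growthConst r D ≠ ∞ := by
  have h1 := blockConst_ne_top hr
  have h2 : (2 + 2 ^ r : ℝ≥0∞) ^ (2 / r) ≠ ∞ := by
    refine ENNReal.rpow_ne_top_of_nonneg (by positivity) ?_
    exact ENNReal.add_ne_top.2 ⟨by simp, ENNReal.rpow_ne_top_of_nonneg (by linarith) (by simp)⟩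
  unfold growthConst
  generalize (2 + 2 ^ r : ℝ≥0∞) ^ (2 / r) = c at h2
  finiteness

theorem cellConst_le (r : ℝ) {L D : ℕ} (hL : 1 ≤ L) (hD : 1 ≤ D) :
    cellConst r L (D * L) ≤ growthConst r D * (L : ℝ≥0∞) ^ 2 := by
  have hDL : 1 ≤ D * L := Nat.mul_pos hD hL
  have h1 : ((L + 1 : ℕ) : ℝ≥0∞) ≤ 2 * L := by exact_mod_cast (by omega : L + 1 ≤ 2 * L)
  have h2 : ((D * L + 2 : ℕ) : ℝ≥0∞) ≤ (3 * D : ℕ) * L := by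
    exact_mod_cast (by rw [mul_assoc]; omega : D * L + 2 ≤ 3 * D * L)
  unfold cellConst growthConst
  calc _ ≤ 2 * (22 * (2 * (L : ℝ≥0∞)) ^ 2
        + (2 + 2 ^ r) ^ (2 / r) * (blockConst r * ((3 * D : ℕ) * (L : ℝ≥0∞)) ^ 2)) := by gcongr
    _ = _ := by ring

end MultiFreq

theorem theorem7p1 (r : ℝ) (hr : 2 < r) (ε : ℝ) (hε : 0 < ε) :
    ∃ C : ℝ≥0, ∀ (N : ℕ) (ξ : Fin N → ℝ), StrictMono ξ →
      ∀ f : Lp ℂ 2 (volume : Measure ℝ),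
        eLpNorm (fun x : ℝ => MultiFreq.varNorm r (fun k : ℤ => MultiFreq.freqProj ξ k f x))
            2 volume
          ≤ (C : ℝ≥0∞) * (N : ℝ≥0∞) ^ ε * eLpNorm f 2 volume := by
  set D := ⌈r / (2 * (r - 2))⌉₊ with hDdef
  have hD1 : 1 ≤ D := Nat.ceil_pos.2 (div_pos (by linarith) (by linarith))
  set M := 4 * MultiFreq.growthConst r D with hM
  have hMfin : M ≠ ∞ := ENNReal.mul_ne_top (by simp) (MultiFreq.growthConst_ne_top hr D)
  set c := ENNReal.ofReal (1 / (ε * Real.log 2) + 1) with hc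
  have hCfin : M ^ (1 / 2 : ℝ) * c ≠ ∞ :=
    ENNReal.mul_ne_top (ENNReal.rpow_ne_top_of_nonneg (by norm_num) hMfin) ENNReal.ofReal_ne_top
  refine ⟨(M ^ (1 / 2 : ℝ) * c).toNNReal, fun N ξ hξ f => ?_⟩
  rw [ENNReal.coe_toNNReal hCfin]
  -- For `N = 0` the factor `N ^ ε` vanishes, so the left side has to be shown to be zero.
  rcases Nat.eq_zero_or_pos N with rfl | hN
  · have hae : (fun x : ℝ => MultiFreq.varNorm r (fun k : ℤ => MultiFreq.freqProj ξ k f x))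
        =ᵐ[volume] fun _ => 0 := by
      filter_upwards [ae_all_iff.2 fun k => MultiFreq.freqProj_ae_eq ξ k f] with x hx
      have h0 : ∀ k, MultiFreq.freqSet ξ k = ∅ := fun k => by simp [MultiFreq.freqSet]
      simp only [hx, h0, Set.indicator_empty]
      simp [MultiFreq.fourierInv_apply, MultiFreq.varNorm_zero (show 0 < r by linarith)]
    rw [eLpNorm_congr_ae hae]
    simp
  -- The squared norm costs a multiple of `L ^ 2`, so the loss is linear in `log N` before it is
  -- traded for `N ^ ε`.
  · set L := Nat.log 2 N + 1 with hL
    have hNL : N < 2 ^ L := Nat.lt_pow_succ_log_self one_lt_two N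
    have hLc : (L : ℝ≥0∞) ≤ c * (N : ℝ≥0∞) ^ ε := by
      have := ENNReal.ofReal_le_ofReal (MultiFreq.natLog_succ_le hε hN)
      rw [ENNReal.ofReal_natCast, ENNReal.ofReal_mul' (by positivity),
        ← ENNReal.ofReal_rpow_of_nonneg (Nat.cast_nonneg N) hε.le, ENNReal.ofReal_natCast] at this
      exact this
    have key := MultiFreq.eLpNorm_varNorm_freqProj_sq_le hξ.injective hr hNL
      (m₀ := D * L) (Nat.mul_pos hD1 (Nat.succ_pos _))
      (MultiFreq.sqrt_rpow_mul_le_one hr hNL.le (Nat.le_ceil _)) f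
    refine (ENNReal.pow_le_pow_left_iff two_ne_zero).1 (key.trans ?_)
    have hsq : (M ^ (1 / 2 : ℝ)) ^ 2 = M := by
      rw [← ENNReal.rpow_two, ← ENNReal.rpow_mul]
      norm_num
    calc _ ≤ 4 * (MultiFreq.growthConst r D * (L : ℝ≥0∞) ^ 2) * eLpNorm f 2 volume ^ 2 := by
          gcongr
          exact MultiFreq.cellConst_le r (Nat.succ_pos _) hD1
      _ = M * (L : ℝ≥0∞) ^ 2 * eLpNorm f 2 volume ^ 2 := by
          rw [hM]
          ring
      _ ≤ M * (c * (N : ℝ≥0∞) ^ ε) ^ 2 * eLpNorm f 2 volume ^ 2 := by gcongr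
      _ = (M ^ (1 / 2 : ℝ)) ^ 2 * (c * (N : ℝ≥0∞) ^ ε) ^ 2 * eLpNorm f 2 volume ^ 2 := by rw [hsq]
      _ = _ := by ring
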